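/- Let $L_1=\langle O,F,E,\mathrm{eval}\rangle$ and let $T_1$ be the theory stating that $O$ and $F$ are disjoint sorts whose union is the universe, $E$ is an equivalence relation on $O$, and $\mathrm{eval}\colon F\times O\to O$ satisfies, for all $f\in F$ and $b,b'\in O$, $E(\mathrm{eval}(f,b),b)$, and $E(b,b')\Rightarrow \mathrm{eval}(f,b)=\mathrm{eval}(f,b')$ (each $\mathrm{eval}(f,-)$ is a selector function for $E$). Let $T^*_1$ be the theory of the Fraïssé limit of the class of finite models of $T_1$. For a model $M$, a set $A\subseteq M$ and a tuple $b$ in $M$: a formula $\varphi(x;b)$ *divides* over $A$ if, in some elementary extension of $M$, there is an $A$-indiscernible sequence $(b_i)_{i<\omega}$ with $b_0=b$ such that $\{\varphi(x;b_i):i<\omega\}$ is inconsistent; it *forks* over $A$ if, in some elementary extension of $M$, it implies a finite disjunction $\bigvee_i\psi_i(x;c_i)$ with each $\psi_i(x;c_i)$ dividing over $A$. A complete type over $M$ forks over $A$ if it contains a formula that forks over $A$, and it is $A$-invariant if, whenever $b\equiv_A b'$ are tuples of $M$ and $\varphi(x;y)$ is a formula, it contains $\varphi(x;b)$ if and only if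 it contains $\varphi(x;b')$. **Corollary 9.18.** $T^*_1$ is a complete theory which is $\mathrm{NSOP}_1$ (and $\mathrm{NSOP}_3$) and for which: 1. forking does not equal dividing, even over models: there is a formula $\varphi(x;z)$ such that for every model $M\models T^*_1$ there is a tuple $b$ in some elementary extension of $M$ such that $\varphi(x;b)$ forks over $M$ but does not divide over $M$; 2. nevertheless every type has a global non-forking, indeed invariant, extension: for every model $\mathbb{M}\models T^*_1$ (in particular for a monster model), every set $A\subseteq\mathbb{M}$ and every complete type $p(x)$ over $A$ in finitely many variables, there is a complete type $q(x)$ over $\mathbb{M}$ that extends $p$, is $A$-invariant and does not fork over $A$. In particular, $T^*_1$ is an $\mathrm{NSOP}_3$ theory in which every type has a global non-forking extension but forking is not equal to dividing. -/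

import Mathlib

open FirstOrder FirstOrder.Language

universe u

/-! ### The language, the theory `T₁`, and its Fraïssé-generic completion `T*₁` -/

/-- The only function symbol is the binary symbol `eval`. -/
inductive SelFunc : ℕ → Type
  | eval : SelFunc 2

/-- Unary predicates for the two sorts (`obj` for `O`, `fn` for `F`), and the binary relation `E`. -/
inductive SelRel : ℕ → Type
  | obj : SelRel 1
  | fn : SelRel 1
  | equiv : SelRel 2

/-- The language `⟨O, F, E, eval⟩`. -/
def selLang : FirstOrder.Language.{0, 0} := ⟨SelFunc, SelRel⟩

section Structures

variable {M : Type*} [selLang.Structure M]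

/-- `x` belongs to the sort `O` of objects. -/
def IsObj (x : M) : Prop := Structure.RelMap (L := selLang) SelRel.obj ![x]

/-- `x` belongs to the sort `F` of functions. -/
def IsFn (x : M) : Prop := Structure.RelMap (L := selLang) SelRel.fn ![x]

/-- The relation `E`. -/
def EqRel (x y : M) : Prop := Structure.RelMap (L := selLang) SelRel.equiv ![x, y]

/-- The value `eval(x, y)`. -/
def evalAt (x y : M) : M := Structure.funMap (L := selLang) SelFunc.eval ![x, y]

end Structures

/-- Models of `T₁`. The two sorts are disjoint predicates covering the universe, `E` is an
equivalence relation on `O`, and each `f ∈ F` names a selector function `eval(f, -)` for `E`.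
Function symbols of Mathlib's one-sorted languages are total, so `eval(x, y)` is set to be `y`
outside `F × O`, where the two-sorted function is undefined. -/
structure IsSelectorModel (M : Type*) [selLang.Structure M] : Prop where
  sorts : ∀ x : M, IsFn x ↔ ¬ IsObj x
  rel_obj : ∀ x y : M, EqRel x y → IsObj x ∧ IsObj y
  refl : ∀ x : M, IsObj x → EqRel x x
  symm : ∀ x y : M, EqRel x y → EqRel y x
  trans : ∀ x y z : M, EqRel x y → EqRel y z → EqRel x z
  eval_rel : ∀ f b : M, IsFn f → IsObj b → EqRel (evalAt f b) b
  eval_congr : ∀ f b b' : M, IsFn f → EqRel b b' → evalAt f b = evalAt f b'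
  eval_off : ∀ x y : M, ¬ (IsFn x ∧ IsObj y) → evalAt x y = y

/-- The class `𝕂₁` of finite models of `T₁`. -/
def finiteSelectorModels : Set (CategoryTheory.Bundled.{0} selLang.Structure) :=
  {M | Finite M ∧ IsSelectorModel M}

instance : Countable (Σ l, selLang.Functions l) := by
  have : Function.Injective (fun _ : (Σ l, selLang.Functions l) => ()) := by
    rintro ⟨_, ⟨⟩⟩ ⟨_, ⟨⟩⟩ _
    rfl
  exact this.countable

/-- `T*₁`: the set of sentences true in the (countable) Fraïssé limit of the class `𝕂₁` of finite
models of `T₁`. -/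
def selectorTheory : selLang.Theory :=
  {φ | ∀ (M : Type) [selLang.Structure M] [Countable M],
    IsFraisseLimit finiteSelectorModels M → M ⊨ φ}

namespace ForkDiv

variable {L : FirstOrder.Language.{0, 0}}

/-! ### `SOP₁` and `SOP₃`

A set of formulas with parameters in a model is consistent iff each finite subset of it is satisfied
in that model. -/

/-- `φ(x; y)` has `SOP₁` in `M`, as witnessed by a tree of tuples indexed by `2^{<ω}`, that is, by
finite lists of booleans (`false` is `0` and `true` is `1`). -/
def HasSOP₁ (M : Type u) [L.Structure M] {m n : ℕ} (φ : L.Formula (Fin m ⊕ Fin n)) : Prop :=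
  ∃ a : List Bool → Fin n → M,
    (∀ (η : ℕ → Bool) (I : Finset ℕ), ∃ x : Fin m → M,
      ∀ α ∈ I, φ.Realize (Sum.elim x (a ((List.range α).map η)))) ∧
    (∀ η ν : List Bool, (η ++ [false]) <+: ν →
      ¬ ∃ x : Fin m → M,
        φ.Realize (Sum.elim x (a ν)) ∧ φ.Realize (Sum.elim x (a (η ++ [true]))))

/-- `T` is `NSOP₁`: no formula has `SOP₁` in a model of `T`. -/
def NSOP₁ (T : L.Theory) : Prop :=
  ∀ (M : Type u) [L.Structure M] [Nonempty M] [M ⊨ T] (m n : ℕ) (φ : L.Formula (Fin m ⊕ Fin n)),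
    ¬ HasSOP₁ M φ

/-- `φ(x; y)`, with `x` and `y` of the same length, has `SOP₃` in `M`: it defines a directed graph
with an infinite chain and without directed cycles of length three. -/
def HasSOP₃ (M : Type u) [L.Structure M] {n : ℕ} (φ : L.Formula (Fin n ⊕ Fin n)) : Prop :=
  (∃ a : ℕ → Fin n → M, ∀ i j, i < j → φ.Realize (Sum.elim (a i) (a j))) ∧
  ¬ ∃ x y z : Fin n → M, φ.Realize (Sum.elim x y) ∧ φ.Realize (Sum.elim y z) ∧
    φ.Realize (Sum.elim z x)

/-- `T` is `NSOP₃`: no formula has `SOP₃` in a model of `T`. -/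
def NSOP₃ (T : L.Theory) : Prop :=
  ∀ (M : Type u) [L.Structure M] [Nonempty M] [M ⊨ T] (n : ℕ) (φ : L.Formula (Fin n ⊕ Fin n)),
    ¬ HasSOP₃ M φ

/-! ### Dividing and forking of formulas

Instead of fixing a monster model, parameters are taken in an arbitrary model `M`, and the sequences
and formulas that witness dividing and forking are looked for in elementary extensions of `M`. -/

/-- The sequence of `k`-tuples `s` is indiscernible over `A`. -/
def IsIndiscernible {M : Type u} [L.Structure M] (A : Set M) {k : ℕ} (s : ℕ → Fin k → M) : Prop :=
  ∀ (r : ℕ) (ψ : L[[A]].Formula (Fin r × Fin k)) (i j : Fin r → ℕ), StrictMono i → StrictMono j →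
    (ψ.Realize (fun p => s (i p.1) p.2) ↔ ψ.Realize (fun p => s (j p.1) p.2))

/-- `φ(x; b)` divides over `A`: in some elementary extension `N` there is an `A`-indiscernible
sequence `(sᵢ)` with `s₀ = b` such that `{φ(x; sᵢ) : i < ω}` is inconsistent. -/
def Divides {M : Type u} [L.Structure M] (A : Set M) {n k : ℕ} (φ : L.Formula (Fin n ⊕ Fin k))
    (b : Fin k → M) : Prop :=
  ∃ (N : Type u) (_ : L.Structure N) (e : M ↪ₑ[L] N) (s : ℕ → Fin k → N),
    s 0 = e ∘ b ∧ IsIndiscernible (L := L) (e '' A) s ∧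
    ∃ I : Finset ℕ, ¬ ∃ x : Fin n → N, ∀ i ∈ I, φ.Realize (Sum.elim x (s i))

/-- `φ(x; b)` forks over `A`: in some elementary extension `N` it implies a finite disjunction of
formulas `ψᵢ(x; cᵢ)`, each of which divides over `A`. -/
def Forks {M : Type u} [L.Structure M] (A : Set M) {n k : ℕ} (φ : L.Formula (Fin n ⊕ Fin k))
    (b : Fin k → M) : Prop :=
  ∃ (N : Type u) (_ : L.Structure N) (e : M ↪ₑ[L] N) (r : ℕ) (l : Fin r → ℕ)
    (ψ : ∀ i, L.Formula (Fin n ⊕ Fin (l i))) (c : ∀ i, Fin (l i) → N),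
    (∀ i, Divides (e '' A) (ψ i) (c i)) ∧
    ∀ x : Fin n → N, φ.Realize (Sum.elim x (e ∘ b)) → ∃ i, (ψ i).Realize (Sum.elim x (c i))

/-! ### Types over sets, global types -/

/-- `S_n(A)`: complete `n`-types over the set `A` of parameters in `M`. -/
abbrev TypeOver (L : FirstOrder.Language.{0, 0}) (M : Type u) [L.Structure M] (A : Set M) (n : ℕ) :=
  (L[[A]].completeTheory M).CompleteType (Fin n)

/-- `S_n(M)`: complete `n`-types over the whole model `M`. -/
abbrev GlobalType (L : FirstOrder.Language.{0, 0}) (M : Type u) [L.Structure M] (n : ℕ) :=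
  (L.elementaryDiagram M).CompleteType (Fin n)

variable {M : Type u} [L.Structure M] {n : ℕ}

/-- The global type `q` extends the type `p` over `A`. -/
def Extends {A : Set M} (q : GlobalType L M n) (p : TypeOver L M A n) : Prop :=
  ∀ φ : L[[A]].Formula (Fin n), Formula.equivSentence φ ∈ p →
    Formula.equivSentence ((L.lhomWithConstantsMap ((↑) : A → M)).onFormula φ) ∈ q

/-- The formula `φ(x; b)`, as a formula with parameters in `M`. -/
def instantiate {k : ℕ} (φ : L.Formula (Fin n ⊕ Fin k)) (b : Fin k → M) :
    L[[M]].Formula (Fin n) :=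
  ((L.lhomWithConstants M).onFormula φ).subst
    (Sum.elim (fun i => Term.var i) (fun j => (L.con (b j)).term))

/-- The formula `φ(x; b)` belongs to the global type `q`. -/
def GlobalType.Contains (q : GlobalType L M n) {k : ℕ} (φ : L.Formula (Fin n ⊕ Fin k))
    (b : Fin k → M) : Prop :=
  Formula.equivSentence (instantiate φ b) ∈ q

/-- `b ≡_A b'`. -/
def SameType (L : FirstOrder.Language.{0, 0}) {M : Type u} [L.Structure M] (A : Set M) {k : ℕ}
    (b b' : Fin k → M) : Prop :=
  ∀ ψ : L[[A]].Formula (Fin k), ψ.Realize b ↔ ψ.Realize b'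

/-- `q` is `A`-invariant: if `b ≡_A b'`, then `φ(x; b) ∈ q` iff `φ(x; b') ∈ q`. -/
def GlobalType.Invariant (q : GlobalType L M n) (A : Set M) : Prop :=
  ∀ (k : ℕ) (φ : L.Formula (Fin n ⊕ Fin k)) (b b' : Fin k → M),
    SameType L A b b' → (q.Contains φ b ↔ q.Contains φ b')

/-- `q` forks over `A`: it contains a formula that forks over `A` (for a complete type this is the
same as implying such a formula, by compactness). -/
def GlobalType.ForksOver (q : GlobalType L M n) (A : Set M) : Prop :=
  ∃ (k : ℕ) (φ : L.Formula (Fin n ⊕ Fin k)) (b : Fin k → M), q.Contains φ b ∧ Forks A φ b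

end ForkDiv

-- A selector depends only on the class of its argument, so every term collapses to a variable or to
-- one application of `eval` to two variables. Finitely generated models of `T₁` are therefore
-- finite, and partial isomorphisms are easy to control. The Fraïssé limit is realised as
-- `GenericModel`, in which the matrix recording the choice of each function in each class contains
-- every finite pattern, both along rows and along columns. Its one-point extension property
-- `IsPartIso.extend` gives the Fraïssé limit, hence completeness; transferred to all models, it
-- gives quantifier elimination (`SameQF.realize_iff`). By compactness every model of `T₁` embeds in
-- a model of `T*₁` (`exists_model`), so consistency questions reduce to building models of `T₁`.
-- The tool for this is `exists_amalgam`: two models are glued along a partial isomorphism, and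
-- functions private to one side may select arbitrarily in classes private to the other.
--
-- For `NSOP₁` and `NSOP₃`, consider a long sequence of pairs `c₀ i`, `c₁ i` of equal type over the
-- earlier pairs, and a tuple `d`. Pigeonhole yields `i < j` for which `d`, `c₀ j` and the pair at
-- `i` interact only through what precedes `i`. Then `exists_amalgam_types` moves the type of `d`
-- over `c₀ i` to `c₁ i` while keeping its type over `c₀ j`. A tree witnessing `SOP₁`, and the tree
-- of intervals of a chain witnessing `SOP₃`, both contain such sequences for which the outcome is
-- inconsistent (`no_separated_tree`).
--
-- The formula that forks without dividing says that `x₀` selects `z` or that `x₁` is equivalent to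
-- `z`. Each disjunct divides, along a sequence inside one class or across classes respectively, but
-- every indiscernible sequence of objects is of one of these two kinds, and the other disjunct then
-- has a common solution.
--
-- For global extensions, a model realising the given type is amalgamated with the big model over
-- `A` by canonical rules (`IsFree`). Partial isomorphisms respecting `A` extend to such amalgams
-- (`isPartIso_freeRel`); this gives invariance, then non-dividing, and non-forking because the
-- amalgam exists over every elementary extension too.

universe v

namespace Selector

/-! ### Rules of evaluation in models of `T₁` -/

section Basic

variable {M : Type*} [selLang.Structure M] {N : Type*} [selLang.Structure N]

theorem _root_.IsSelectorModel.isFn_iff (h : IsSelectorModel M) {x : M} : IsFn x ↔ ¬ IsObj x :=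
  h.sorts x

theorem evalAt_of_not_fn (h : IsSelectorModel M) {x y : M} (hx : IsObj x) : evalAt x y = y :=
  h.eval_off _ _ fun hh => (h.isFn_iff.1 hh.1) hx

theorem evalAt_of_not_obj (h : IsSelectorModel M) {x y : M} (hy : ¬ IsObj y) : evalAt x y = y :=
  h.eval_off _ _ fun hh => hy hh.2

theorem isObj_evalAt (h : IsSelectorModel M) {x y : M} : IsObj (evalAt x y) ↔ IsObj y := by
  by_cases hxy : IsFn x ∧ IsObj y
  · exact iff_of_true (h.rel_obj _ _ (h.eval_rel _ _ hxy.1 hxy.2)).1 hxy.2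
  · rw [h.eval_off _ _ hxy]

theorem eqRel_comm (h : IsSelectorModel M) {x y : M} : EqRel x y ↔ EqRel y x :=
  ⟨h.symm _ _, h.symm _ _⟩

theorem eqRel_congr_left (h : IsSelectorModel M) {x y z : M} (hxy : EqRel x y) :
    EqRel x z ↔ EqRel y z :=
  ⟨fun hz => h.trans _ _ _ (h.symm _ _ hxy) hz, fun hz => h.trans _ _ _ hxy hz⟩

theorem eqRel_congr_right (h : IsSelectorModel M) {x y z : M} (hxy : EqRel x y) :
    EqRel z x ↔ EqRel z y :=
  ⟨fun hz => h.trans _ _ _ hz hxy, fun hz => h.trans _ _ _ hz (h.symm _ _ hxy)⟩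

theorem evalAt_eqRel (h : IsSelectorModel M) {x y : M} (hy : IsObj y) : EqRel (evalAt x y) y := by
  by_cases hx : IsObj x
  · rw [evalAt_of_not_fn h hx]; exact h.refl _ hy
  · exact h.eval_rel _ _ (h.isFn_iff.2 hx) hy

theorem eqRel_evalAt_left (h : IsSelectorModel M) {x y z : M} :
    EqRel (evalAt x y) z ↔ EqRel y z := by
  by_cases hy : IsObj y
  · exact eqRel_congr_left h (evalAt_eqRel h hy)
  · rw [evalAt_of_not_obj h hy]

theorem eqRel_evalAt_right (h : IsSelectorModel M) {x y z : M} :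
    EqRel z (evalAt x y) ↔ EqRel z y := by
  rw [eqRel_comm h, eqRel_evalAt_left h, eqRel_comm h]

/-- The inner evaluation stays in the class of `z`, and a selector sees nothing but the class. This
is what collapses nested terms to depth one. -/
theorem evalAt_evalAt_right (h : IsSelectorModel M) {x y z : M} (hx : ¬ IsObj x) :
    evalAt x (evalAt y z) = evalAt x z := by
  by_cases hz : IsObj z
  · exact h.eval_congr _ _ _ (h.isFn_iff.2 hx) (evalAt_eqRel h hz)
  · rw [evalAt_of_not_obj h (y := z) hz]

theorem evalAt_congr (h : IsSelectorModel M) {x y z : M} (hx : ¬ IsObj x) (hyz : EqRel y z) :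
    evalAt x y = evalAt x z :=
  h.eval_congr _ _ _ (h.isFn_iff.2 hx) hyz

/-- The structure with objects `obj`, relation `rel`, evaluation `ev`, and all other elements as
functions. -/
@[reducible] def mkStructure {X : Type*} (obj : X → Prop) (rel : X → X → Prop) (ev : X → X → X) :
    selLang.Structure X where
  funMap := fun {_} f => match f with
    | SelFunc.eval => fun v => ev (v 0) (v 1)
  RelMap := fun {_} r => match r with
    | SelRel.obj => fun v => obj (v 0)
    | SelRel.fn => fun v => ¬ obj (v 0)
    | SelRel.equiv => fun v => rel (v 0) (v 1)

theorem mkStructure_isSelectorModel {X : Type*} {obj : X → Prop} {rel : X → X → Prop}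
    {ev : X → X → X} (rel_obj : ∀ x y, rel x y → obj x ∧ obj y) (refl : ∀ x, obj x → rel x x)
    (symm : ∀ x y, rel x y → rel y x) (trans : ∀ x y z, rel x y → rel y z → rel x z)
    (eval_rel : ∀ f b, ¬ obj f → obj b → rel (ev f b) b)
    (eval_congr : ∀ f b b', ¬ obj f → rel b b' → ev f b = ev f b')
    (eval_off : ∀ x y, (obj x ∨ ¬ obj y) → ev x y = y) :
    @IsSelectorModel X (mkStructure obj rel ev) := by
  let _ := mkStructure obj rel ev
  exact
    { sorts := fun x => Iff.rfl
      rel_obj := rel_obj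
      refl := refl
      symm := symm
      trans := trans
      eval_rel := eval_rel
      eval_congr := eval_congr
      eval_off := fun x y h => eval_off x y (by
        by_contra hc
        push Not at hc
        exact h ⟨hc.1, hc.2⟩) }

end Basic

/-- A partial isomorphism between two structures, as a relation. -/
structure IsPartIso {M N : Type*} [selLang.Structure M] [selLang.Structure N]
    (R : M → N → Prop) : Prop where
  eq_iff : ∀ {x x' y y'}, R x x' → R y y' → (x = y ↔ x' = y')
  obj_iff : ∀ {x x'}, R x x' → (IsObj x ↔ IsObj x')
  rel_iff : ∀ {x x' y y'}, R x x' → R y y' → (EqRel x y ↔ EqRel x' y')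
  eval : ∀ {x x' y y'}, R x x' → R y y' → R (evalAt x y) (evalAt x' y')

/-- A map which is an isomorphism onto its image. -/
structure IsEmb {M N : Type*} [selLang.Structure M] [selLang.Structure N]
    (f : M → N) : Prop where
  inj : Function.Injective f
  obj_iff : ∀ x, IsObj (f x) ↔ IsObj x
  rel_iff : ∀ x y, EqRel (f x) (f y) ↔ EqRel x y
  eval : ∀ x y, evalAt (f x) (f y) = f (evalAt x y)

/-! ### Partial isomorphisms, terms of depth one and quantifier-free types -/

section PartIso

variable {M : Type*} [selLang.Structure M] {N : Type*} [selLang.Structure N]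
  {P : Type*} [selLang.Structure P] {J : Type*}

theorem IsPartIso.swap {R : M → N → Prop} (h : IsPartIso R) : IsPartIso (fun x y => R y x) :=
  ⟨fun a b => (h.eq_iff a b).symm, fun a => (h.obj_iff a).symm, fun a b => (h.rel_iff a b).symm,
    fun a b => h.eval a b⟩

theorem IsPartIso.comp {R : M → N → Prop} {S : N → P → Prop} (hR : IsPartIso R)
    (hS : IsPartIso S) : IsPartIso (fun x z => ∃ y, R x y ∧ S y z) := by
  constructor
  · rintro x x' y y' ⟨a, h1, h2⟩ ⟨b, h3, h4⟩
    rw [hR.eq_iff h1 h3, hS.eq_iff h2 h4]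
  · rintro x x' ⟨a, h1, h2⟩
    rw [hR.obj_iff h1, hS.obj_iff h2]
  · rintro x x' y y' ⟨a, h1, h2⟩ ⟨b, h3, h4⟩
    rw [hR.rel_iff h1 h3, hS.rel_iff h2 h4]
  · rintro x x' y y' ⟨a, h1, h2⟩ ⟨b, h3, h4⟩
    exact ⟨_, hR.eval h1 h3, hS.eval h2 h4⟩

theorem IsEmb.isPartIso {f : M → N} (h : IsEmb f) : IsPartIso (fun x y => y = f x) := by
  constructor
  · rintro x _ y _ rfl rfl; exact h.inj.eq_iff.symm
  · rintro x _ rfl; exact (h.obj_iff x).symm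
  · rintro x _ y _ rfl rfl; exact (h.rel_iff x y).symm
  · rintro x _ y _ rfl rfl; exact h.eval x y

theorem isPartIso_false : IsPartIso (fun (_ : M) (_ : N) => False) := by
  constructor <;> (intros; contradiction)

/-- Terms of the language in the variables `J`, up to equality in models of `T₁`. -/
abbrev Tm (J : Type*) := J ⊕ J × J

/-- The value of a term. -/
def tval (v : J → M) : Tm J → M :=
  Sum.elim v fun p => evalAt (v p.1) (v p.2)

@[simp] theorem tval_inl (v : J → M) (i : J) : tval v (.inl i) = v i := rfl

@[simp] theorem tval_inr (v : J → M) (p : J × J) :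
    tval v (.inr p) = evalAt (v p.1) (v p.2) := rfl

/-- The variable of a term which determines its class. -/
def Tm.base : Tm J → J := Sum.elim id Prod.snd

theorem isObj_tval (h : IsSelectorModel M) (v : J → M) (t : Tm J) :
    IsObj (tval v t) ↔ IsObj (v t.base) := by
  rcases t with i | ⟨i, j⟩
  · rfl
  · exact isObj_evalAt h

theorem eqRel_tval (h : IsSelectorModel M) (v : J → M) (s t : Tm J) :
    EqRel (tval v s) (tval v t) ↔ EqRel (v s.base) (v t.base) := by
  rcases s with i | ⟨i, j⟩ <;> rcases t with k | ⟨k, l⟩ <;>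
    simp [Tm.base, eqRel_evalAt_left h, eqRel_evalAt_right h]

open Classical in
/-- The term `eval(s, t)`, given the set `o` of variables whose values are objects. -/
noncomputable def Tm.eval (o : J → Prop) (s t : Tm J) : Tm J :=
  if o s.base then t else .inr (s.base, t.base)

theorem tval_base_of_not_obj (h : IsSelectorModel M) (v : J → M) (t : Tm J)
    (ht : ¬ IsObj (v t.base)) : tval v t = v t.base := by
  rcases t with i | ⟨i, j⟩
  · rfl
  · exact evalAt_of_not_obj h ht

theorem tval_eval (h : IsSelectorModel M) (v : J → M) (s t : Tm J) :
    tval v (Tm.eval (fun i => IsObj (v i)) s t) = evalAt (tval v s) (tval v t) := by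
  unfold Tm.eval
  split_ifs with hs
  · rw [evalAt_of_not_fn h ((isObj_tval h v s).2 hs)]
  -- A term whose value is a function equals its base variable, since `eval` returns its second
  -- argument whenever that is not an object.
  · rw [tval_base_of_not_obj h v s hs, tval_inr]
    rcases t with i | ⟨i, j⟩
    · rfl
    · exact (evalAt_evalAt_right h hs).symm

/-- Atomic formulas in the variables `J`. -/
abbrev Atom (J : Type*) := J ⊕ (J × J) ⊕ (Tm J × Tm J)

/-- The truth value of an atomic formula. -/
def atomHolds (v : J → M) : Atom J → Prop
  | .inl i => IsObj (v i)
  | .inr (.inl p) => EqRel (v p.1) (v p.2)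
  | .inr (.inr p) => tval v p.1 = tval v p.2

/-- Two families of elements satisfy the same quantifier-free formulas. -/
def SameQF (v : J → M) (v' : J → N) : Prop :=
  ∃ R : M → N → Prop, IsPartIso R ∧ ∀ i, R (v i) (v' i)

/-- The relation generated by two families of elements. -/
def genRel (v : J → M) (v' : J → N) (x : M) (x' : N) : Prop :=
  ∃ t, x = tval v t ∧ x' = tval v' t

theorem IsPartIso.tval {R : M → N → Prop} (h : IsPartIso R) {v : J → M} {v' : J → N}
    (hv : ∀ i, R (v i) (v' i)) (t : Tm J) : R (tval v t) (tval v' t) := by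
  rcases t with i | ⟨i, j⟩
  · exact hv i
  · exact h.eval (hv i) (hv j)

theorem genRel_base (v : J → M) (v' : J → N) (i : J) : genRel v v' (v i) (v' i) :=
  ⟨.inl i, rfl, rfl⟩

/-- Atoms include all equalities between terms of depth one, and the sort and the class of a term
are those of its base variable. Closure under `eval` holds because `Tm.eval` depends only on which
variables are objects. -/
theorem isPartIso_genRel (hM : IsSelectorModel M) (hN : IsSelectorModel N) {v : J → M} {v' : J → N}
    (h : ∀ a, atomHolds v a ↔ atomHolds v' a) : IsPartIso (genRel v v') := by
  have ho : (fun i => IsObj (v i)) = fun i => IsObj (v' i) := by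
    funext i; exact propext (h (.inl i))
  constructor
  · rintro _ _ _ _ ⟨s, rfl, rfl⟩ ⟨t, rfl, rfl⟩
    exact h (.inr (.inr (s, t)))
  · rintro _ _ ⟨s, rfl, rfl⟩
    rw [isObj_tval hM, isObj_tval hN]; exact h (.inl _)
  · rintro _ _ _ _ ⟨s, rfl, rfl⟩ ⟨t, rfl, rfl⟩
    rw [eqRel_tval hM, eqRel_tval hN]; exact h (.inr (.inl (_, _)))
  · rintro _ _ _ _ ⟨s, rfl, rfl⟩ ⟨t, rfl, rfl⟩
    refine ⟨Tm.eval (fun i => IsObj (v i)) s t, (tval_eval hM v s t).symm, ?_⟩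
    rw [ho, tval_eval hN]

theorem SameQF.atomHolds_iff {v : J → M} {v' : J → N} (h : SameQF v v') (a : Atom J) :
    atomHolds v a ↔ atomHolds v' a := by
  obtain ⟨R, hR, hv⟩ := h
  rcases a with i | ⟨i, j⟩ | ⟨s, t⟩
  · exact hR.obj_iff (hv i)
  · exact hR.rel_iff (hv i) (hv j)
  · exact hR.eq_iff (hR.tval hv s) (hR.tval hv t)

theorem sameQF_iff (hM : IsSelectorModel M) (hN : IsSelectorModel N) {v : J → M} {v' : J → N} :
    SameQF v v' ↔ ∀ a, atomHolds v a ↔ atomHolds v' a :=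
  ⟨fun h => h.atomHolds_iff, fun h => ⟨_, isPartIso_genRel hM hN h, genRel_base v v'⟩⟩

theorem SameQF.isPartIso (hM : IsSelectorModel M) (hN : IsSelectorModel N) {v : J → M} {v' : J → N}
    (h : SameQF v v') : IsPartIso (genRel v v') :=
  isPartIso_genRel hM hN h.atomHolds_iff

theorem SameQF.symm {v : J → M} {v' : J → N} (h : SameQF v v') : SameQF v' v :=
  let ⟨_, hR, hv⟩ := h
  ⟨_, hR.swap, hv⟩

theorem SameQF.trans {v : J → M} {v' : J → N} {v'' : J → P} (h : SameQF v v')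
    (h' : SameQF v' v'') : SameQF v v'' :=
  let ⟨_, hR, hv⟩ := h
  let ⟨_, hR', hv'⟩ := h'
  ⟨_, hR.comp hR', fun i => ⟨_, hv i, hv' i⟩⟩

theorem SameQF.comp {K : Type*} {v : J → M} {v' : J → N} (h : SameQF v v') (f : K → J) :
    SameQF (v ∘ f) (v' ∘ f) :=
  let ⟨R, hR, hv⟩ := h
  ⟨R, hR, fun i => hv (f i)⟩

theorem IsEmb.sameQF {f : M → N} (h : IsEmb f) (v : J → M) : SameQF v (f ∘ v) :=
  ⟨_, h.isPartIso, fun _ => rfl⟩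

/-- The set of values of terms, that is, the substructure generated by a family. -/
def closed (v : J → M) : Set M := Set.range (tval v)

theorem evalAt_mem_closed (h : IsSelectorModel M) {v : J → M} {x y : M} (hx : x ∈ closed v)
    (hy : y ∈ closed v) : evalAt x y ∈ closed v := by
  obtain ⟨s, rfl⟩ := hx
  obtain ⟨t, rfl⟩ := hy
  exact ⟨_, tval_eval h v s t⟩

theorem closed_subset {v : J → M} {S : Set M} (hS : ∀ x ∈ S, ∀ y ∈ S, evalAt x y ∈ S)
    (hv : ∀ i, v i ∈ S) : closed v ⊆ S := by
  rintro _ ⟨i | ⟨i, j⟩, rfl⟩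
  · exact hv i
  · exact hS _ (hv i) _ (hv j)

theorem mem_closed (v : J → M) (i : J) : v i ∈ closed v := ⟨.inl i, rfl⟩

end PartIso

/-! ### Atoms as first-order formulas -/

section Formulas

variable {M : Type*} [selLang.Structure M] {J : Type*}

/-- A term as a term of the language. -/
def tmTerm : Tm J → selLang.Term J
  | .inl i => .var i
  | .inr (i, j) => Functions.apply₂ (L := selLang) SelFunc.eval (.var i) (.var j)

/-- An atomic formula as a formula of the language. -/
def atomFormula : Atom J → selLang.Formula J
  | .inl i => Relations.formula₁ (L := selLang) SelRel.obj (.var i)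
  | .inr (.inl p) => Relations.formula₂ (L := selLang) SelRel.equiv (.var p.1) (.var p.2)
  | .inr (.inr p) => Term.equal (tmTerm p.1) (tmTerm p.2)

theorem realize_tmTerm (v : J → M) (t : Tm J) : (tmTerm t).realize v = tval v t := by
  rcases t with i | ⟨i, j⟩
  · rfl
  · exact Term.realize_functions_apply₂ (L := selLang) (f := SelFunc.eval)

@[simp] theorem realize_atomFormula (v : J → M) (a : Atom J) :
    (atomFormula a).Realize v ↔ atomHolds v a := by
  rcases a with i | p | p
  · exact Formula.realize_rel₁ (L := selLang) (R := SelRel.obj)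
  · exact Formula.realize_rel₂ (L := selLang) (R := SelRel.equiv)
  · simp only [atomFormula, Formula.realize_equal, realize_tmTerm]; rfl

end Formulas

/-! ### A countable model built from a generic matrix -/

section Generic

/-- The `j`-th entry of the `i`-th finite sequence of natural numbers. -/
def seqEntry (i j : ℕ) : ℕ := (Denumerable.ofNat (List ℕ) i).getD j 0

/-- After the prescribed entries one further entry is free, and distinct values there give distinct
codes. -/
theorem infinite_seqEntry (s : Finset ℕ) (t : ℕ → ℕ) :
    {i | ∀ j ∈ s, seqEntry i j = t j}.Infinite := by
  obtain ⟨K, hK⟩ := s.exists_nat_subset_range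
  have hinj : Function.Injective fun c : ℕ =>
      Encodable.encode ((List.range K).map t ++ [c]) := by
    intro c d h
    have := Encodable.encode_injective h
    simpa using this
  refine (Set.infinite_range_of_injective hinj).mono ?_
  rintro _ ⟨c, rfl⟩ j hj
  have hjK : j < K := by simpa using hK hj
  simp [seqEntry, List.getD_eq_getElem?_getD, List.getElem?_append, hjK]

/-- A generic matrix of natural numbers. -/
def genericMatrix (f i : ℕ) : ℕ := if f < i then seqEntry i f else seqEntry f i

/-- A column with index beyond all rows in `s` is read from its own code, whose entries can be
prescribed. Rows are treated symmetrically. -/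
theorem exists_column (s X : Finset ℕ) (t : ℕ → ℕ) :
    ∃ i, i ∉ X ∧ ∀ f ∈ s, genericMatrix f i = t f := by
  obtain ⟨K, hK⟩ := s.exists_nat_subset_range
  obtain ⟨i, hi, hi'⟩ := (infinite_seqEntry s t).exists_notMem_finset (X ∪ Finset.range K)
  simp only [Finset.mem_union, Finset.mem_range, not_or, not_lt] at hi'
  refine ⟨i, hi'.1, fun f hf => ?_⟩
  have : f < K := by simpa using hK hf
  rw [genericMatrix, if_pos (this.trans_le hi'.2)]
  exact hi f hf

theorem exists_row (s X : Finset ℕ) (t : ℕ → ℕ) :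
    ∃ f, f ∉ X ∧ ∀ i ∈ s, genericMatrix f i = t i := by
  obtain ⟨K, hK⟩ := s.exists_nat_subset_range
  obtain ⟨f, hf, hf'⟩ := (infinite_seqEntry s t).exists_notMem_finset (X ∪ Finset.range K)
  simp only [Finset.mem_union, Finset.mem_range, not_or, not_lt] at hf'
  refine ⟨f, hf'.1, fun i hi => ?_⟩
  have : i < K := by simpa using hK hi
  rw [genericMatrix, if_neg (not_lt.2 (this.le.trans hf'.2))]
  exact hf i hi

/-- The universe of a countable generic model: functions are natural numbers, and objects are
pairs of natural numbers, the first of which determines the class. -/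
def GenericModel : Type := ℕ ⊕ ℕ × ℕ

instance : Countable GenericModel := inferInstanceAs (Countable (ℕ ⊕ ℕ × ℕ))

instance : Nonempty GenericModel := ⟨.inl 0⟩

/-- The equivalence relation of the generic model. -/
def GenericModel.rel : ℕ ⊕ ℕ × ℕ → ℕ ⊕ ℕ × ℕ → Prop
  | .inr p, .inr q => p.1 = q.1
  | _, _ => False

/-- The evaluation of the generic model. -/
def GenericModel.ev : ℕ ⊕ ℕ × ℕ → ℕ ⊕ ℕ × ℕ → ℕ ⊕ ℕ × ℕ
  | .inl f, .inr p => .inr (p.1, genericMatrix f p.1)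
  | _, y => y

instance : selLang.Structure GenericModel :=
  mkStructure (X := ℕ ⊕ ℕ × ℕ) (fun x => x.isRight) GenericModel.rel GenericModel.ev

/-- A function of the generic model. -/
def GenericModel.fn (f : ℕ) : GenericModel := .inl f

/-- An object of the generic model. -/
def GenericModel.ob (i j : ℕ) : GenericModel := .inr (i, j)

open GenericModel

theorem GenericModel.exists_eq (x : GenericModel) : (∃ f, x = fn f) ∨ ∃ i j, x = ob i j := by
  rcases x with f | ⟨i, j⟩
  · exact .inl ⟨f, rfl⟩
  · exact .inr ⟨i, j, rfl⟩

theorem GenericModel.isObj_fn (f : ℕ) : ¬ IsObj (fn f) := by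
  intro h; exact Bool.false_ne_true h

theorem GenericModel.isObj_ob (i j : ℕ) : IsObj (ob i j) := rfl

theorem GenericModel.evalAt_fn_ob (f i j : ℕ) :
    evalAt (fn f) (ob i j) = ob i (genericMatrix f i) := rfl

theorem GenericModel.ob_inj {i j i' j' : ℕ} : ob i j = ob i' j' ↔ i = i' ∧ j = j' := by
  refine ⟨fun h => ?_, by rintro ⟨rfl, rfl⟩; rfl⟩
  have := Sum.inr_injective h
  simpa using this

theorem GenericModel.fn_inj {f g : ℕ} : fn f = fn g ↔ f = g :=
  ⟨fun h => Sum.inl_injective h, by rintro rfl; rfl⟩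

theorem GenericModel.exists_fn {x : GenericModel} (h : ¬ IsObj x) : ∃ f, x = fn f := by
  rcases x.exists_eq with h' | ⟨i, j, rfl⟩
  · exact h'
  · exact absurd (isObj_ob i j) h

theorem GenericModel.exists_ob {x : GenericModel} (h : IsObj x) : ∃ i j, x = ob i j := by
  rcases x.exists_eq with ⟨f, rfl⟩ | h'
  · exact absurd h (isObj_fn f)
  · exact h'

theorem GenericModel.isSelectorModel : IsSelectorModel GenericModel := by
  refine mkStructure_isSelectorModel (X := ℕ ⊕ ℕ × ℕ) (obj := fun x => x.isRight)
    (rel := GenericModel.rel) (ev := GenericModel.ev) ?_ ?_ ?_ ?_ ?_ ?_ ?_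
  · rintro (x | x) (y | y) h <;> first | exact h.elim | exact ⟨rfl, rfl⟩
  · rintro (x | x) h
    · exact absurd h (by simp)
    · rfl
  · rintro (x | x) (y | y) h <;> first | exact h.elim | exact Eq.symm h
  · rintro (x | x) (y | y) (z | z) h h' <;> first | exact h.elim | exact h'.elim | exact Eq.trans h h'
  · rintro (x | x) (y | y) h h' <;> simp_all [GenericModel.rel, GenericModel.ev]
  · rintro (x | x) (y | y) (z | z) h h' <;>
      first | exact h'.elim | simp_all [GenericModel.rel, GenericModel.ev]
  · rintro (x | x) (y | y) h <;> simp_all [GenericModel.ev]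

end Generic

/-! ### The one-point extension property -/

section Extension

variable {W : Type*} [selLang.Structure W]

/-- The domain of a relation. -/
def relDom {A B : Type*} (R : A → B → Prop) : Set A := {x | ∃ y, R x y}

/-- The range of a relation. -/
def relRan {A B : Type*} (R : A → B → Prop) : Set B := {y | ∃ x, R x y}

theorem IsPartIso.finite_ran {N : Type*} [selLang.Structure N] {R : W → N → Prop}
    (hR : IsPartIso R) (hd : (relDom R).Finite) : (relRan R).Finite := by
  have := hd.to_subtype
  choose g hg using fun x : relDom R => x.2
  refine (Set.finite_range g).subset ?_
  rintro y ⟨x, hx⟩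
  exact ⟨⟨x, y, hx⟩, (hR.eq_iff (hg ⟨x, y, hx⟩) hx).1 rfl⟩

/-- The class of `x` is already represented by `z`, so functions act on `x` as on `z` and no further
values need to be added. -/
theorem IsPartIso.addObj {N : Type*} [selLang.Structure N] (hW : IsSelectorModel W)
    (hN : IsSelectorModel N) {R : W → N → Prop} (hR : IsPartIso R)
    {x z : W} {x' z' : N} (hz : R z z') (hxz : EqRel x z) (hxz' : EqRel x' z')
    (hx : x ∉ relDom R) (hx' : x' ∉ relRan R) :
    IsPartIso (fun y y' => R y y' ∨ (y = x ∧ y' = x')) := by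
  have ox := (hW.rel_obj _ _ hxz).1
  have ox' := (hN.rel_obj _ _ hxz').1
  have hrel : ∀ {y y'}, R y y' → (EqRel x y ↔ EqRel x' y') := fun hy => by
    rw [eqRel_congr_left hW hxz, eqRel_congr_left hN hxz', hR.rel_iff hz hy]
  constructor
  · rintro y y' w w' (h1 | ⟨rfl, rfl⟩) (h2 | ⟨rfl, rfl⟩)
    · exact hR.eq_iff h1 h2
    · exact iff_of_false (fun h => hx ⟨_, h ▸ h1⟩) (fun h => hx' ⟨_, h ▸ h1⟩)
    · exact iff_of_false (fun h => hx ⟨_, h ▸ h2⟩) (fun h => hx' ⟨_, h ▸ h2⟩)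
    · simp
  · rintro y y' (h1 | ⟨rfl, rfl⟩)
    · exact hR.obj_iff h1
    · exact iff_of_true ox ox'
  · rintro y y' w w' (h1 | ⟨rfl, rfl⟩) (h2 | ⟨rfl, rfl⟩)
    · exact hR.rel_iff h1 h2
    · rw [eqRel_comm hW, eqRel_comm hN]; exact hrel h1
    · exact hrel h2
    · exact iff_of_true (hW.refl _ ox) (hN.refl _ ox')
  · rintro y y' w w' (h1 | ⟨rfl, rfl⟩) (h2 | ⟨rfl, rfl⟩)
    · exact .inl (hR.eval h1 h2)
    · by_cases oy : IsObj y
      · rw [evalAt_of_not_fn hW oy, evalAt_of_not_fn hN ((hR.obj_iff h1).1 oy)]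
        exact .inr ⟨rfl, rfl⟩
      · rw [evalAt_congr hW oy hxz, evalAt_congr hN (fun h => oy ((hR.obj_iff h1).2 h)) hxz']
        exact .inl (hR.eval h1 hz)
    · rw [evalAt_of_not_fn hW ox, evalAt_of_not_fn hN ox']
      exact .inl h2
    · rw [evalAt_of_not_fn hW ox, evalAt_of_not_fn hN ox']
      exact .inr ⟨rfl, rfl⟩

open GenericModel

theorem finite_relDom_or {A B : Type*} {R : A → B → Prop} (hd : (relDom R).Finite) (x : A) (x' : B) :
    (relDom fun y y' => R y y' ∨ (y = x ∧ y' = x')).Finite := by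
  refine (hd.union (Set.finite_singleton x)).subset ?_
  rintro y ⟨y', h | ⟨rfl, rfl⟩⟩
  · exact .inl ⟨_, h⟩
  · exact .inr rfl

/-- Classes of the generic model are infinite, so one of them always has an object outside the
finite range. -/
theorem extend_class (hW : IsSelectorModel W) {R : W → GenericModel → Prop} (hR : IsPartIso R)
    (hd : (relDom R).Finite) {x z : W} (hz : z ∈ relDom R) (hxz : EqRel x z) :
    ∃ R' : W → GenericModel → Prop, IsPartIso R' ∧ (relDom R').Finite ∧ x ∈ relDom R' ∧
      (∀ y y', R y y' → R' y y') ∧ ∀ y ∈ relDom R', y ∈ relDom R ∨ y = x := by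
  by_cases hx : x ∈ relDom R
  · exact ⟨R, hR, hd, hx, fun _ _ h => h, fun _ h => .inl h⟩
  obtain ⟨z', hz⟩ := hz
  obtain ⟨i, j, rfl⟩ := exists_ob ((hR.obj_iff hz).1 (hW.rel_obj _ _ hxz).2)
  have hinj : Function.Injective (fun k => ob i k) := fun a b h => (ob_inj.1 h).2
  obtain ⟨_, ⟨k, rfl⟩, hk⟩ := (Set.infinite_range_of_injective hinj).exists_notMem_finite
    (hR.finite_ran hd)
  refine ⟨_, hR.addObj hW GenericModel.isSelectorModel hz hxz
    (show EqRel (ob i k) (ob i j) from rfl) hx hk, finite_relDom_or hd _ _, ⟨_, .inr ⟨rfl, rfl⟩⟩,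
    fun _ _ => .inl, ?_⟩
  rintro y ⟨y', h | ⟨rfl, rfl⟩⟩
  · exact .inl ⟨_, h⟩
  · exact .inr rfl

theorem extend_classes (hW : IsSelectorModel W) {R : W → GenericModel → Prop} (hR : IsPartIso R)
    (hd : (relDom R).Finite) {S : Set W} (hS : S.Finite)
    (hSR : ∀ x ∈ S, ∃ z ∈ relDom R, EqRel x z) :
    ∃ R' : W → GenericModel → Prop, IsPartIso R' ∧ (relDom R').Finite ∧ S ⊆ relDom R' ∧
      (∀ y y', R y y' → R' y y') ∧ ∀ y ∈ relDom R', y ∈ relDom R ∨ y ∈ S := by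
  induction S, hS using Set.Finite.induction_on with
  | empty => exact ⟨R, hR, hd, Set.empty_subset _, fun _ _ h => h, fun _ h => .inl h⟩
  | @insert a S _ _ ih =>
    obtain ⟨R₁, h1, h2, h3, h4, h5⟩ := ih fun x hx => hSR x (.inr hx)
    obtain ⟨z, ⟨z', hz⟩, haz⟩ := hSR a (.inl rfl)
    obtain ⟨R₂, k1, k2, k3, k4, k5⟩ := extend_class hW h1 h2 ⟨z', h4 _ _ hz⟩ haz
    refine ⟨R₂, k1, k2, ?_, fun y y' h => k4 _ _ (h4 _ _ h), fun y hy => ?_⟩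
    · rintro y (rfl | hy)
      · exact k3
      · obtain ⟨y', hy'⟩ := h3 hy
        exact ⟨y', k4 _ _ hy'⟩
    · rcases k5 y hy with h | rfl
      · exact (h5 y h).imp_right .inr
      · exact .inr (.inl rfl)

/-- With `x` come the objects that functions of the domain select in its class. A fresh column
supplies the new class, its entries being the codes of these selected objects. -/
theorem extend_newClass (hW : IsSelectorModel W) {R : W → GenericModel → Prop} (hR : IsPartIso R)
    (hd : (relDom R).Finite) {x : W} (ox : IsObj x) (hx : ∀ z ∈ relDom R, ¬ EqRel x z) :
    ∃ R' : W → GenericModel → Prop, IsPartIso R' ∧ (relDom R').Finite ∧ x ∈ relDom R' ∧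
      ∀ y y', R y y' → R' y y' := by
  classical
  have hG := GenericModel.isSelectorModel
  let S : Set W := insert x ((fun f => evalAt f x) '' relDom R)
  have hS : S.Finite := (hd.image _).insert x
  have hSx : ∀ y ∈ S, EqRel y x := by
    rintro y (rfl | ⟨f, -, rfl⟩)
    · exact hW.refl _ ox
    · exact evalAt_eqRel hW ox
  obtain ⟨code, hcode⟩ : ∃ code : W → ℕ, Set.InjOn code S :=
    Set.countable_iff_exists_injOn.1 hS.countable
  have hr := hR.finite_ran hd
  have hfin : {f : ℕ | fn f ∈ relRan R}.Finite :=
    hr.preimage (fun a _ b _ h => fn_inj.1 h)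
  have hcol : {i : ℕ | ∃ j, ob i j ∈ relRan R}.Finite := by
    have := hr.image fun y : GenericModel => Sum.elim (fun _ => 0) (fun p : ℕ × ℕ => p.1) y
    refine this.subset ?_
    rintro i ⟨j, hj⟩
    exact ⟨_, hj, rfl⟩
  -- The pattern wanted in the new column; it is well defined because `R` is one-to-one.
  have hex : ∀ f : ℕ, ∃ c : ℕ, ∀ g, R g (fn f) → c = code (evalAt g x) := by
    intro f
    by_cases h : ∃ g, R g (fn f)
    · obtain ⟨g, hg⟩ := h
      exact ⟨code (evalAt g x), fun g' hg' => by rw [(hR.eq_iff hg hg').2 rfl]⟩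
    · exact ⟨0, fun g hg => absurd ⟨g, hg⟩ h⟩
  choose t ht using hex
  obtain ⟨i, hi, hit⟩ := exists_column hfin.toFinset hcol.toFinset t
  have hi' : ∀ j, ob i j ∉ relRan R := fun j hj => hi (hcol.mem_toFinset.2 ⟨j, hj⟩)
  have hcls : ∀ {y y' w}, R y y' → w ∈ S → ¬ EqRel y w := fun {y y' w} hy hw h =>
    hx y ⟨y', hy⟩ (hW.symm _ _ (hW.trans _ _ _ h (hSx _ hw)))
  have hcls' : ∀ {y y' j}, R y y' → ¬ EqRel y' (ob i j) := fun {y y' j} hy h => by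
    obtain ⟨a, b, rfl⟩ := exists_ob (hG.rel_obj _ _ h).1
    obtain rfl : a = i := h
    exact hi' b ⟨_, hy⟩
  have oS : ∀ y ∈ S, IsObj y := fun y hy => (hW.rel_obj _ _ (hSx y hy)).1
  have hev : ∀ {f f' y}, R f f' → y ∈ S → ¬ IsObj f →
      evalAt f y ∈ S ∧ evalAt f' (ob i (code y)) = ob i (code (evalAt f y)) := by
    intro f f' y hf hy of
    have h1 : evalAt f y = evalAt f x := evalAt_congr hW of (hSx y hy)
    obtain ⟨g, rfl⟩ := exists_fn fun h => of ((hR.obj_iff hf).2 h)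
    rw [h1, evalAt_fn_ob, hit g (hfin.mem_toFinset.2 ⟨f, hf⟩), ht g f hf]
    exact ⟨.inr ⟨f, ⟨_, hf⟩, rfl⟩, rfl⟩
  refine ⟨fun y y' => R y y' ∨ (y ∈ S ∧ y' = ob i (code y)), ?_, ?_,
    ⟨_, .inr ⟨.inl rfl, rfl⟩⟩, fun _ _ => .inl⟩
  · constructor
    · rintro y y' w w' (h1 | ⟨h1, rfl⟩) (h2 | ⟨h2, rfl⟩)
      · exact hR.eq_iff h1 h2
      · refine iff_of_false ?_ ?_
        · rintro rfl; exact hcls h1 h2 (hW.refl _ (oS _ h2))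
        · rintro rfl; exact hi' _ ⟨_, h1⟩
      · refine iff_of_false ?_ ?_
        · rintro rfl; exact hcls h2 h1 (hW.refl _ (oS _ h1))
        · rintro rfl; exact hi' _ ⟨_, h2⟩
      · rw [ob_inj]
        simp only [true_and]
        exact (hcode.eq_iff h1 h2).symm
    · rintro y y' (h1 | ⟨h1, rfl⟩)
      · exact hR.obj_iff h1
      · exact iff_of_true (oS _ h1) (isObj_ob _ _)
    · rintro y y' w w' (h1 | ⟨h1, rfl⟩) (h2 | ⟨h2, rfl⟩)
      · exact hR.rel_iff h1 h2
      · exact iff_of_false (hcls h1 h2) (hcls' h1)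
      · rw [eqRel_comm hW, eqRel_comm hG]
        exact iff_of_false (hcls h2 h1) (hcls' h2)
      · exact iff_of_true (hW.trans _ _ _ (hSx _ h1) (hW.symm _ _ (hSx _ h2))) rfl
    · rintro y y' w w' (h1 | ⟨h1, rfl⟩) (h2 | ⟨h2, rfl⟩)
      · exact .inl (hR.eval h1 h2)
      · by_cases oy : IsObj y
        · rw [evalAt_of_not_fn hW oy, evalAt_of_not_fn hG ((hR.obj_iff h1).1 oy)]
          exact .inr ⟨h2, rfl⟩
        · obtain ⟨ha, hb⟩ := hev h1 h2 oy
          exact .inr ⟨ha, hb⟩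
      · rw [evalAt_of_not_fn hW (oS _ h1), evalAt_of_not_fn hG (isObj_ob _ _)]
        exact .inl h2
      · rw [evalAt_of_not_fn hW (oS _ h1), evalAt_of_not_fn hG (isObj_ob _ _)]
        exact .inr ⟨h2, rfl⟩
  · refine (hd.union hS).subset ?_
    rintro y ⟨y', h | ⟨h, -⟩⟩
    · exact .inl ⟨_, h⟩
    · exact .inr h

/-- The values of the new function are added first, as objects of classes already present. A fresh
row with the resulting pattern then serves as its image. -/
theorem extend_fn (hW : IsSelectorModel W) {R : W → GenericModel → Prop} (hR : IsPartIso R)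
    (hd : (relDom R).Finite) {x : W} (ox : ¬ IsObj x) :
    ∃ R' : W → GenericModel → Prop, IsPartIso R' ∧ (relDom R').Finite ∧ x ∈ relDom R' ∧
      ∀ y y', R y y' → R' y y' := by
  classical
  have hG := GenericModel.isSelectorModel
  by_cases hx : x ∈ relDom R
  · exact ⟨R, hR, hd, hx, fun _ _ h => h⟩
  let S : Set W := (fun z => evalAt x z) '' (relDom R ∩ {z | IsObj z})
  obtain ⟨R₁, h1, h2, h3, h4, h5⟩ := extend_classes hW hR hd (S := S)
    ((hd.inter_of_left _).image _) (by
      rintro _ ⟨z, ⟨hz, oz⟩, rfl⟩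
      exact ⟨z, hz, evalAt_eqRel hW oz⟩)
  -- The added values create no new class, so a single round of additions suffices.
  have hSd : ∀ z ∈ relDom R₁, IsObj z → evalAt x z ∈ relDom R₁ := by
    intro z hz oz
    rcases h5 z hz with h | ⟨w, hw, rfl⟩
    · exact h3 ⟨z, ⟨h, oz⟩, rfl⟩
    · rw [evalAt_evalAt_right hW ox]
      exact h3 ⟨w, hw, rfl⟩
  have hx1 : x ∉ relDom R₁ := by
    intro h
    rcases h5 x h with h | ⟨w, hw, hwx⟩
    · exact hx h
    · exact ox (hwx ▸ (isObj_evalAt hW).2 hw.2)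
  have hr := h1.finite_ran h2
  have hfin : {f : ℕ | fn f ∈ relRan R₁}.Finite :=
    hr.preimage (fun a _ b _ h => fn_inj.1 h)
  have hcol : {i : ℕ | ∃ j, ob i j ∈ relRan R₁}.Finite := by
    have := hr.image fun y : GenericModel => Sum.elim (fun _ => 0) (fun p : ℕ × ℕ => p.1) y
    refine this.subset ?_
    rintro i ⟨j, hj⟩
    exact ⟨_, hj, rfl⟩
  have hex : ∀ i : ℕ, ∃ c : ℕ, ∀ z j, R₁ z (ob i j) → R₁ (evalAt x z) (ob i c) := by
    intro i
    by_cases h : ∃ z j, R₁ z (ob i j)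
    · obtain ⟨z, j, hz⟩ := h
      have oz := (h1.obj_iff hz).2 (isObj_ob _ _)
      obtain ⟨y', hy'⟩ := hSd z ⟨_, hz⟩ oz
      obtain ⟨a, b, rfl⟩ := exists_ob ((h1.obj_iff hy').1 ((isObj_evalAt hW).2 oz))
      obtain rfl : a = i := (h1.rel_iff hy' hz).1 (evalAt_eqRel hW oz)
      refine ⟨b, fun w k hw => ?_⟩
      rw [evalAt_congr hW ox ((h1.rel_iff hw hz).2 rfl)]
      exact hy'
    · exact ⟨0, fun z j hz => absurd ⟨z, j, hz⟩ h⟩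
  choose t ht using hex
  obtain ⟨f, hf, hft⟩ := exists_row hcol.toFinset hfin.toFinset t
  have hf' : fn f ∉ relRan R₁ := fun h => hf (hfin.mem_toFinset.2 h)
  refine ⟨fun y y' => R₁ y y' ∨ (y = x ∧ y' = fn f), ?_, finite_relDom_or h2 _ _,
    ⟨_, .inr ⟨rfl, rfl⟩⟩, fun _ _ h => .inl (h4 _ _ h)⟩
  constructor
  · rintro y y' w w' (k1 | ⟨rfl, rfl⟩) (k2 | ⟨rfl, rfl⟩)
    · exact h1.eq_iff k1 k2
    · exact iff_of_false (fun h => hx1 ⟨_, h ▸ k1⟩) (fun h => hf' ⟨_, h ▸ k1⟩)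
    · exact iff_of_false (fun h => hx1 ⟨_, h ▸ k2⟩) (fun h => hf' ⟨_, h ▸ k2⟩)
    · simp
  · rintro y y' (k1 | ⟨rfl, rfl⟩)
    · exact h1.obj_iff k1
    · exact iff_of_false ox (isObj_fn _)
  · rintro y y' w w' (k1 | ⟨rfl, rfl⟩) (k2 | ⟨rfl, rfl⟩)
    · exact h1.rel_iff k1 k2
    · exact iff_of_false (fun h => ox (hW.rel_obj _ _ h).2)
        (fun h => isObj_fn _ (hG.rel_obj _ _ h).2)
    · exact iff_of_false (fun h => ox (hW.rel_obj _ _ h).1)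
        (fun h => isObj_fn _ (hG.rel_obj _ _ h).1)
    · exact iff_of_false (fun h => ox (hW.rel_obj _ _ h).1)
        (fun h => isObj_fn _ (hG.rel_obj _ _ h).1)
  · rintro y y' w w' (k1 | ⟨rfl, rfl⟩) (k2 | ⟨rfl, rfl⟩)
    · exact .inl (h1.eval k1 k2)
    · rw [evalAt_of_not_obj hW ox, evalAt_of_not_obj hG (isObj_fn _)]
      exact .inr ⟨rfl, rfl⟩
    · by_cases ow : IsObj w
      · obtain ⟨i, j, rfl⟩ := exists_ob ((h1.obj_iff k2).1 ow)
        rw [evalAt_fn_ob, hft i (hcol.mem_toFinset.2 ⟨j, _, k2⟩)]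
        exact .inl (ht i _ _ k2)
      · rw [evalAt_of_not_obj hW ow, evalAt_of_not_obj hG fun h => ow ((h1.obj_iff k2).2 h)]
        exact .inl k2
    · rw [evalAt_of_not_obj hW ox, evalAt_of_not_obj hG (isObj_fn _)]
      exact .inr ⟨rfl, rfl⟩

/-- The extension property of the generic model. -/
theorem IsPartIso.extend (hW : IsSelectorModel W) {R : W → GenericModel → Prop} (hR : IsPartIso R)
    (hd : (relDom R).Finite) (x : W) :
    ∃ R' : W → GenericModel → Prop, IsPartIso R' ∧ (relDom R').Finite ∧ x ∈ relDom R' ∧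
      ∀ y y', R y y' → R' y y' := by
  by_cases ox : IsObj x
  · by_cases hx : ∃ z ∈ relDom R, EqRel x z
    · obtain ⟨z, hz, hxz⟩ := hx
      obtain ⟨R', h1, h2, h3, h4, -⟩ := extend_class hW hR hd hz hxz
      exact ⟨R', h1, h2, h3, h4⟩
    · push Not at hx
      exact extend_newClass hW hR hd ox hx
  · exact extend_fn hW hR hd ox

theorem finite_relDom_genRel {N J : Type*} [Finite J] [selLang.Structure N] (v : J → W)
    (v' : J → N) : (relDom (genRel v v')).Finite := by
  refine (Set.finite_range (tval v)).subset ?_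
  rintro x ⟨y, t, rfl, -⟩
  exact ⟨t, rfl⟩

theorem SameQF.extend (hW : IsSelectorModel W) {J : Type*} [Finite J] {v : J → W}
    {v' : J → GenericModel} (h : SameQF v v') (x : W) :
    ∃ R : W → GenericModel → Prop, IsPartIso R ∧ (∀ i, R (v i) (v' i)) ∧ ∃ x', R x x' := by
  obtain ⟨R, h1, -, h2, h3⟩ := (h.isPartIso hW GenericModel.isSelectorModel).extend hW
    (finite_relDom_genRel v v') x
  exact ⟨R, h1, fun i => h3 _ _ (genRel_base v v' i), h2⟩

theorem exists_sameQF_genericModel (hW : IsSelectorModel W) {S : Set W} (hS : S.Finite) :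
    ∃ R : W → GenericModel → Prop, IsPartIso R ∧ (relDom R).Finite ∧ S ⊆ relDom R := by
  induction S, hS using Set.Finite.induction_on with
  | empty =>
    exact ⟨_, isPartIso_false, by simp [relDom], Set.empty_subset _⟩
  | @insert a S _ _ ih =>
    obtain ⟨R, h1, h2, h3⟩ := ih
    obtain ⟨R', k1, k2, k3, k4⟩ := h1.extend hW h2 a
    refine ⟨R', k1, k2, Set.insert_subset k3 fun y hy => ?_⟩
    obtain ⟨y', hy'⟩ := h3 hy
    exact ⟨y', k4 _ _ hy'⟩

end Extension

/-! ### Embeddings of structures and local finiteness -/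

section Embeddings

variable {M : Type*} [selLang.Structure M] {N : Type*} [selLang.Structure N]

theorem relMap_obj (x : Fin 1 → M) :
    Structure.RelMap (L := selLang) SelRel.obj x ↔ IsObj (x 0) := by
  have : x = ![x 0] := by ext i; fin_cases i; rfl
  rw [this]; rfl

theorem relMap_fn (x : Fin 1 → M) :
    Structure.RelMap (L := selLang) SelRel.fn x ↔ IsFn (x 0) := by
  have : x = ![x 0] := by ext i; fin_cases i; rfl
  rw [this]; rfl

theorem relMap_equiv (x : Fin 2 → M) :
    Structure.RelMap (L := selLang) SelRel.equiv x ↔ EqRel (x 0) (x 1) := by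
  have : x = ![x 0, x 1] := by ext i; fin_cases i <;> rfl
  rw [this]; rfl

theorem funMap_eval (x : Fin 2 → M) :
    Structure.funMap (L := selLang) SelFunc.eval x = evalAt (x 0) (x 1) := by
  have : x = ![x 0, x 1] := by ext i; fin_cases i <;> rfl
  rw [this]; rfl

/-- An isomorphism onto the image, as an embedding of structures. -/
def IsEmb.toEmbedding (hM : IsSelectorModel M) (hN : IsSelectorModel N) {f : M → N}
    (h : IsEmb f) : M ↪[selLang] N where
  toFun := f
  inj' := h.inj
  map_fun' := by
    rintro _ ⟨⟩ x
    rw [funMap_eval, funMap_eval]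
    exact (h.eval _ _).symm
  map_rel' := by
    rintro _ ⟨⟩ x
    · rw [relMap_obj, relMap_obj]; exact h.obj_iff _
    · rw [relMap_fn, relMap_fn, hM.isFn_iff, hN.isFn_iff]; exact not_congr (h.obj_iff _)
    · rw [relMap_equiv, relMap_equiv]; exact h.rel_iff _ _

theorem isEmb_embedding (f : M ↪[selLang] N) : IsEmb f where
  inj := f.injective
  obj_iff x := by
    have := f.map_rel SelRel.obj ![x]
    rwa [relMap_obj, relMap_obj] at this
  rel_iff x y := by
    have := f.map_rel SelRel.equiv ![x, y]
    rwa [relMap_equiv, relMap_equiv] at this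
  eval x y := by
    have := f.map_fun SelFunc.eval ![x, y]
    rw [funMap_eval, funMap_eval] at this
    exact this.symm

theorem isFn_embedding (f : M ↪[selLang] N) (x : M) : IsFn (f x) ↔ IsFn x := by
  have := f.map_rel SelRel.fn ![x]
  rwa [relMap_fn, relMap_fn] at this

theorem isSelectorModel_of_embedding (hN : IsSelectorModel N) (f : M ↪[selLang] N) :
    IsSelectorModel M := by
  have h := isEmb_embedding f
  have hf := isFn_embedding f
  constructor
  · intro x; rw [← hf, hN.isFn_iff, h.obj_iff]
  · intro x y hxy
    rw [← h.obj_iff, ← h.obj_iff]; exact hN.rel_obj _ _ ((h.rel_iff _ _).2 hxy)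
  · intro x hx
    exact (h.rel_iff _ _).1 (hN.refl _ ((h.obj_iff _).2 hx))
  · intro x y hx
    exact (h.rel_iff _ _).1 (hN.symm _ _ ((h.rel_iff _ _).2 hx))
  · intro x y z hx hy
    exact (h.rel_iff _ _).1 (hN.trans _ _ _ ((h.rel_iff _ _).2 hx) ((h.rel_iff _ _).2 hy))
  · intro x y hx hy
    rw [← h.rel_iff, ← h.eval]
    exact hN.eval_rel _ _ ((hf _).2 hx) ((h.obj_iff _).2 hy)
  · intro x y z hx hy
    apply h.inj
    rw [← h.eval, ← h.eval]
    exact hN.eval_congr _ _ _ ((hf _).2 hx) ((h.rel_iff _ _).2 hy)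
  · intro x y hxy
    apply h.inj
    rw [← h.eval]
    exact hN.eval_off _ _ fun hh => hxy ⟨(hf _).1 hh.1, (h.obj_iff _).1 hh.2⟩

theorem IsPartIso.exists_isEmb {R : M → N → Prop} (hR : IsPartIso R) (h : ∀ x, ∃ y, R x y) :
    ∃ f : M → N, IsEmb f ∧ ∀ x, R x (f x) := by
  choose f hf using h
  refine ⟨f, ⟨fun x y hxy => (hR.eq_iff (hf x) (hf y)).2 hxy, fun x => (hR.obj_iff (hf x)).symm,
    fun x y => (hR.rel_iff (hf x) (hf y)).symm, fun x y => ?_⟩, hf⟩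
  exact ((hR.eq_iff (hR.eval (hf x) (hf y)) (hf _)).1 rfl)

/-- The substructure generated by a family of elements. -/
def closedSubstructure (hM : IsSelectorModel M) {J : Type*} (v : J → M) :
    selLang.Substructure M where
  carrier := closed v
  fun_mem := by
    rintro _ ⟨⟩ x hx
    rw [funMap_eval]
    exact evalAt_mem_closed hM (hx 0) (hx 1)

theorem finite_of_fg (hM : IsSelectorModel M) {S : selLang.Substructure M} (hS : S.FG) :
    (S : Set M).Finite := by
  obtain ⟨t, rfl⟩ := hS
  have : Substructure.closure selLang (t : Set M) ≤ closedSubstructure hM ((↑) : t → M) :=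
    Substructure.closure_le.2 fun x hx => mem_closed ((↑) : t → M) ⟨x, hx⟩
  exact (Set.finite_range (tval ((↑) : t → M))).subset this

end Embeddings

/-! ### The generic model is the Fraïssé limit -/

section Limit

open GenericModel

/-- Ultrahomogeneity reduces to one-point extensions of embeddings of finitely generated
substructures. These are finite, so `IsPartIso.extend` applies. -/
theorem isUltrahomogeneous_genericModel : selLang.IsUltrahomogeneous GenericModel := by
  have hG := GenericModel.isSelectorModel
  rw [isUltrahomogeneous_iff_IsExtensionPair Structure.cg_of_countable,
    isExtensionPair_iff_exists_embedding_closure_singleton_sup]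
  intro S hS f m
  have hf := isEmb_embedding f
  have hs := isEmb_embedding S.subtype
  have hR := hs.isPartIso.swap.comp hf.isPartIso
  obtain ⟨R, h1, -, ⟨m', hm'⟩, h3⟩ := hR.extend hG ((finite_of_fg hG hS).subset (by
    rintro x ⟨y, z, rfl, -⟩; exact z.2)) m
  have hle : Substructure.closure selLang {m} ⊔ S ≤
      (⟨relDom R, by
        rintro _ ⟨⟩ x hx
        rw [funMap_eval]
        obtain ⟨a, ha⟩ := hx 0
        obtain ⟨b, hb⟩ := hx 1
        exact ⟨_, h1.eval ha hb⟩⟩ : selLang.Substructure GenericModel) := by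
    refine sup_le (Substructure.closure_le.2 ?_) ?_
    · rintro _ rfl; exact ⟨m', hm'⟩
    · intro x hx
      exact ⟨f ⟨x, hx⟩, h3 _ _ ⟨⟨x, hx⟩, rfl, rfl⟩⟩
  have hsub := isEmb_embedding (Substructure.closure selLang {m} ⊔ S).subtype
  obtain ⟨g, hg, hgR⟩ := (hsub.isPartIso.comp h1).exists_isEmb fun x => by
    obtain ⟨y, hy⟩ := hle x.2
    exact ⟨y, _, rfl, hy⟩
  refine ⟨hg.toEmbedding (isSelectorModel_of_embedding hG (Substructure.subtype _)) hG, ?_⟩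
  ext x
  obtain ⟨y, hy, hy'⟩ := hgR (Substructure.inclusion le_sup_right x)
  refine (h1.eq_iff (h3 _ _ ⟨x, rfl, rfl⟩) hy').1 ?_
  rw [hy]; rfl

theorem age_genericModel : selLang.age GenericModel = finiteSelectorModels := by
  have hG := GenericModel.isSelectorModel
  ext N
  constructor
  · rintro ⟨hN, ⟨f⟩⟩
    have hs := isSelectorModel_of_embedding hG f
    refine ⟨?_, hs⟩
    have := finite_of_fg hs (Structure.fg_def.1 hN)
    exact Set.finite_univ_iff.1 this
  · rintro ⟨hfin, hs⟩
    refine ⟨Structure.FG.of_finite, ?_⟩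
    obtain ⟨R, h1, -, h2⟩ := exists_sameQF_genericModel hs (Set.finite_univ (α := N))
    obtain ⟨g, hg, -⟩ := h1.exists_isEmb fun x => h2 (Set.mem_univ x)
    exact ⟨hg.toEmbedding hs hG⟩

theorem isFraisseLimit_genericModel : IsFraisseLimit finiteSelectorModels GenericModel :=
  ⟨isUltrahomogeneous_genericModel, age_genericModel⟩

/-- Countable Fraïssé limits of the same class are isomorphic, so one of them decides the theory. -/
theorem selectorTheory_eq : selectorTheory = selLang.completeTheory GenericModel := by
  ext φ
  constructor
  · exact fun h => h GenericModel isFraisseLimit_genericModel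
  · intro h M _ _ hM
    obtain ⟨e⟩ := isFraisseLimit_genericModel.nonempty_equiv hM
    exact (StrongHomClass.realize_sentence e φ).1 h

theorem selectorTheory_isComplete : selectorTheory.IsComplete := by
  rw [selectorTheory_eq]
  exact completeTheory.isComplete _ _

instance : GenericModel ⊨ selectorTheory := by
  rw [selectorTheory_eq]; infer_instance

theorem realize_sentence_iff (M : Type*) [selLang.Structure M] [hM : M ⊨ selectorTheory]
    (φ : selLang.Sentence) : M ⊨ φ ↔ GenericModel ⊨ φ := by
  have : M ⊨ selLang.completeTheory GenericModel := selectorTheory_eq ▸ hM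
  exact realize_iff_of_model_completeTheory GenericModel M φ

end Limit

/-! ### Quantifier elimination -/

section BackAndForth

open Classical in
/-- The formula which says that the atoms that hold are exactly those in `κ`. -/
noncomputable def diagramFormula {J : Type*} [Finite J] (κ : Atom J → Prop) : selLang.Formula J :=
  Formula.iInf fun a => if κ a then atomFormula a else (atomFormula a).not

theorem realize_diagramFormula {J : Type*} [Finite J] (κ : Atom J → Prop)
    {M : Type*} [selLang.Structure M] (v : J → M) :
    (diagramFormula κ).Realize v ↔ ∀ a, atomHolds v a ↔ κ a := by
  rw [diagramFormula, Formula.realize_iInf]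
  refine forall_congr' fun a => ?_
  split_ifs with h <;> simp [h]

variable (M : Type*) [selLang.Structure M] [M ⊨ selectorTheory]
  (N : Type*) [selLang.Structure N] [N ⊨ selectorTheory]

variable {M} in
-- The atomic diagram of a finite family is a single formula, and its satisfiability is a sentence
-- on which all models agree.
theorem exists_atomHolds_iff {J : Type*} [Finite J] (v : J → M) :
    ∃ v' : J → GenericModel, ∀ a, atomHolds v a ↔ atomHolds v' a := by
  let φ : selLang.Sentence := Formula.iExs J ((diagramFormula (atomHolds v)).relabel Sum.inr)
  have h : M ⊨ φ := by
    refine Formula.realize_iExs.2 ⟨v, ?_⟩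
    rw [Formula.realize_relabel, Sum.elim_comp_inr, realize_diagramFormula]
    exact fun _ => Iff.rfl
  rw [realize_sentence_iff] at h
  obtain ⟨v', hv'⟩ := Formula.realize_iExs.1 h
  rw [Formula.realize_relabel, Sum.elim_comp_inr, realize_diagramFormula] at hv'
  exact ⟨v', fun a => (hv' a).symm⟩

/-- The sentence which says that the functions are the elements that are not objects. -/
noncomputable def sortsSentence : selLang.Sentence :=
  Formula.iAlls Unit (((Relations.formula₁ (L := selLang) SelRel.fn (.var ())).iff
    (Relations.formula₁ (L := selLang) SelRel.obj (.var ())).not).relabel Sum.inr)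

theorem realize_sortsSentence (K : Type*) [selLang.Structure K] :
    K ⊨ sortsSentence ↔ ∀ x : K, IsFn x ↔ ¬ IsObj x := by
  refine Formula.realize_iAlls.trans ?_
  have (v : Unit → K) : Formula.Realize (((Relations.formula₁ (L := selLang) SelRel.fn
      (.var ())).iff (Relations.formula₁ (L := selLang) SelRel.obj (.var ())).not).relabel
      Sum.inr) (Sum.elim (default : Empty → K) v) ↔ (IsFn (v ()) ↔ ¬ IsObj (v ())) := by
    rw [Formula.realize_relabel, Sum.elim_comp_inr, Formula.realize_iff, Formula.realize_not]
    exact iff_congr (Formula.realize_rel₁ (L := selLang) (R := SelRel.fn))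
      (not_congr (Formula.realize_rel₁ (L := selLang) (R := SelRel.obj)))
  exact ⟨fun h x => (this fun _ => x).1 (h _), fun h v => (this v).2 (h _)⟩

/-- Apart from the axiom on sorts, each axiom concerns at most three elements and is pulled back
from the generic model by matching atomic diagrams. -/
theorem isSelectorModel_of_model : IsSelectorModel M := by
  have hG := GenericModel.isSelectorModel
  -- The value `evalAt x y` is listed as a fourth entry because the `E`-atoms relate variables only.
  have key : ∀ x y z : M, ∃ v : Fin 4 → GenericModel,
      ∀ a, atomHolds ![x, y, z, evalAt x y] a ↔ atomHolds v a :=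
    fun x y z => exists_atomHolds_iff _
  -- The predicate for functions does not occur in atoms, so this axiom is transferred as a
  -- sentence.
  have hfn : ∀ x : M, IsFn x ↔ ¬ IsObj x := by
    rw [← realize_sortsSentence, realize_sentence_iff, realize_sortsSentence]
    exact hG.sorts
  constructor
  · exact hfn
  · intro x y hxy
    obtain ⟨v, hv⟩ := key x y x
    have h := hG.rel_obj _ _ ((hv (.inr (.inl (0, 1)))).1 hxy)
    exact ⟨(hv (.inl 0)).2 h.1, (hv (.inl 1)).2 h.2⟩
  · intro x hx
    obtain ⟨v, hv⟩ := key x x x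
    exact (hv (.inr (.inl (0, 0)))).2 (hG.refl _ ((hv (.inl 0)).1 hx))
  · intro x y hxy
    obtain ⟨v, hv⟩ := key x y x
    exact (hv (.inr (.inl (1, 0)))).2 (hG.symm _ _ ((hv (.inr (.inl (0, 1)))).1 hxy))
  · intro x y z hxy hyz
    obtain ⟨v, hv⟩ := key x y z
    exact (hv (.inr (.inl (0, 2)))).2 (hG.trans _ _ _ ((hv (.inr (.inl (0, 1)))).1 hxy)
      ((hv (.inr (.inl (1, 2)))).1 hyz))
  · intro x y hx hy
    obtain ⟨v, hv⟩ := key x y x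
    have h3 : v 3 = evalAt (v 0) (v 1) := (hv (.inr (.inr (.inl 3, .inr (0, 1))))).1 rfl
    refine (hv (.inr (.inl (3, 1)))).2 ?_
    have := hG.eval_rel (v 0) (v 1) (hG.isFn_iff.2 fun h => (hfn x).1 hx ((hv (.inl 0)).2 h))
      ((hv (.inl 1)).1 hy)
    rw [← h3] at this
    exact this
  · intro x y z hx hyz
    obtain ⟨v, hv⟩ := key x y z
    exact (hv (.inr (.inr (.inr (0, 1), .inr (0, 2))))).2 (hG.eval_congr (v 0) (v 1) (v 2)
      (hG.isFn_iff.2 fun h => (hfn x).1 hx ((hv (.inl 0)).2 h)) ((hv (.inr (.inl (1, 2)))).1 hyz))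
  · intro x y hxy
    obtain ⟨v, hv⟩ := key x y x
    refine (hv (.inr (.inr (.inr (0, 1), .inl 1)))).2 (hG.eval_off (v 0) (v 1) ?_)
    rintro ⟨h, h'⟩
    exact hxy ⟨(hfn x).2 fun hx => hG.isFn_iff.1 h ((hv (.inl 0)).1 hx), (hv (.inl 1)).2 h'⟩

variable {M N}

/-- For a fixed pair of finite diagrams, the extension property of the generic model is one
sentence, hence true in every model. -/
theorem exists_extend {J : Type*} [Finite J] (v : J → M) (v' : J ⊕ Unit → GenericModel)
    (h : ∀ a, atomHolds v a ↔ atomHolds (v' ∘ Sum.inl) a) :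
    ∃ x, ∀ a, atomHolds (Sum.elim v fun _ => x) a ↔ atomHolds v' a := by
  have hG := GenericModel.isSelectorModel
  let φ : selLang.Sentence := Formula.iAlls J (((diagramFormula (atomHolds v)).imp
    (Formula.iExs Unit (diagramFormula (atomHolds v')))).relabel Sum.inr)
  have h1 : GenericModel ⊨ φ := by
    refine Formula.realize_iAlls.2 fun w => ?_
    rw [Formula.realize_relabel, Sum.elim_comp_inr, Formula.realize_imp, realize_diagramFormula,
      Formula.realize_iExs]
    intro hw
    have hs : SameQF (v' ∘ Sum.inl) w :=
      (sameQF_iff hG hG).2 fun a => (h a).symm.trans (hw a).symm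
    obtain ⟨R, hR, hv, x, hx⟩ := hs.extend hG (v' (.inr ()))
    refine ⟨fun _ => x, (realize_diagramFormula _ _).2 fun a => ?_⟩
    refine (SameQF.atomHolds_iff ⟨R, hR, ?_⟩ a).symm
    rintro (i | i)
    · exact hv i
    · exact hx
  have h2 := Formula.realize_iAlls.1 ((realize_sentence_iff M φ).2 h1) v
  rw [Formula.realize_relabel, Sum.elim_comp_inr, Formula.realize_imp, realize_diagramFormula,
    Formula.realize_iExs] at h2
  obtain ⟨x, hx⟩ := h2 fun _ => Iff.rfl
  exact ⟨x (), (realize_diagramFormula _ _).1 hx⟩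

theorem SameQF.extend_model {J : Type*} [Finite J] {v : J → M} {w : J → N} (h : SameQF v w)
    (x : M) : ∃ y, SameQF (Sum.elim v fun _ : Unit => x) (Sum.elim w fun _ : Unit => y) := by
  have hM := isSelectorModel_of_model M
  have hN := isSelectorModel_of_model N
  obtain ⟨v', hv'⟩ := exists_atomHolds_iff (Sum.elim v fun _ : Unit => x)
  have hs : SameQF v (v' ∘ Sum.inl) :=
    ((sameQF_iff hM GenericModel.isSelectorModel).2 hv').comp Sum.inl
  obtain ⟨y, hy⟩ := exists_extend w v' (h.symm.trans hs).atomHolds_iff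
  exact ⟨y, (sameQF_iff hM hN).2 fun a => (hv' a).trans (hy a).symm⟩

theorem IsPartIso.realize_term {A B : Type*} [selLang.Structure A] [selLang.Structure B]
    {R : A → B → Prop} (hR : IsPartIso R) {α : Type*} {v : α → A} {w : α → B}
    (h : ∀ i, R (v i) (w i)) (t : selLang.Term α) : R (t.realize v) (t.realize w) := by
  induction t with
  | var i => exact h i
  | func f ts ih =>
    obtain ⟨⟩ := f
    simp only [Term.realize]
    rw [funMap_eval, funMap_eval]
    exact hR.eval (ih 0) (ih 1)

/-- The quantifier step is back-and-forth by `SameQF.extend_model`, which needs the family of free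
variables to be finite. -/
theorem SameQF.realize_bounded {α : Type*} [Finite α] {n : ℕ} (φ : selLang.BoundedFormula α n)
    {v : α → M} {w : α → N} {xs : Fin n → M} {ys : Fin n → N}
    (h : SameQF (Sum.elim v xs) (Sum.elim w ys)) : φ.Realize v xs ↔ φ.Realize w ys := by
  induction φ with
  | falsum => rfl
  | equal s t =>
    obtain ⟨R, hR, hv⟩ := h
    exact hR.eq_iff (hR.realize_term hv s) (hR.realize_term hv t)
  | rel r ts =>
    obtain ⟨R, hR, hv⟩ := h
    have ht := fun i => hR.realize_term hv (ts i)
    simp only [BoundedFormula.Realize]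
    obtain ⟨⟩ := r
    · rw [relMap_obj, relMap_obj]
      exact hR.obj_iff (ht 0)
    · rw [relMap_fn, relMap_fn, (isSelectorModel_of_model M).isFn_iff,
        (isSelectorModel_of_model N).isFn_iff]
      exact not_congr (hR.obj_iff (ht 0))
    · rw [relMap_equiv, relMap_equiv]
      exact hR.rel_iff (ht 0) (ht 1)
  | imp φ ψ ih1 ih2 => exact imp_congr (ih1 h) (ih2 h)
  | @all n φ ih =>
    have aux : ∀ {A B : Type _} [selLang.Structure A] [selLang.Structure B] {v : α → A} {w : α → B}
        {xs : Fin n → A} {ys : Fin n → B} {x : A} {y : B},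
        SameQF (Sum.elim (Sum.elim v xs) fun _ : Unit => x)
          (Sum.elim (Sum.elim w ys) fun _ : Unit => y) →
        SameQF (Sum.elim v (Fin.snoc xs x : Fin (n + 1) → A))
          (Sum.elim w (Fin.snoc ys y : Fin (n + 1) → B)) := by
      rintro A B _ _ v w xs ys x y ⟨R, hR, hv⟩
      refine ⟨R, hR, ?_⟩
      rintro (i | i)
      · exact hv (.inl (.inl i))
      · induction i using Fin.lastCases with
        | last => simpa using hv (.inr ())
        | cast i => simpa using hv (.inl (.inr i))
    constructor
    · intro hx y
      obtain ⟨x, hxy⟩ := h.symm.extend_model y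
      exact (ih (aux hxy.symm)).1 (hx x)
    · intro hy x
      obtain ⟨y, hxy⟩ := h.extend_model x
      exact (ih (aux hxy)).2 (hy y)

/-- Quantifier elimination: families with the same quantifier-free type have the same type. -/
theorem SameQF.realize_iff {α : Type*} {v : α → M} {w : α → N} (h : SameQF v w)
    (φ : selLang.Formula α) : φ.Realize v ↔ φ.Realize w := by
  classical
  -- Only finitely many variables occur in `φ`, which reduces to the finite case.
  rw [Formula.Realize, Formula.Realize,
    ← BoundedFormula.realize_restrictFreeVar (φ := φ) (f := id)
      (v := fun i : φ.freeVarFinset => v i) v (fun _ => rfl),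
    ← BoundedFormula.realize_restrictFreeVar (φ := φ) (f := id)
      (v := fun i : φ.freeVarFinset => w i) w (fun _ => rfl)]
  refine SameQF.realize_bounded _ ?_
  obtain ⟨R, hR, hv⟩ := h
  refine ⟨R, hR, ?_⟩
  rintro (i | i)
  · exact hv i
  · exact i.elim0

/-- An isomorphism onto the image between models of `T*₁` is elementary. -/
def IsEmb.toElementary {f : M → N} (h : IsEmb f) : M ↪ₑ[selLang] N where
  toFun := f
  map_formula' _ φ x := ((h.sameQF x).realize_iff φ).symm

end BackAndForth

/-! ### Embedding models of `T₁` in models of `T*₁` -/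

section Compactness

variable {W : Type u} [selLang.Structure W]

/-- The variables of a term. -/
def Tm.vars {J : Type*} : Tm J → Set J
  | .inl i => {i}
  | .inr (i, j) => {i, j}

theorem Tm.finite_vars {J : Type*} (t : Tm J) : t.vars.Finite := by
  rcases t with i | ⟨i, j⟩ <;> simp [Tm.vars]

/-- The variables of an atomic formula. -/
def Atom.vars {J : Type*} : Atom J → Set J
  | .inl i => {i}
  | .inr (.inl (i, j)) => {i, j}
  | .inr (.inr (s, t)) => s.vars ∪ t.vars

theorem Atom.finite_vars {J : Type*} (a : Atom J) : (Atom.vars a).Finite := by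
  rcases a with i | ⟨i, j⟩ | ⟨s, t⟩
  · simp [Atom.vars]
  · simp [Atom.vars]
  · exact s.finite_vars.union t.finite_vars

theorem atomHolds_iff_of_vars {A B J : Type*} [selLang.Structure A] [selLang.Structure B]
    {R : A → B → Prop} (hR : IsPartIso R) {v : J → A} {w : J → B} (a : Atom J)
    (h : ∀ i ∈ Atom.vars a, R (v i) (w i)) : atomHolds v a ↔ atomHolds w a := by
  have ht : ∀ t : Tm J, (∀ i ∈ t.vars, R (v i) (w i)) → R (tval v t) (tval w t) := by
    rintro (i | ⟨i, j⟩) h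
    · exact h i rfl
    · exact hR.eval (h i (.inl rfl)) (h j (.inr rfl))
  rcases a with i | ⟨i, j⟩ | ⟨s, t⟩
  · exact hR.obj_iff (h i rfl)
  · exact hR.rel_iff (h i (.inl rfl)) (h j (.inr rfl))
  · exact hR.eq_iff (ht s fun i hi => h i (.inl hi)) (ht t fun i hi => h i (.inr hi))

/-- The sentences which hold in the generic model under every interpretation of the elements of `W`
which is a partial isomorphism on a suitable finite set. -/
def embeddingTheory (W : Type u) [selLang.Structure W] : (selLang[[W]]).Theory :=
  {φ | ∃ S : Set W, S.Finite ∧ ∀ (g : W → GenericModel) (R : W → GenericModel → Prop),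
    IsPartIso R → (∀ s ∈ S, R s (g s)) → (Formula.equivSentence.symm φ).Realize g}

/-- Finitely many sentences require a partial isomorphism only on a finite subset of `W`, and the
extension property provides one. The remaining constants are interpreted arbitrarily. -/
theorem embeddingTheory_isSatisfiable (hW : IsSelectorModel W) :
    (embeddingTheory W).IsSatisfiable := by
  classical
  rw [Theory.isSatisfiable_iff_isFinitelySatisfiable]
  intro T hT
  choose! S hS hST using fun φ (hφ : φ ∈ (T : (selLang[[W]]).Theory)) => hT hφ
  obtain ⟨R, hR, -, hd⟩ := exists_sameQF_genericModel hW
    (Set.Finite.biUnion T.finite_toSet hS)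
  have hg : ∃ g : W → GenericModel, ∀ x ∈ relDom R, R x (g x) := by
    have h : ∀ x, ∃ y, x ∈ relDom R → R x y := fun x => by
      by_cases hx : x ∈ relDom R
      · exact ⟨hx.choose, fun _ => hx.choose_spec⟩
      · exact ⟨Classical.arbitrary _, fun h => absurd h hx⟩
    choose g hg using h
    exact ⟨g, hg⟩
  obtain ⟨g, hg⟩ := hg
  let _ : (constantsOn W).Structure GenericModel := constantsOn.structure g
  have : GenericModel ⊨ (T : (selLang[[W]]).Theory) := by
    refine ⟨fun φ hφ => ?_⟩
    rw [← Formula.realize_equivSentence_symm]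
    exact hST φ hφ g R hR fun s hs => hg s (hd (Set.mem_biUnion hφ hs))
  exact Theory.Model.isSatisfiable GenericModel

/-- Every model of `T₁` embeds into a model of `T*₁`. -/
theorem exists_model (hW : IsSelectorModel W) :
    ∃ (N : Type u) (_ : selLang.Structure N) (_ : N ⊨ selectorTheory) (_ : Nonempty N)
      (f : W → N), IsEmb f := by
  obtain ⟨N⟩ := embeddingTheory_isSatisfiable hW
  let _ : selLang.Structure N := (selLang.lhomWithConstants W).reduct N
  have : (selLang.lhomWithConstants W).IsExpansionOn N := LHom.isExpansionOn_reduct _ _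
  let f : W → N := fun a => (selLang.con a : N)
  have key : ∀ φ : selLang.Formula W, (∃ S : Set W, S.Finite ∧ ∀ (g : W → GenericModel)
      (R : W → GenericModel → Prop), IsPartIso R → (∀ s ∈ S, R s (g s)) → φ.Realize g) →
      φ.Realize f := by
    rintro φ ⟨S, hS, h⟩
    refine (Formula.realize_equivSentence N φ).1 ?_
    refine N.is_model.realize_of_mem _ ⟨S, hS, fun g R hR hg => ?_⟩
    rw [Equiv.symm_apply_apply]
    exact h g R hR hg
  have hN : N ⊨ selectorTheory := by
    refine ⟨fun φ hφ => ?_⟩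
    have h := key (φ.relabel (Empty.elim : Empty → W)) ⟨∅, Set.finite_empty, fun g R _ _ => by
      rw [Formula.realize_relabel, Subsingleton.elim (g ∘ Empty.elim) default]
      exact Theory.realize_sentence_of_mem selectorTheory hφ⟩
    rw [Formula.realize_relabel, Subsingleton.elim (f ∘ Empty.elim) default] at h
    exact h
  -- An atom has finitely many variables, so either it or its negation belongs to `embeddingTheory
  -- W`.
  have hat : ∀ a : Atom W, atomHolds (id : W → W) a ↔ atomHolds f a := by
    intro a
    by_cases ha : atomHolds (id : W → W) a
    · refine iff_of_true ha ((realize_atomFormula f a).1 (key _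
        ⟨Atom.vars a, Atom.finite_vars a, fun g R hR hg => ?_⟩))
      rw [realize_atomFormula, ← atomHolds_iff_of_vars hR (v := id) a hg]
      exact ha
    · refine iff_of_false ha ?_
      have h := key (atomFormula a).not
        ⟨Atom.vars a, Atom.finite_vars a, fun g R hR hg => ?_⟩
      · rwa [Formula.realize_not, realize_atomFormula] at h
      · rw [Formula.realize_not, realize_atomFormula, ← atomHolds_iff_of_vars hR (v := id) a hg]
        exact ha
  have hp := isPartIso_genRel hW (isSelectorModel_of_model N) hat
  refine ⟨N, inferInstance, hN, inferInstance, f, ?_⟩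
  have hb := genRel_base (id : W → W) f
  exact ⟨fun x y h => (hp.eq_iff (hb x) (hb y)).2 h, fun x => (hp.obj_iff (hb x)).symm,
    fun x y => (hp.rel_iff (hb x) (hb y)).symm,
    fun x y => (hp.eq_iff (hp.eval (hb x) (hb y)) (hb _)).1 rfl⟩

end Compactness

/-! ### Amalgamation with prescribed selectors -/

section Amalgam

variable {N : Type u} [selLang.Structure N] {P : Type v} [selLang.Structure P]

/-- Gluing along `H` merges the classes that `H` links. No axiom ties a function private to one side
to a class private to the other, so its choice there is free: `α` and `β` are arbitrary rules that
respect classes. -/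
theorem exists_amalgam (hN : IsSelectorModel N) (hP : IsSelectorModel P) {H : P → N → Prop}
    (hH : IsPartIso H) (α : P → N → N) (β : N → P → P)
    (hα : ∀ f y, ¬ IsObj f → IsObj y → EqRel (α f y) y)
    (hα' : ∀ f y y', ¬ IsObj f → EqRel y y' → α f y = α f y')
    (hβ : ∀ g x, ¬ IsObj g → IsObj x → EqRel (β g x) x)
    (hβ' : ∀ g x x', ¬ IsObj g → EqRel x x' → β g x = β g x') :
    ∃ (W : Type max u v) (_ : selLang.Structure W) (ι : N → W) (τ : P → W),
      IsSelectorModel W ∧ IsEmb ι ∧ IsEmb τ ∧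
      (∀ p n, τ p = ι n ↔ H p n) ∧
      (∀ p n, EqRel (τ p) (ι n) ↔ ∃ p' n', H p' n' ∧ EqRel p p' ∧ EqRel n' n) ∧
      (∀ f y, ¬ IsObj f → f ∉ relDom H → IsObj y → (∀ y' ∈ relRan H, ¬ EqRel y y') →
        evalAt (τ f) (ι y) = ι (α f y)) ∧
      (∀ g x, ¬ IsObj g → g ∉ relRan H → IsObj x → (∀ x' ∈ relDom H, ¬ EqRel x x') →
        evalAt (ι g) (τ x) = τ (β g x)) := by
  classical
  let W := N ⊕ {p : P // p ∉ relDom H}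
  let τ : P → W := fun p => if h : p ∈ relDom H then .inl h.choose else .inr ⟨p, h⟩
  let link : P → N → Prop := fun p n => ∃ p' n', H p' n' ∧ EqRel p p' ∧ EqRel n' n
  let obj : W → Prop := fun w => Sum.elim (fun n => IsObj n) (fun p => IsObj p.1) w
  let rel : W → W → Prop := fun w w' => match w, w' with
    | .inl n, .inl n' => EqRel n n'
    | .inr p, .inl n => link p.1 n
    | .inl n, .inr p => link p.1 n
    | .inr p, .inr p' => EqRel p.1 p'.1
  let A : W → Set P := fun w => {p | rel (τ p) w}
  let B : W → Set N := fun w => {n | rel (.inl n) w}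
  -- A function acts through a member of the class on its own side if there is one, and functions
  -- identified by `H` count for both sides; otherwise `α` or `β` applies. Only the sets of members
  -- on the two sides enter, so equivalent arguments get equal values.
  let evF : W → Set P → Set N → W → W := fun f X Y d => match f with
    | .inl g => if h : Y.Nonempty then .inl (evalAt g h.some) else
        if h' : X.Nonempty then
          if hg : ∃ p, H p g then τ (evalAt hg.choose h'.some) else τ (β g h'.some)
        else d
    | .inr f => if h : X.Nonempty then τ (evalAt f.1 h.some) else
        if h' : Y.Nonempty then .inl (α f.1 h'.some) else d
  let ev : W → W → W := fun f b => if ¬ obj f ∧ obj b then evF f (A b) (B b) f else b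
  have τ_inl : ∀ {p n}, H p n → τ p = .inl n := by
    intro p n h
    have hp : p ∈ relDom H := ⟨n, h⟩
    have : τ p = .inl hp.choose := dif_pos hp
    rw [this, (hH.eq_iff hp.choose_spec h).1 rfl]
  have τ_inr : ∀ {p} (h : p ∉ relDom H), τ p = .inr ⟨p, h⟩ := fun h => dif_neg h
  have τ_eq_inl : ∀ p n, τ p = .inl n ↔ H p n := by
    intro p n
    refine ⟨fun h => ?_, τ_inl⟩
    by_cases hp : p ∈ relDom H
    · obtain ⟨n', hn'⟩ := hp
      rw [τ_inl hn'] at h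
      rwa [← Sum.inl_injective h]
    · rw [τ_inr hp] at h
      exact absurd h (by simp)
  have τ_inj : Function.Injective τ := by
    intro p p' h
    by_cases hp : p ∈ relDom H
    · obtain ⟨n, hn⟩ := hp
      rw [τ_inl hn, eq_comm, τ_eq_inl] at h
      exact (hH.eq_iff hn h).2 rfl
    · by_cases hp' : p' ∈ relDom H
      · obtain ⟨n, hn⟩ := hp'
        rw [τ_inl hn, τ_eq_inl] at h
        exact absurd ⟨n, h⟩ hp
      · rw [τ_inr hp, τ_inr hp'] at h
        simpa using Sum.inr_injective h
  have link_iff : ∀ {p n q}, H p n → (link q n ↔ EqRel q p) := by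
    intro p n q h
    constructor
    · rintro ⟨p', n', h1, h2, h3⟩
      exact hP.trans _ _ _ h2 ((hH.rel_iff h1 h).2 h3)
    · intro h'
      exact ⟨p, n, h, h', hN.refl _ ((hH.obj_iff h).1 (hP.rel_obj _ _ h').2)⟩
  have link_iff' : ∀ {p n m}, H p n → (link p m ↔ EqRel n m) := by
    intro p n m h
    constructor
    · rintro ⟨p', n', h1, h2, h3⟩
      exact hN.trans _ _ _ ((hH.rel_iff h h1).1 h2) h3
    · intro h'
      exact ⟨p, n, h, hP.refl _ ((hH.obj_iff h).2 (hN.rel_obj _ _ h').1), h'⟩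
  have obj_τ : ∀ p, obj (τ p) ↔ IsObj p := by
    intro p
    by_cases hp : p ∈ relDom H
    · obtain ⟨n, hn⟩ := hp
      rw [τ_inl hn]; exact (hH.obj_iff hn).symm
    · rw [τ_inr hp]; exact Iff.rfl
  have rel_τ_inl : ∀ p n, rel (τ p) (.inl n) ↔ link p n := by
    intro p n
    by_cases hp : p ∈ relDom H
    · obtain ⟨m, hm⟩ := hp
      rw [τ_inl hm]; exact (link_iff' hm).symm
    · rw [τ_inr hp]
  have rel_symm : ∀ x y, rel x y → rel y x := by
    rintro (x | x) (y | y) h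
    · exact hN.symm _ _ h
    · exact h
    · exact h
    · exact hP.symm _ _ h
  have link_trans : ∀ {p q n}, EqRel p q → link q n → link p n := by
    rintro p q n h ⟨p', n', h1, h2, h3⟩
    exact ⟨p', n', h1, hP.trans _ _ _ h h2, h3⟩
  have link_trans' : ∀ {p n m}, link p n → EqRel n m → link p m := by
    rintro p n m ⟨p', n', h1, h2, h3⟩ h
    exact ⟨p', n', h1, h2, hN.trans _ _ _ h3 h⟩
  have link_link : ∀ {p q n}, link p n → link q n → EqRel p q := by
    rintro p q n ⟨p', n', h1, h2, h3⟩ ⟨q', m', k1, k2, k3⟩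
    exact hP.trans _ _ _ h2 (hP.trans _ _ _
      ((hH.rel_iff h1 k1).2 (hN.trans _ _ _ h3 (hN.symm _ _ k3))) (hP.symm _ _ k2))
  have link_link' : ∀ {p n m}, link p n → link p m → EqRel n m := by
    rintro p n m ⟨p', n', h1, h2, h3⟩ ⟨q', m', k1, k2, k3⟩
    exact hN.trans _ _ _ (hN.symm _ _ h3) (hN.trans _ _ _
      ((hH.rel_iff h1 k1).1 (hP.trans _ _ _ (hP.symm _ _ h2) k2)) k3)
  have rel_trans : ∀ x y z, rel x y → rel y z → rel x z := by
    rintro (x | x) (y | y) (z | z) h h'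
    · exact hN.trans _ _ _ h h'
    · exact link_trans' h' (hN.symm _ _ h)
    · exact link_link' h h'
    · exact link_trans (hP.symm _ _ h') h
    · exact link_trans' h h'
    · exact link_link h h'
    · exact link_trans h h'
    · exact hP.trans _ _ _ h h'
  have rel_ττ : ∀ p q, rel (τ p) (τ q) ↔ EqRel p q := by
    intro p q
    by_cases hq : q ∈ relDom H
    · obtain ⟨m, hm⟩ := hq
      rw [τ_inl hm, rel_τ_inl, link_iff hm]
    · by_cases hp : p ∈ relDom H
      · obtain ⟨m, hm⟩ := hp
        rw [τ_inl hm, τ_inr hq]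
        exact (link_iff hm).trans (eqRel_comm hP)
      · rw [τ_inr hp, τ_inr hq]
  have rel_obj : ∀ x y, rel x y → obj x ∧ obj y := by
    have hl : ∀ {p n}, link p n → IsObj p ∧ IsObj n := by
      rintro p n ⟨p', n', h1, h2, h3⟩
      exact ⟨(hP.rel_obj _ _ h2).1, (hN.rel_obj _ _ h3).2⟩
    rintro (x | x) (y | y) h
    · exact hN.rel_obj _ _ h
    · exact (hl h).symm
    · exact hl h
    · exact hP.rel_obj _ _ h
  have rel_refl : ∀ x, obj x → rel x x := by
    rintro (x | x) h
    · exact hN.refl _ h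
    · exact hP.refl _ h
  have rel_inl : ∀ n m, rel (.inl n) (.inl m) ↔ EqRel n m := fun _ _ => Iff.rfl
  have AB : ∀ b, obj b → (A b).Nonempty ∨ (B b).Nonempty := by
    rintro (b | b) h
    · exact .inr ⟨b, hN.refl _ h⟩
    · refine .inl ⟨b.1, ?_⟩
      change rel (τ b.1) _
      rw [τ_inr b.2]
      exact hP.refl _ h
  have ev_inl_pos : ∀ g b n, ¬ IsObj g → rel (.inl n) b → ev (.inl g) b = .inl (evalAt g n) := by
    intro g b n hg hn
    have h : (B b).Nonempty := ⟨n, hn⟩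
    have h1 : ev (.inl g) b = .inl (evalAt g h.some) :=
      (if_pos ⟨hg, (rel_obj _ _ hn).2⟩).trans (dif_pos h)
    rw [h1, evalAt_congr hN hg]
    exact (rel_inl _ _).1 (rel_trans _ _ _ h.some_mem (rel_symm _ _ hn))
  have ev_inl_neg : ∀ g x, ¬ IsObj g → IsObj x → ¬ (B (τ x)).Nonempty → g ∉ relRan H →
      ev (.inl g) (τ x) = τ (β g x) := by
    intro g x hg hx hB hr
    have h : (A (τ x)).Nonempty := ⟨x, (rel_ττ _ _).2 (hP.refl _ hx)⟩
    have h1 : ev (.inl g) (τ x) = τ (β g h.some) :=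
      (if_pos ⟨hg, (obj_τ x).2 hx⟩).trans ((dif_neg hB).trans ((dif_pos h).trans (dif_neg hr)))
    rw [h1, hβ' g _ x hg]
    exact (rel_ττ _ _).1 h.some_mem
  have ev_τ : ∀ f b x, ¬ IsObj f → rel (τ x) b → ev (τ f) b = τ (evalAt f x) := by
    intro f b x hf hx
    have hA : (A b).Nonempty := ⟨x, hx⟩
    by_cases hd : f ∈ relDom H
    · obtain ⟨g, hg⟩ := hd
      have hgo : ¬ IsObj g := fun h => hf ((hH.obj_iff hg).2 h)
      rw [τ_inl hg]
      by_cases hB : (B b).Nonempty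
      · obtain ⟨n, hn⟩ := hB
        rw [ev_inl_pos g b n hgo hn]
        -- A class that meets both sides contains a pair matched by `H`, and the two evaluations
        -- agree there because `H` preserves `eval`.
        obtain ⟨p', n', h1, h2, h3⟩ :=
          (rel_τ_inl _ _).1 (rel_trans _ _ _ hx (rel_symm _ _ hn))
        rw [evalAt_congr hP hf h2, ← evalAt_congr hN hgo h3, τ_inl (hH.eval hg h1)]
      · have hex : ∃ p, H p g := ⟨f, hg⟩
        have h1 : ev (.inl g) b = τ (evalAt hex.choose hA.some) :=
          (if_pos ⟨hgo, (rel_obj _ _ hx).2⟩).trans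
            ((dif_neg hB).trans ((dif_pos hA).trans (dif_pos hex)))
        rw [h1, (hH.eq_iff hex.choose_spec hg).2 rfl, evalAt_congr hP hf]
        exact (rel_ττ _ _).1 (rel_trans _ _ _ hA.some_mem (rel_symm _ _ hx))
    · have h1 : ev (τ f) b = τ (evalAt f hA.some) := by
        rw [τ_inr hd]
        exact (if_pos ⟨hf, (rel_obj _ _ hx).2⟩).trans (dif_pos hA)
      rw [h1, evalAt_congr hP hf]
      exact (rel_ττ _ _).1 (rel_trans _ _ _ hA.some_mem (rel_symm _ _ hx))
  have ev_α : ∀ f y, ¬ IsObj f → f ∉ relDom H → IsObj y → ¬ (A (.inl y)).Nonempty →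
      ev (τ f) (.inl y) = .inl (α f y) := by
    intro f y hf hd hy hA
    have hB : (B (.inl y)).Nonempty := ⟨y, hN.refl _ hy⟩
    have h1 : ev (τ f) (.inl y) = .inl (α f hB.some) := by
      rw [τ_inr hd]
      exact (if_pos ⟨hf, hy⟩).trans ((dif_neg hA).trans (dif_pos hB))
    rw [h1, hα' f _ y hf]
    exact (rel_inl _ _).1 hB.some_mem
  have cases_τ : ∀ w : W, (∃ n, w = .inl n) ∨ ∃ p, p ∉ relDom H ∧ w = τ p := by
    rintro (n | p)
    · exact .inl ⟨n, rfl⟩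
    · exact .inr ⟨p.1, p.2, (τ_inr p.2).symm⟩
  have ev_off : ∀ x y, (obj x ∨ ¬ obj y) → ev x y = y := by
    intro x y h
    refine if_neg fun hh => ?_
    tauto
  have link_dom : ∀ {x n}, link x n → ∃ x' ∈ relDom H, EqRel x x' := by
    rintro x n ⟨p', n', h1, h2, -⟩
    exact ⟨p', ⟨_, h1⟩, h2⟩
  have link_ran : ∀ {x n}, link x n → ∃ n' ∈ relRan H, EqRel n n' := by
    rintro x n ⟨p', n', h1, -, h2⟩
    exact ⟨n', ⟨_, h1⟩, hN.symm _ _ h2⟩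
  let _ : selLang.Structure W := mkStructure obj rel ev
  refine ⟨W, inferInstance, .inl, τ, ?_, ?_, ?_, τ_eq_inl, rel_τ_inl, ?_, ?_⟩
  · refine mkStructure_isSelectorModel rel_obj rel_refl rel_symm rel_trans ?_ ?_ ev_off
    · intro f b hf hb
      rcases cases_τ f with ⟨g, rfl⟩ | ⟨f, hd, rfl⟩
      · by_cases hB : (B b).Nonempty
        · obtain ⟨n, hn⟩ := hB
          rw [ev_inl_pos g b n hf hn]
          exact rel_trans _ _ _ ((rel_inl _ _).2 (evalAt_eqRel hN (rel_obj _ _ hn).1)) hn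
        · obtain ⟨x, hx⟩ := (AB b hb).resolve_right hB
          by_cases hr : g ∈ relRan H
          · obtain ⟨p, hp⟩ := hr
            have hpo : ¬ IsObj p := fun h => hf ((hH.obj_iff hp).1 h)
            rw [← τ_inl hp, ev_τ p b x hpo hx]
            exact rel_trans _ _ _
              ((rel_ττ _ _).2 (evalAt_eqRel hP ((obj_τ _).1 (rel_obj _ _ hx).1))) hx
          · rcases cases_τ b with ⟨n, rfl⟩ | ⟨y, hy, rfl⟩
            · exact absurd ⟨n, hN.refl _ hb⟩ hB
            · have oy := (obj_τ y).1 hb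
              rw [ev_inl_neg g y hf oy hB hr]
              exact (rel_ττ _ _).2 (hβ g y hf oy)
      · have hfo : ¬ IsObj f := fun h => hf ((obj_τ _).2 h)
        by_cases hA : (A b).Nonempty
        · obtain ⟨x, hx⟩ := hA
          rw [ev_τ f b x hfo hx]
          exact rel_trans _ _ _
            ((rel_ττ _ _).2 (evalAt_eqRel hP ((obj_τ _).1 (rel_obj _ _ hx).1))) hx
        · rcases cases_τ b with ⟨n, rfl⟩ | ⟨y, hy, rfl⟩
          · rw [ev_α f n hfo hd hb hA]
            exact (rel_inl _ _).2 (hα f n hfo hb)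
          · exact absurd ⟨y, (rel_ττ _ _).2 (hP.refl _ ((obj_τ y).1 hb))⟩ hA
    · intro f b b' hf hbb
      have hA : A b = A b' := Set.ext fun p =>
        ⟨fun h => rel_trans _ _ _ h hbb, fun h => rel_trans _ _ _ h (rel_symm _ _ hbb)⟩
      have hB : B b = B b' := Set.ext fun p =>
        ⟨fun h => rel_trans _ _ _ h hbb, fun h => rel_trans _ _ _ h (rel_symm _ _ hbb)⟩
      have h1 : ev f b = evF f (A b) (B b) f := if_pos ⟨hf, (rel_obj _ _ hbb).1⟩
      have h2 : ev f b' = evF f (A b') (B b') f := if_pos ⟨hf, (rel_obj _ _ hbb).2⟩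
      rw [h1, h2, hA, hB]
  · refine ⟨Sum.inl_injective, fun _ => Iff.rfl, fun _ _ => Iff.rfl, fun x y => ?_⟩
    change ev (.inl x) (.inl y) = _
    by_cases hxy : IsObj x ∨ ¬ IsObj y
    · rw [ev_off (.inl x) (.inl y) hxy, hN.eval_off]
      rw [hN.isFn_iff]; tauto
    · push Not at hxy
      exact ev_inl_pos x _ y hxy.1 (hN.refl _ hxy.2)
  · refine ⟨τ_inj, obj_τ, rel_ττ, fun x y => ?_⟩
    change ev (τ x) (τ y) = _
    by_cases hxy : IsObj x ∨ ¬ IsObj y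
    · rw [ev_off _ _ (by rwa [obj_τ, obj_τ]), hP.eval_off]
      rw [hP.isFn_iff]; tauto
    · push Not at hxy
      exact ev_τ x _ y hxy.1 ((rel_ττ _ _).2 (hP.refl _ hxy.2))
  · intro f y hf hd hy hr
    refine ev_α f y hf hd hy ?_
    rintro ⟨p, hp⟩
    obtain ⟨n', h1, h2⟩ := link_ran ((rel_τ_inl _ _).1 hp)
    exact hr n' h1 h2
  · intro g x hg hr hx hd
    refine ev_inl_neg g x hg hx ?_ hr
    rintro ⟨n, hn⟩
    obtain ⟨x', h1, h2⟩ := link_dom ((rel_τ_inl _ _).1 (rel_symm _ _ hn))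
    exact hd x' h1 h2

end Amalgam

/-! ### Descent of solutions along elementary embeddings -/

section Transfer

variable {M N : Type*} [selLang.Structure M] [selLang.Structure N]

/-- The formula which says that the instances of `φ(x; y)` at a finite family of parameters have a
common solution. -/
noncomputable def commonSolution {n : ℕ} {κ : Type} (ι : Type) [Finite ι]
    (φ : selLang.Formula (Fin n ⊕ κ)) : selLang.Formula (ι × κ) :=
  Formula.iExs (Fin n) (Formula.iInf fun i : ι =>
    φ.relabel (Sum.elim Sum.inr fun a => Sum.inl (i, a)))

theorem realize_commonSolution {n : ℕ} {κ : Type} {ι : Type} [Finite ι]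
    (φ : selLang.Formula (Fin n ⊕ κ)) (b : ι → κ → M) :
    (commonSolution ι φ).Realize (fun p => b p.1 p.2) ↔
      ∃ x : Fin n → M, ∀ i, φ.Realize (Sum.elim x (b i)) := by
  rw [commonSolution, Formula.realize_iExs]
  refine exists_congr fun x => ?_
  rw [Formula.realize_iInf]
  refine forall_congr' fun i => ?_
  rw [Formula.realize_relabel]
  have : (Sum.elim (fun p : ι × κ => b p.1 p.2) x) ∘
      (Sum.elim Sum.inr fun a => Sum.inl (i, a)) = Sum.elim x (b i) := by
    funext a; rcases a with a | a <;> rfl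
  rw [this]

theorem exists_realize_of_elementary (e : M ↪ₑ[selLang] N) {n : ℕ} {κ ι : Type} [Finite ι]
    (φ : selLang.Formula (Fin n ⊕ κ)) (b : ι → κ → M)
    (h : ∃ x : Fin n → N, ∀ i, φ.Realize (Sum.elim x (e ∘ b i))) :
    ∃ x : Fin n → M, ∀ i, φ.Realize (Sum.elim x (b i)) := by
  rw [← realize_commonSolution] at h ⊢
  exact (e.map_formula _ _).1 h

end Transfer

/-! ### Independent amalgamation of types -/

section SOP

/-- A monotone condition switches on at most once, so it spoils at most one of `Fintype.card Q + 1`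
blocks. -/
theorem exists_stable_block {Q : Type*} [Fintype Q] (p : Q → ℕ → Prop)
    (hp : ∀ q, Monotone (p q)) (L : ℕ) :
    ∃ b ≤ Fintype.card Q, ∀ q, p q ((b + 1) * L) → p q (b * L) := by
  by_contra! h
  choose g hg using fun b : Fin (Fintype.card Q + 1) => h b.1 (Nat.lt_succ_iff.1 b.2)
  have hinj : Function.Injective g := by
    have key : ∀ a b, a < b → g a ≠ g b := fun a b hab he => by
      refine (hg b).2 (hp _ (Nat.mul_le_mul_right L (Nat.succ_le_of_lt hab)) ?_)
      rw [← he]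
      exact (hg a).1
    intro a b hab
    rcases lt_trichotomy a b with h | h | h
    · exact absurd hab (key _ _ h)
    · exact h
    · exact absurd hab.symm (key _ _ h)
  have := Fintype.card_le_of_injective g hinj
  simp at this

/-- Amalgamation of the types of `d` over `b` and over `e`, the former moved to `b'`, over a
base `C`. -/
theorem exists_amalgam_types {M : Type u} [selLang.Structure M] [M ⊨ selectorTheory]
    {J K : Type*} {C : Set M} {S : M → M → Prop} (hS : IsPartIso S) (hC : ∀ c ∈ C, S c c)
    {d : J → M} {b b' e : K → M} (hb : ∀ a, S (b a) (b' a))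
    (h1 : ∀ x ∈ closed (Sum.elim d e), x ∈ relDom S ∨ x ∈ relRan S → x ∈ C)
    (h2 : ∀ x ∈ closed (Sum.elim d e), ∀ y, y ∈ relDom S ∨ y ∈ relRan S → EqRel x y →
      ∃ c ∈ C, EqRel x c)
    (h3 : ∀ x ∈ closed d, x ∈ closed e → x ∈ C)
    (h4 : ∀ x ∈ closed d, ∀ y ∈ closed e, EqRel x y → ∃ c ∈ C, EqRel x c) :
    ∃ (N : Type u) (_ : selLang.Structure N) (_ : N ⊨ selectorTheory) (f : M ↪ₑ[selLang] N)
      (d' : J → N), SameQF (Sum.elim d b) (Sum.elim d' (f ∘ b')) ∧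
        SameQF (Sum.elim d e) (Sum.elim d' (f ∘ e)) := by
  have hM := isSelectorModel_of_model M
  set G := closed (Sum.elim d e) with hG
  have hGc : ∀ x ∈ G, ∀ y ∈ G, evalAt x y ∈ G := fun x hx y hy => evalAt_mem_closed hM hx hy
  have hdG : closed d ⊆ G := closed_subset hGc fun i => mem_closed (Sum.elim d e) (.inl i)
  have heG : closed e ⊆ G := closed_subset hGc fun i => mem_closed (Sum.elim d e) (.inr i)
  -- Classes that meet `C` are common to both copies of `M`, so the objects of `G` in them, which
  -- include the values selected there, must be identified as well.
  let T : Set M := {x | x ∈ G ∧ IsObj x ∧ ∃ c ∈ C, EqRel x c}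
  let H : M → M → Prop := fun x y => S x y ∨ (x = y ∧ x ∈ T)
  have hST : ∀ {x y z}, S x y → z ∈ T → (EqRel x z ↔ EqRel y z) := by
    rintro x y z h ⟨-, -, c, hc, hzc⟩
    rw [eqRel_congr_right hM hzc, eqRel_congr_right hM hzc]
    exact hS.rel_iff h (hC c hc)
  have hSTeq : ∀ {x y z}, S x y → z ∈ T → (x = z ↔ y = z) := by
    rintro x y z h ⟨hz, -, -⟩
    constructor
    · rintro rfl
      exact ((hS.eq_iff h (hC x (h1 x hz (.inl ⟨_, h⟩)))).1 rfl)
    · rintro rfl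
      exact ((hS.eq_iff h (hC y (h1 y hz (.inr ⟨_, h⟩)))).2 rfl)
  have hH : IsPartIso H := by
    constructor
    · rintro x x' y y' (h | ⟨rfl, h⟩) (h' | ⟨rfl, h'⟩)
      · exact hS.eq_iff h h'
      · exact hSTeq h h'
      · rw [eq_comm, hSTeq h' h, eq_comm]
      · rfl
    · rintro x x' (h | ⟨rfl, h⟩)
      · exact hS.obj_iff h
      · rfl
    · rintro x x' y y' (h | ⟨rfl, h⟩) (h' | ⟨rfl, h'⟩)
      · exact hS.rel_iff h h'
      · exact hST h h'
      · rw [eqRel_comm hM, hST h' h, eqRel_comm hM]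
      · rfl
    · rintro x x' y y' (h | ⟨rfl, h⟩) (h' | ⟨rfl, h'⟩)
      · exact .inl (hS.eval h h')
      · by_cases ox : IsObj x
        · rw [evalAt_of_not_fn hM ox, evalAt_of_not_fn hM ((hS.obj_iff h).1 ox)]
          exact .inr ⟨rfl, h'⟩
        · obtain ⟨-, -, c, hc, hyc⟩ := h'
          rw [evalAt_congr hM ox hyc, evalAt_congr hM (fun k => ox ((hS.obj_iff h).2 k)) hyc]
          exact .inl (hS.eval h (hC c hc))
      · rw [evalAt_of_not_fn hM h.2.1, evalAt_of_not_fn hM h.2.1]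
        exact .inl h'
      · rw [evalAt_of_not_fn hM h.2.1]
        exact .inr ⟨rfl, h'⟩
  have hfn : ∀ x ∈ G, ¬ IsObj x → (x ∈ relDom H ∨ x ∈ relRan H) → x ∈ C := by
    rintro x hx ox (⟨y, h | ⟨-, h⟩⟩ | ⟨y, h | ⟨rfl, h⟩⟩)
    · exact h1 x hx (.inl ⟨_, h⟩)
    · exact absurd h.2.1 ox
    · exact h1 x hx (.inr ⟨_, h⟩)
    · exact absurd h.2.1 ox
  have hcl : ∀ x ∈ G, ∀ y, (y ∈ relDom H ∨ y ∈ relRan H) → EqRel x y → ∃ c ∈ C, EqRel x c := by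
    rintro x hx y (⟨z, h | ⟨-, -, -, c, hc, h⟩⟩ | ⟨z, h | ⟨rfl, -, -, c, hc, h⟩⟩) hxy
    · exact h2 x hx y (.inl ⟨_, h⟩) hxy
    · exact ⟨c, hc, hM.trans _ _ _ hxy h⟩
    · exact h2 x hx y (.inr ⟨_, h⟩) hxy
    · exact ⟨c, hc, hM.trans _ _ _ hxy h⟩
  -- Two copies of `M` are glued along `H`. In classes private to one copy, private functions of the
  -- other select what they select in `M`.
  obtain ⟨W, _, ι, τ, hW, hι, hτ, eq1, rel1, ruleα, ruleβ⟩ :=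
    exists_amalgam hM hM hH (fun f y => evalAt f y) (fun f y => evalAt f y)
      (fun f y _ hy => evalAt_eqRel hM hy) (fun f y y' hf h => evalAt_congr hM hf h)
      (fun f y _ hy => evalAt_eqRel hM hy) (fun f y y' hf h => evalAt_congr hM hf h)
  have hCτ : ∀ c ∈ C, τ c = ι c := fun c hc => (eq1 c c).2 (.inl (hC c hc))
  have hTτ : ∀ c ∈ T, τ c = ι c := fun c hc => (eq1 c c).2 (.inr ⟨rfl, hc⟩)
  -- The elements on the side of `d`, away from `C`. They are read in the copy `τ` and the rest of
  -- `G` in the copy `ι`; this mixed map shows that `τ ∘ d` keeps the type of `d` over `e`.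
  let Z : Set M := {x | (¬ IsObj x ∧ x ∈ closed d ∧ x ∉ C) ∨
    (IsObj x ∧ (∃ y ∈ closed d, EqRel x y) ∧ ∀ c ∈ C, ¬ EqRel x c)}
  have hZobj : ∀ {x y}, EqRel x y → x ∈ Z → y ∈ Z := by
    rintro x y h (⟨h1, -⟩ | ⟨-, ⟨w, hw, hxw⟩, h2⟩)
    · exact absurd (hM.rel_obj _ _ h).1 h1
    · exact .inr ⟨(hM.rel_obj _ _ h).2, ⟨w, hw, hM.trans _ _ _ (hM.symm _ _ h) hxw⟩,
        fun c hc hyc => h2 c hc (hM.trans _ _ _ h hyc)⟩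
  let R : M → W → Prop := fun x w => x ∈ G ∧ ((x ∈ Z ∧ w = τ x) ∨ (x ∉ Z ∧ w = ι x))
  have hZne : ∀ {x y}, x ∈ G → x ∈ Z → y ∈ G → y ∉ Z → τ x ≠ ι y := by
    intro x y hx hxZ hy hyZ h
    rcases (eq1 x y).1 h with h | ⟨rfl, -⟩
    · have hxC := h1 x hx (.inl ⟨_, h⟩)
      exact hyZ ((hS.eq_iff h (hC x hxC)).1 rfl ▸ hxZ)
    · exact hyZ hxZ
  have hZrel : ∀ {x y}, x ∈ G → x ∈ Z → ¬ EqRel (τ x) (ι y) := by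
    intro x y hx hxZ h
    obtain ⟨p', n', hp, hxp, -⟩ := (rel1 x y).1 h
    obtain ⟨c, hc, hxc⟩ := hcl x hx p' (.inl ⟨_, hp⟩) hxp
    rcases hxZ with ⟨ho, -⟩ | ⟨-, -, h⟩
    · exact ho (hM.rel_obj _ _ hxc).1
    · exact h c hc hxc
  have hR : IsPartIso R := by
    constructor
    · rintro x _ y _ ⟨hx, ⟨hxZ, rfl⟩ | ⟨hxZ, rfl⟩⟩ ⟨hy, ⟨hyZ, rfl⟩ | ⟨hyZ, rfl⟩⟩
      · exact hτ.inj.eq_iff.symm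
      · exact iff_of_false (fun h => hyZ (h ▸ hxZ)) (hZne hx hxZ hy hyZ)
      · exact iff_of_false (fun h => hxZ (h ▸ hyZ)) (hZne hy hyZ hx hxZ).symm
      · exact hι.inj.eq_iff.symm
    · rintro x _ ⟨hx, ⟨hxZ, rfl⟩ | ⟨hxZ, rfl⟩⟩
      · exact (hτ.obj_iff x).symm
      · exact (hι.obj_iff x).symm
    · rintro x _ y _ ⟨hx, ⟨hxZ, rfl⟩ | ⟨hxZ, rfl⟩⟩ ⟨hy, ⟨hyZ, rfl⟩ | ⟨hyZ, rfl⟩⟩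
      · exact (hτ.rel_iff x y).symm
      · exact iff_of_false (fun h => hyZ (hZobj h hxZ)) (hZrel hx hxZ)
      · exact iff_of_false (fun h => hxZ (hZobj (hM.symm _ _ h) hyZ))
          (fun h => hZrel hy hyZ (hW.symm _ _ h))
      · exact (hι.rel_iff x y).symm
    · rintro x x' y y' ⟨hx, hxx⟩ ⟨hy, hyy⟩
      have ox : IsObj x' ↔ IsObj x := by
        rcases hxx with ⟨-, rfl⟩ | ⟨-, rfl⟩
        exacts [hτ.obj_iff x, hι.obj_iff x]
      have oy : IsObj y' ↔ IsObj y := by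
        rcases hyy with ⟨-, rfl⟩ | ⟨-, rfl⟩
        exacts [hτ.obj_iff y, hι.obj_iff y]
      by_cases hxo : IsObj x
      · rw [evalAt_of_not_fn hM hxo, evalAt_of_not_fn hW (ox.2 hxo)]
        exact ⟨hy, hyy⟩
      by_cases hyo : ¬ IsObj y
      · rw [evalAt_of_not_obj hM hyo, evalAt_of_not_obj hW (oy.not.2 hyo)]
        exact ⟨hy, hyy⟩
      rw [not_not] at hyo
      have hE : EqRel (evalAt x y) y := evalAt_eqRel hM hyo
      refine ⟨hGc x hx y hy, ?_⟩
      rcases hxx with ⟨hxZ, rfl⟩ | ⟨hxZ, rfl⟩ <;> rcases hyy with ⟨hyZ, rfl⟩ | ⟨hyZ, rfl⟩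
      · exact .inl ⟨hZobj (hM.symm _ _ hE) hyZ, hτ.eval x y⟩
      · refine .inr ⟨fun h => hyZ (hZobj hE h), ?_⟩
        -- If the class meets `C`, argument and value lie in `T`, where the copies coincide;
        -- otherwise the prescribed rule copies the value from `M`.
        by_cases hyC : ∃ c ∈ C, EqRel y c
        · rw [← hTτ y ⟨hy, hyo, hyC⟩, hτ.eval]
          obtain ⟨c, hc, hyc⟩ := hyC
          exact hTτ _ ⟨hGc x hx y hy, (hM.rel_obj _ _ hE).1, c, hc, hM.trans _ _ _ hE hyc⟩
        · refine ruleα x y hxo (fun h => ?_) hyo fun y' hy' h => hyC (hcl y hy y' (.inr hy') h)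
          rcases hxZ with ⟨-, -, hxC⟩ | ⟨ho, -⟩
          · exact hxC (hfn x hx hxo (.inl h))
          · exact hxo ho
      · refine .inl ⟨hZobj (hM.symm _ _ hE) hyZ, ?_⟩
        by_cases hxC : x ∈ C
        · rw [← hCτ x hxC, hτ.eval]
        · refine ruleβ x y hxo (fun h => hxC (hfn x hx hxo (.inr h))) hyo fun y' hy' h => ?_
          obtain ⟨c, hc, hyc⟩ := hcl y hy y' (.inl hy') h
          rcases hyZ with ⟨ho, -⟩ | ⟨-, -, hn⟩
          · exact ho hyo
          · exact hn c hc hyc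
      · exact .inr ⟨fun h => hyZ (hZobj hE h), hι.eval x y⟩
  obtain ⟨N, _, hN, _, g, hg⟩ := exists_model hW
  have hgι : IsEmb (g ∘ ι) := by
    refine ⟨hg.inj.comp hι.inj, fun x => ?_, fun x y => ?_, fun x y => ?_⟩
    · exact (hg.obj_iff _).trans (hι.obj_iff _)
    · exact (hg.rel_iff _ _).trans (hι.rel_iff _ _)
    · exact (hg.eval _ _).trans (congrArg g (hι.eval _ _))
  refine ⟨N, inferInstance, hN, hgι.toElementary, g ∘ τ ∘ d, ?_, ?_⟩
  · refine ⟨_, hτ.isPartIso.comp hg.isPartIso, ?_⟩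
    rintro (i | i)
    · exact ⟨_, rfl, rfl⟩
    · refine ⟨_, rfl, ?_⟩
      change g (ι (b' i)) = g (τ (b i))
      rw [(eq1 _ _).2 (.inl (hb i))]
  · refine ⟨_, hR.comp hg.isPartIso, ?_⟩
    rintro (i | i)
    · refine ⟨τ (d i), ⟨hdG (mem_closed d i), ?_⟩, rfl⟩
      by_cases hi : d i ∈ Z
      · exact .inl ⟨hi, rfl⟩
      · refine .inr ⟨hi, ?_⟩
        have hdi := mem_closed d i
        by_cases ho : IsObj (d i)
        · refine hTτ _ ⟨hdG hdi, ho, ?_⟩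
          by_contra! hc
          exact hi (.inr ⟨ho, ⟨_, hdi, hM.refl _ ho⟩, hc⟩)
        · refine hCτ _ ?_
          by_contra hc
          exact hi (.inl ⟨ho, hdi, hc⟩)
    · refine ⟨ι (e i), ⟨heG (mem_closed e i), .inr ⟨?_, rfl⟩⟩, rfl⟩
      have hei := mem_closed e i
      rintro (⟨-, hd, hc⟩ | ⟨-, ⟨y, hy, hey⟩, hc⟩)
      · exact hc (h3 _ hd hei)
      · obtain ⟨c, hcC, hyc⟩ := h4 y hy _ hei (hM.symm _ _ hey)
        exact hc c hcC (hM.trans _ _ _ hey hyc)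

end SOP

/-! ### `NSOP₁` and `NSOP₃` -/

section SOP

/-- The first `i` pairs of tuples of a sequence of pairs of tuples, as a family of elements. -/
def prevFam {M K : Type*} (c₀ c₁ : ℕ → K → M) (i : ℕ) : Fin i × Bool × K → M :=
  fun p => bif p.2.1 then c₁ p.1 p.2.2 else c₀ p.1 p.2.2

/-- Terms of `d` enter the growing sets `C i`, or their classes, at finitely many moments, so some
block sees no such event. Inside it, `i` is chosen so that the terms of `d` and `c₀ j` together gain
nothing from `C i` to `C (i + 1)`. These are the hypotheses of `exists_amalgam_types` over `C i`. -/
theorem exists_common_solution (n m : ℕ) : ∃ N : ℕ, ∀ (M : Type u) [selLang.Structure M]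
    [M ⊨ selectorTheory] (c₀ c₁ : ℕ → Fin m → M) (d : Fin n → M),
    (∀ i < N, SameQF (Sum.elim (prevFam c₀ c₁ i) (c₀ i)) (Sum.elim (prevFam c₀ c₁ i) (c₁ i))) →
    ∃ i j, i < j ∧ j < N ∧ ∀ φ : selLang.Formula (Fin n ⊕ Fin m),
      φ.Realize (Sum.elim d (c₀ i)) → φ.Realize (Sum.elim d (c₀ j)) →
      ∃ x : Fin n → M, φ.Realize (Sum.elim x (c₁ i)) ∧ φ.Realize (Sum.elim x (c₀ j)) := by
  classical
  let Q₁ := Tm (Fin n) ⊕ Tm (Fin n)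
  let Q₂ := Tm (Fin n ⊕ Fin m) ⊕ Tm (Fin n ⊕ Fin m)
  -- A block holds `Fintype.card Q₂ + 1` candidates for `i`, followed by `j`.
  let L := Fintype.card Q₂ + 2
  refine ⟨(Fintype.card Q₁ + 1) * L, fun M _ _ c₀ c₁ d hc => ?_⟩
  have hM := isSelectorModel_of_model M
  let C : ℕ → Set M := fun i => closed (prevFam c₀ c₁ i)
  have hCc : ∀ i, ∀ x ∈ C i, ∀ y ∈ C i, evalAt x y ∈ C i :=
    fun i x hx y hy => evalAt_mem_closed hM hx hy
  have hCmono : Monotone C := by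
    intro i j hij
    refine closed_subset (hCc j) ?_
    rintro ⟨k, s, a⟩
    exact mem_closed (prevFam c₀ c₁ j) (⟨k.1, k.2.trans_le hij⟩, s, a)
  have hC₀ : ∀ {i j} (a : Fin m), i < j → c₀ i a ∈ C j :=
    fun {i j} a h => mem_closed (prevFam c₀ c₁ j) (⟨i, h⟩, false, a)
  have hC₁ : ∀ {i j} (a : Fin m), i < j → c₁ i a ∈ C j :=
    fun {i j} a h => mem_closed (prevFam c₀ c₁ j) (⟨i, h⟩, true, a)
  -- the increasing conditions attached to the terms of a family
  let p : ∀ {J : Type}, (J → M) → (Tm J ⊕ Tm J) → ℕ → Prop := fun v t i =>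
    Sum.elim (fun t => tval v t ∈ C i) (fun t => ∃ c ∈ C i, EqRel (tval v t) c) t
  have hp : ∀ {J : Type} (v : J → M) t, Monotone (p v t) := by
    rintro J v (t | t) i j hij
    · exact fun h => hCmono hij h
    · rintro ⟨c, h, h'⟩
      exact ⟨c, hCmono hij h, h'⟩
  obtain ⟨b, hb, hbd⟩ := exists_stable_block (p d) (hp d) L
  -- The last index of the block, so `C (j + 1)`, which contains the closure of `c₀ j`, is the set
  -- at the start of the next block.
  let j := b * L + (Fintype.card Q₂ + 1)
  obtain ⟨s, hs, hsd⟩ := exists_stable_block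
    (fun t s => p (Sum.elim d (c₀ j)) t (b * L + s))
    (fun t s s' h => hp _ t (Nat.add_le_add_left h _)) 1
  simp only [mul_one] at hsd
  change s ≤ Fintype.card Q₂ at hs
  change b ≤ Fintype.card Q₁ at hb
  let i := b * L + s
  have hij : i < j := by simp only [i, j]; omega
  have hjL : j + 1 = (b + 1) * L := by simp only [j, L]; ring
  have hjN : j < (Fintype.card Q₁ + 1) * L := by
    have : (b + 1) * L ≤ (Fintype.card Q₁ + 1) * L := Nat.mul_le_mul_right L (by omega)
    omega
  have hS := (hc i (hij.trans hjN)).isPartIso hM hM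
  set S := genRel (Sum.elim (prevFam c₀ c₁ i) (c₀ i)) (Sum.elim (prevFam c₀ c₁ i) (c₁ i)) with hSdef
  have hdom : ∀ x, x ∈ relDom S ∨ x ∈ relRan S → x ∈ C (i + 1) := by
    rintro _ (⟨_, t, rfl, -⟩ | ⟨_, t, -, rfl⟩)
    · refine closed_subset (hCc (i + 1)) ?_ ⟨t, rfl⟩
      rintro (k | a)
      · exact hCmono (Nat.le_succ i) (mem_closed _ k)
      · exact hC₀ a (Nat.lt_succ_self i)
    · refine closed_subset (hCc (i + 1)) ?_ ⟨t, rfl⟩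
      rintro (k | a)
      · exact hCmono (Nat.le_succ i) (mem_closed _ k)
      · exact hC₁ a (Nat.lt_succ_self i)
  have hbi : C (b * L) ⊆ C i := hCmono (Nat.le_add_right _ _)
  have hej : closed (c₀ j) ⊆ C (j + 1) := closed_subset (hCc _) fun a => hC₀ a (Nat.lt_succ_self j)
  refine ⟨i, j, hij, hjN, fun φ h1 h2 => ?_⟩
  have a1 : ∀ c ∈ C i, S c c := by
    rintro _ ⟨t, rfl⟩
    exact hS.tval (fun k => genRel_base (Sum.elim (prevFam c₀ c₁ i) (c₀ i))
      (Sum.elim (prevFam c₀ c₁ i) (c₁ i)) (.inl k)) t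
  have a2 : ∀ x ∈ closed (Sum.elim d (c₀ j)), x ∈ relDom S ∨ x ∈ relRan S → x ∈ C i := by
    rintro _ ⟨t, rfl⟩ h
    exact hsd (.inl t) (hdom _ h)
  have a3 : ∀ x ∈ closed (Sum.elim d (c₀ j)), ∀ y, y ∈ relDom S ∨ y ∈ relRan S → EqRel x y →
      ∃ c ∈ C i, EqRel x c := by
    rintro _ ⟨t, rfl⟩ y h hy
    exact hsd (.inr t) ⟨y, hdom _ h, hy⟩
  have a4 : ∀ x ∈ closed d, x ∈ closed (c₀ j) → x ∈ C i := by
    rintro _ ⟨t, rfl⟩ h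
    refine hbi (hbd (.inl t) ?_)
    rw [← hjL]
    exact hej h
  have a5 : ∀ x ∈ closed d, ∀ y ∈ closed (c₀ j), EqRel x y → ∃ c ∈ C i, EqRel x c := by
    rintro _ ⟨t, rfl⟩ y h hy
    have : p d (.inr t) ((b + 1) * L) := by
      rw [← hjL]
      exact ⟨y, hej h, hy⟩
    obtain ⟨c, hcC, hyc⟩ := hbd (.inr t) this
    exact ⟨c, hbi hcC, hyc⟩
  obtain ⟨N, _, _, f, d', k1, k2⟩ := exists_amalgam_types hS a1
    (fun a => genRel_base (Sum.elim (prevFam c₀ c₁ i) (c₀ i))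
      (Sum.elim (prevFam c₀ c₁ i) (c₁ i)) (.inr a)) a2 a3 a4 a5
  obtain ⟨x, hx⟩ := exists_realize_of_elementary f (ι := Bool) φ
    (fun s => bif s then c₁ i else c₀ j) ⟨d', by
      rintro (s | s)
      · exact (k2.realize_iff φ).1 h2
      · exact (k1.realize_iff φ).1 h1⟩
  exact ⟨x, hx true, hx false⟩

/-- A bound for the number of types of `m`-tuples over `c` elements. -/
noncomputable def typeBound (m c : ℕ) : ℕ := Nat.card (Set (Atom (Fin c ⊕ Fin m)))

theorem exists_sameQF_of_typeBound {M : Type*} [selLang.Structure M] (hM : IsSelectorModel M)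
    {m c : ℕ} (w : Fin c → M) (x : ℕ → Fin m → M) :
    ∃ k l, k < l ∧ l ≤ typeBound m c ∧ SameQF (Sum.elim w (x k)) (Sum.elim w (x l)) := by
  classical
  let code : Fin (typeBound m c + 1) → Set (Atom (Fin c ⊕ Fin m)) :=
    fun k => {a | atomHolds (Sum.elim w (x k)) a}
  obtain ⟨k, l, hkl, h⟩ := Fintype.exists_ne_map_eq_of_card_lt code (by
    rw [Fintype.card_fin, typeBound, Nat.card_eq_fintype_card]; exact Nat.lt_succ_self _)
  have hs : ∀ k l, code k = code l → SameQF (Sum.elim w (x k)) (Sum.elim w (x l)) :=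
    fun k l h => (sameQF_iff hM hM).2 fun a => Set.ext_iff.1 h a
  rcases lt_or_gt_of_ne hkl with hlt | hlt
  · exact ⟨k, l, hlt, Nat.lt_succ_iff.1 l.2, hs k l h⟩
  · exact ⟨l, k, hlt, Nat.lt_succ_iff.1 k.2, hs l k h.symm⟩

/-- Sequences of pairs of nodes are found in any tree whose nodes have enough successors. -/
theorem exists_node_sequence {M : Type*} [selLang.Structure M] {T : Type*} {m : ℕ}
    (a : T → Fin m → M) (Below Sep : T → T → Prop) (V : ℕ → ℕ → T → Prop)
    (htrans : ∀ x y z, Below x y → Below y z → Below x z)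
    (hstep : ∀ N c η, V (N + 1) c η → ∀ w : Fin c → M, ∃ σ ρ, Below η σ ∧
      V N (c + (m + m)) σ ∧ SameQF (Sum.elim w (a σ)) (Sum.elim w (a ρ)) ∧ Sep ρ σ ∧
      ∀ σ', Below σ σ' → Sep ρ σ')
    (N : ℕ) : ∀ c η, V N c η → ∀ w : Fin c → M, ∃ σ ρ : ℕ → T,
      (∀ i < N, SameQF (Sum.elim (Sum.elim w (prevFam (a ∘ σ) (a ∘ ρ) i)) (a (σ i)))
        (Sum.elim (Sum.elim w (prevFam (a ∘ σ) (a ∘ ρ) i)) (a (ρ i)))) ∧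
      (∀ i < N, Below η (σ i)) ∧ (∀ i j, i < j → j < N → Below (σ i) (σ j)) ∧
      ∀ i j, i ≤ j → j < N → Sep (ρ i) (σ j) := by
  -- `V N c η` is to be read as: beyond `η` there is room for `N` more pairs when `c` parameters are
  -- in use.
  induction N with
  | zero => exact fun c η _ w => ⟨fun _ => η, fun _ => η, by simp⟩
  | succ N ih =>
    intro c η hV w
    obtain ⟨σ₀, ρ₀, h1, h2, h3, h4, h5⟩ := hstep N c η hV w
    -- Both members of the first pair become parameters for all later ones.
    let w' : Fin (c + (m + m)) → M := Fin.append w (Fin.append (a σ₀) (a ρ₀))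
    obtain ⟨σ, ρ, k1, k2, k3, k4⟩ := ih _ σ₀ h2 w'
    refine ⟨fun i => i.casesOn σ₀ σ, fun i => i.casesOn ρ₀ ρ, ?_, ?_, ?_, ?_⟩
    · rintro (_ | i) hi
      · obtain ⟨R, hR, hv⟩ := h3
        refine ⟨R, hR, ?_⟩
        rintro ((i | ⟨k, -⟩) | i)
        · exact hv (.inl i)
        · exact k.elim0
        · exact hv (.inr i)
      · obtain ⟨R, hR, hv⟩ := k1 i (Nat.lt_of_succ_lt_succ hi)
        refine ⟨R, hR, ?_⟩
        rintro ((i | ⟨⟨_ | k, hk⟩, s, b⟩) | i)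
        · simpa [w'] using hv (.inl (.inl (Fin.castAdd _ i)))
        · cases s
          · simpa [w', prevFam] using hv (.inl (.inl (Fin.natAdd _ (Fin.castAdd _ b))))
          · have h := hv (.inl (.inl (Fin.natAdd _ (Fin.natAdd _ b))))
            simp only [w', Sum.elim_inl, Fin.append_right] at h
            exact h
        · exact hv (.inl (.inr (⟨k, Nat.lt_of_succ_lt_succ hk⟩, s, b)))
        · exact hv (.inr i)
    · rintro (_ | i) hi
      · exact h1
      · exact htrans _ _ _ h1 (k2 i (Nat.lt_of_succ_lt_succ hi))
    · rintro (_ | i) (_ | j) hij hj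
      · exact absurd hij (lt_irrefl _)
      · exact k2 j (Nat.lt_of_succ_lt_succ hj)
      · exact absurd hij (Nat.not_lt_zero _)
      · exact k3 i j (Nat.lt_of_succ_lt_succ hij) (Nat.lt_of_succ_lt_succ hj)
    · rintro (_ | i) (_ | j) hij hj
      · exact h4
      · exact h5 _ (k2 j (Nat.lt_of_succ_lt_succ hj))
      · exact absurd hij (Nat.not_succ_le_zero _)
      · exact k4 i j (Nat.le_of_succ_le_succ hij) (Nat.lt_of_succ_lt_succ hj)

/-- A tree of parameters whose branches are consistent, and which has enough types, contains
consistent pairs of separated nodes. -/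
theorem no_separated_tree {M : Type u} [selLang.Structure M] [M ⊨ selectorTheory] {T : Type*}
    {n m : ℕ} (φ : selLang.Formula (Fin n ⊕ Fin m))
    (a : T → Fin m → M) (Below Sep : T → T → Prop) (V : ℕ → ℕ → T → Prop)
    (htrans : ∀ x y z, Below x y → Below y z → Below x z)
    (hstep : ∀ N c η, V (N + 1) c η → ∀ w : Fin c → M, ∃ σ ρ, Below η σ ∧
      V N (c + (m + m)) σ ∧ SameQF (Sum.elim w (a σ)) (Sum.elim w (a ρ)) ∧ Sep ρ σ ∧
      ∀ σ', Below σ σ' → Sep ρ σ')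
    (hV : ∀ N, ∃ η, V N 0 η)
    (hpath : ∀ (N : ℕ) (η : T) (σ : ℕ → T), (∀ i < N, Below η (σ i)) →
      (∀ i j, i < j → j < N → Below (σ i) (σ j)) →
      ∃ x : Fin n → M, ∀ i < N, φ.Realize (Sum.elim x (a (σ i))))
    (hsep : ∀ ρ σ, Sep ρ σ → ¬ ∃ x : Fin n → M, φ.Realize (Sum.elim x (a σ)) ∧
      φ.Realize (Sum.elim x (a ρ))) : False := by
  obtain ⟨N, hN⟩ := exists_common_solution.{u} n m
  obtain ⟨η, hη⟩ := hV N
  obtain ⟨σ, ρ, k1, k2, k3, k4⟩ :=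
    exists_node_sequence a Below Sep V htrans hstep N 0 η hη Fin.elim0
  obtain ⟨d, hd⟩ := hpath N η σ k2 k3
  obtain ⟨i, j, hij, hj, h⟩ := hN M (a ∘ σ) (a ∘ ρ) d fun i hi =>
    (k1 i hi).comp (Sum.map Sum.inr id)
      |> fun h => by
        refine Eq.mp (congrArg₂ SameQF ?_ ?_) h <;>
          (funext x; rcases x with x | x <;> rfl)
  -- The solution along the branch is turned into a common solution at `ρ i` and `σ j`, which are
  -- separated.
  obtain ⟨x, hx1, hx2⟩ := h φ (hd i (hij.trans hj)) (hd j hj)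
  exact hsep _ _ (k4 i j hij.le hj) ⟨x, hx2, hx1⟩

/-- Among the nodes `η0ᵏ1`, two have the same type over the given parameters. The one with more
zeros lies above `η0ᵏ0` for the smaller `k`, so it and everything above it is inconsistent with the
other. -/
theorem nsop₁ : ForkDiv.NSOP₁.{u} selectorTheory := by
  intro M _ _ _ n m φ
  rintro ⟨a, hcons, hinc⟩
  have hM := isSelectorModel_of_model M
  refine no_separated_tree φ a (fun η σ => η <+: σ)
    (fun ρ σ => ∃ κ, ρ = κ ++ [true] ∧ (κ ++ [false]) <+: σ) (fun _ _ _ => True)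
    (fun _ _ _ => List.IsPrefix.trans) ?_ (fun _ => ⟨[], trivial⟩) ?_ ?_
  · intro N c η _ w
    obtain ⟨k, l, hkl, -, h⟩ := exists_sameQF_of_typeBound hM w
      fun k => a (η ++ List.replicate k false ++ [true])
    have hsep : (η ++ List.replicate k false ++ [false]) <+:
        η ++ List.replicate l false ++ [true] := by
      obtain ⟨r, rfl⟩ := Nat.exists_eq_add_of_lt hkl
      refine ⟨List.replicate r false ++ [true], ?_⟩
      rw [show k + r + 1 = k + 1 + r by ring, List.replicate_add, List.replicate_succ']
      simp
    refine ⟨η ++ List.replicate l false ++ [true], η ++ List.replicate k false ++ [true],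
      ⟨List.replicate l false ++ [true], by simp⟩, trivial, h.symm, ⟨_, rfl, hsep⟩,
      fun σ' hσ => ⟨_, rfl, hsep.trans hσ⟩⟩
  · intro N η σ _ hσ
    -- The branch through the last node, continued by `false`, passes through all the nodes.
    obtain ⟨x, hx⟩ := hcons (fun t => (σ (N - 1)).getD t false)
      ((Finset.range N).image fun i => (σ i).length)
    refine ⟨x, fun i hi => ?_⟩
    have h := hx (σ i).length (Finset.mem_image_of_mem _ (Finset.mem_range.2 hi))
    have hpre : σ i <+: σ (N - 1) := by
      rcases Nat.lt_or_ge i (N - 1) with hlt | hge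
      · exact hσ i _ hlt (by omega)
      · rw [show i = N - 1 by omega]
    have : (List.range (σ i).length).map (fun t => (σ (N - 1)).getD t false) = σ i := by
      obtain ⟨r, hr⟩ := hpre
      rw [← hr]
      refine List.ext_getElem (by simp) fun t h1 h2 => ?_
      simp [List.getD_eq_getElem?_getD, List.getElem?_append, h2]
    rwa [this] at h
  · rintro _ σ ⟨κ, rfl, hκ⟩
    exact hinc κ σ hκ

/-- The length of an interval which has enough disjoint subintervals. -/
noncomputable def intervalLength (m : ℕ) : ℕ → ℕ → ℕ
  | 0, _ => 2
  | N + 1, c => (typeBound m c + 1) * (intervalLength m N (c + (m + m)) + 1)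

theorem two_le_intervalLength (m N c : ℕ) : 2 ≤ intervalLength m N c := by
  induction N generalizing c with
  | zero => exact le_rfl
  | succ N ih =>
    have := ih (c + (m + m))
    rw [intervalLength]
    nlinarith [Nat.zero_le (typeBound m c)]

/-- The nodes are intervals of the chain, and `ψ` says that `x` lies between the two ends. Nested
intervals have a common solution inside the innermost one. A common solution for two disjoint
intervals would form a directed triangle with the right end of the left interval and the left end of
the right one. -/
theorem nsop₃ : ForkDiv.NSOP₃.{u} selectorTheory := by
  intro M _ _ _ n φ
  rintro ⟨⟨s, hs⟩, hcyc⟩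
  have hM := isSelectorModel_of_model M
  let ψ : selLang.Formula (Fin n ⊕ Fin (n + n)) :=
    φ.relabel (Sum.elim (Sum.inr ∘ Fin.castAdd n) Sum.inl) ⊓
      φ.relabel (Sum.elim Sum.inl (Sum.inr ∘ Fin.natAdd n))
  let a : ℕ × ℕ → Fin (n + n) → M := fun p => Fin.append (s p.1) (s p.2)
  have hψ : ∀ x p, ψ.Realize (Sum.elim x (a p)) ↔
      φ.Realize (Sum.elim (s p.1) x) ∧ φ.Realize (Sum.elim x (s p.2)) := by
    intro x p
    rw [Formula.realize_inf, Formula.realize_relabel, Formula.realize_relabel]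
    refine and_congr (iff_of_eq (congrArg _ ?_)) (iff_of_eq (congrArg _ ?_)) <;>
      (funext i; rcases i with i | i <;> simp [a, -Fin.natAdd_eq_addNat])
  refine no_separated_tree ψ a
    (fun η σ => η.1 ≤ σ.1 ∧ σ.2 ≤ η.2 ∧ σ.1 + 2 ≤ σ.2) (fun ρ σ => σ.2 < ρ.1)
    (fun N c η => η.1 + intervalLength (n + n) N c ≤ η.2) ?_ ?_
    (fun N => ⟨(0, intervalLength (n + n) N 0), by simp⟩) ?_ ?_
  · rintro x y z ⟨h1, h2, h3⟩ ⟨h4, h5, h6⟩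
    exact ⟨h1.trans h4, h5.trans h2, h6⟩
  · rintro N c ⟨p, q⟩ hη w
    set L := intervalLength (n + n) N (c + (n + n + (n + n))) with hL
    have hL2 : 2 ≤ L := two_le_intervalLength _ _ _
    -- Consecutive intervals of length `L` start `L + 1` apart, so each ends strictly before the
    -- next begins.
    obtain ⟨k, l, hkl, hl, h⟩ := exists_sameQF_of_typeBound hM w
      fun k => a (p + k * (L + 1), p + k * (L + 1) + L)
    change p + (typeBound (n + n) c + 1) * (L + 1) ≤ q at hη
    have e1 : (k + 1) * (L + 1) ≤ l * (L + 1) := Nat.mul_le_mul_right _ hkl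
    have e2 : (l + 1) * (L + 1) ≤ (typeBound (n + n) c + 1) * (L + 1) :=
      Nat.mul_le_mul_right _ (by omega)
    rw [add_mul, one_mul] at e1 e2
    refine ⟨(p + k * (L + 1), p + k * (L + 1) + L), (p + l * (L + 1), p + l * (L + 1) + L),
      ⟨?_, ?_, ?_⟩, ?_, h, ?_, ?_⟩
    · simp
    · simp only; omega
    · simp only; omega
    · simp only; omega
    · simp only; omega
    · rintro σ' ⟨-, h2, -⟩
      simp only at h2 ⊢
      omega
  · intro N η σ h1 h2
    -- A point strictly inside the innermost interval, whose length is at least two.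
    refine ⟨s ((σ (N - 1)).1 + 1), fun i hi => ?_⟩
    have h3 := h1 (N - 1) (by omega)
    have hle : (σ i).1 ≤ (σ (N - 1)).1 ∧ (σ (N - 1)).2 ≤ (σ i).2 := by
      rcases Nat.lt_or_ge i (N - 1) with hlt | hge
      · have := h2 i _ hlt (by omega)
        exact ⟨this.1, this.2.1⟩
      · rw [show i = N - 1 by omega]
        exact ⟨le_rfl, le_rfl⟩
    rw [hψ]
    exact ⟨hs _ _ (by omega), hs _ _ (by omega)⟩
  · rintro ρ σ h ⟨x, hx1, hx2⟩
    rw [hψ] at hx1 hx2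
    exact hcyc ⟨x, s σ.2, s ρ.1, hx1.2, hs _ _ h, hx2.1⟩

end SOP

/-! ### Formulas with parameters and representatives of classes -/

section Constants

theorem model_of_elementary {M N : Type*} [selLang.Structure M] [selLang.Structure N]
    (e : M ↪ₑ[selLang] N) [M ⊨ selectorTheory] : N ⊨ selectorTheory :=
  e.elementarilyEquivalent.theory_model

theorem isEmb_elementary {M N : Type*} [selLang.Structure M] [selLang.Structure N]
    (e : M ↪ₑ[selLang] N) : IsEmb e :=
  isEmb_embedding e.toEmbedding

theorem IsEmb.comp {M N P : Type*} [selLang.Structure M] [selLang.Structure N]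
    [selLang.Structure P] {g : N → P} {f : M → N} (hg : IsEmb g) (hf : IsEmb f) :
    IsEmb (g ∘ f) :=
  ⟨hg.inj.comp hf.inj, fun _ => (hg.obj_iff _).trans (hf.obj_iff _),
    fun _ _ => (hg.rel_iff _ _).trans (hf.rel_iff _ _),
    fun _ _ => (hg.eval _ _).trans (congrArg g (hf.eval _ _))⟩

theorem realize_iff_of_constants {A : Type*} {M N : Type*} [selLang.Structure M]
    [selLang.Structure N] [(selLang[[A]]).Structure M] [(selLang[[A]]).Structure N]
    [(selLang.lhomWithConstants A).IsExpansionOn M] [(selLang.lhomWithConstants A).IsExpansionOn N]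
    [M ⊨ selectorTheory] [N ⊨ selectorTheory] {α : Type*} {v : α → M} {w : α → N}
    (h : SameQF (Sum.elim (fun a : A => ((selLang.con a : (selLang[[A]]).Constants) : M)) v)
      (Sum.elim (fun a : A => ((selLang.con a : (selLang[[A]]).Constants) : N)) w))
    (φ : (selLang[[A]]).Formula α) : φ.Realize v ↔ φ.Realize w := by
  rw [Formula.Realize, Formula.Realize, ← BoundedFormula.realize_constantsVarsEquiv,
    ← BoundedFormula.realize_constantsVarsEquiv]
  exact h.realize_iff (BoundedFormula.constantsVarsEquiv φ)

theorem realize_iff_of_params {M : Type*} [selLang.Structure M] [M ⊨ selectorTheory] {A : Set M}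
    {α : Type*} {v w : α → M}
    (h : SameQF (Sum.elim (fun a : A => (a : M)) v) (Sum.elim (fun a : A => (a : M)) w))
    (φ : (selLang[[A]]).Formula α) : φ.Realize v ↔ φ.Realize w :=
  realize_iff_of_constants (by simpa only [coe_con] using h) φ

/-- The choice is made from the class as a set, so equivalent elements receive the same
representative. -/
theorem exists_rep {M : Type*} [selLang.Structure M] (hM : IsSelectorModel M) :
    ∃ rep : M → M, (∀ x, IsObj x → EqRel (rep x) x) ∧ ∀ x y, EqRel x y → rep x = rep y := by
  classical
  let pick : Set M → M → M := fun S x => if h : S.Nonempty then h.some else x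
  refine ⟨fun x => pick {y | EqRel y x} x, fun x hx => ?_, fun x y hxy => ?_⟩
  · have h : {y | EqRel y x}.Nonempty := ⟨x, hM.refl _ hx⟩
    have h1 : pick {y | EqRel y x} x = h.some := dif_pos h
    change EqRel (pick {y | EqRel y x} x) x
    rw [h1]
    exact h.some_mem
  · have h : {z | EqRel z y}.Nonempty := ⟨x, hxy⟩
    have hS : {z | EqRel z x} = {z | EqRel z y} := Set.ext fun z => eqRel_congr_right hM hxy
    change pick {z | EqRel z x} x = pick {z | EqRel z y} y
    rw [hS]
    exact (dif_pos h).trans (dif_pos h).symm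

end Constants

/-! ### Indiscernible sequences -/

section Indiscernible

variable {M : Type u} [selLang.Structure M]

theorem isIndiscernible_of_sameQF [M ⊨ selectorTheory] {A : Set M} {k : ℕ} {s : ℕ → Fin k → M}
    (h : ∀ (r : ℕ) (i j : Fin r → ℕ), StrictMono i → StrictMono j →
      SameQF (Sum.elim (fun a : A => (a : M)) fun p : Fin r × Fin k => s (i p.1) p.2)
        (Sum.elim (fun a : A => (a : M)) fun p : Fin r × Fin k => s (j p.1) p.2)) :
    ForkDiv.IsIndiscernible (L := selLang) A s :=
  fun r ψ i j hi hj => realize_iff_of_params (h r i j hi hj) ψ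

theorem _root_.ForkDiv.IsIndiscernible.realize_iff {A : Set M} {k : ℕ} {s : ℕ → Fin k → M}
    (h : ForkDiv.IsIndiscernible (L := selLang) A s) {r : ℕ}
    (ψ : selLang.Formula (Fin r × Fin k)) {i j : Fin r → ℕ} (hi : StrictMono i)
    (hj : StrictMono j) :
    ψ.Realize (fun p => s (i p.1) p.2) ↔ ψ.Realize (fun p => s (j p.1) p.2) := by
  have := h r ((selLang.lhomWithConstants A).onFormula ψ) i j hi hj
  rwa [LHom.realize_onFormula, LHom.realize_onFormula] at this

theorem _root_.ForkDiv.IsIndiscernible.isObj_iff {A : Set M} {k : ℕ} {s : ℕ → Fin k → M}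
    (h : ForkDiv.IsIndiscernible (L := selLang) A s) (a : Fin k) (i j : ℕ) :
    IsObj (s i a) ↔ IsObj (s j a) := by
  have := h.realize_iff (r := 1) (atomFormula (.inl (0, a))) (i := fun _ => i) (j := fun _ => j)
    (Subsingleton.strictMono _) (Subsingleton.strictMono _)
  rwa [realize_atomFormula, realize_atomFormula] at this

theorem _root_.ForkDiv.IsIndiscernible.eqRel_iff {A : Set M} {k : ℕ} {s : ℕ → Fin k → M}
    (h : ForkDiv.IsIndiscernible (L := selLang) A s) (a : Fin k) {i j i' j' : ℕ} (hi : i < j)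
    (hj : i' < j') : EqRel (s i a) (s j a) ↔ EqRel (s i' a) (s j' a) := by
  have hm : ∀ {i j : ℕ}, i < j → StrictMono ![i, j] := fun {i j} h =>
    Fin.strictMono_iff_lt_succ.2 fun x => by fin_cases x; exact h
  have := h.realize_iff (r := 2) (atomFormula (.inr (.inl ((0, a), (1, a))))) (hm hi) (hm hj)
  rwa [realize_atomFormula, realize_atomFormula] at this

end Indiscernible

/-! ### A grid of new objects -/

section Grid

/-- Infinitely many infinite classes of new objects, in each of which all the old functions select
the same object. -/
theorem exists_grid (M : Type u) [selLang.Structure M] [M ⊨ selectorTheory] :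
    ∃ (N : Type u) (_ : selLang.Structure N) (_ : N ⊨ selectorTheory) (e : M ↪ₑ[selLang] N)
      (t : ℕ × ℕ → N), Function.Injective t ∧ (∀ p, IsObj (t p)) ∧
      (∀ p q, EqRel (t p) (t q) ↔ p.1 = q.1) ∧ (∀ p m, ¬ EqRel (t p) (e m)) ∧
      (∀ p m, t p ≠ e m) ∧ ∀ f p, ¬ IsObj f → evalAt (e f) (t p) = t (p.1, 0) := by
  have hM := isSelectorModel_of_model M
  let _ : selLang.Structure (ℕ × ℕ) := mkStructure (fun _ => True) (fun p q => p.1 = q.1)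
    fun _ y => y
  have hP : IsSelectorModel (ℕ × ℕ) := by
    apply mkStructure_isSelectorModel
    · simp
    · simp
    · exact fun _ _ h => h.symm
    · exact fun _ _ _ h h' => h.trans h'
    · exact fun _ _ h => absurd trivial h
    · exact fun _ _ _ h => absurd trivial h
    · simp
  obtain ⟨W, _, ι, τ, hW, hι, hτ, eq1, rel1, -, hβ⟩ :=
    exists_amalgam hM hP (isPartIso_false (M := ℕ × ℕ) (N := M)) (fun _ y => y)
      (fun _ p => (p.1, 0)) (fun _ _ _ h => hM.refl _ h) (fun f _ _ h => absurd trivial h)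
      (fun _ _ _ _ => rfl) (fun _ p p' _ h => Prod.ext (show p.1 = p'.1 from h) rfl)
  obtain ⟨N, _, hN, -, g, hg⟩ := exists_model hW
  refine ⟨N, inferInstance, hN, (hg.comp hι).toElementary, g ∘ τ, hg.inj.comp hτ.inj,
    fun p => ((hg.comp hτ).obj_iff p).2 trivial, fun p q => (hg.comp hτ).rel_iff p q,
    fun p m h => ?_, fun p m h => ?_, fun f p hf => ?_⟩
  · obtain ⟨_, _, h, -⟩ := (rel1 p m).1 ((hg.rel_iff _ _).1 h)
    exact h
  · exact (eq1 p m).1 (hg.inj h)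
  · refine (hg.eval _ _).trans (congrArg g (hβ f p hf ?_ trivial ?_))
    · rintro ⟨_, h⟩; exact h
    · rintro _ ⟨_, h⟩; exact h.elim

/-- Old elements are fixed and old functions select `t (i, 0)` in class `i`, so a correspondence of
indices has to respect only equality, first coordinates and the passage to `(i, 0)`. -/
theorem isPartIso_grid {M N : Type*} [selLang.Structure M] [selLang.Structure N]
    (hN : IsSelectorModel N) {e : M → N} (he : IsEmb e) {t : ℕ × ℕ → N}
    (t_inj : Function.Injective t) (t_obj : ∀ p, IsObj (t p))
    (t_rel : ∀ p q, EqRel (t p) (t q) ↔ p.1 = q.1) (t_e : ∀ p m, ¬ EqRel (t p) (e m))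
    (t_ne : ∀ p m, t p ≠ e m) (t_eval : ∀ f p, ¬ IsObj f → evalAt (e f) (t p) = t (p.1, 0))
    {K : ℕ × ℕ → ℕ × ℕ → Prop} (h1 : ∀ {p p' q q'}, K p p' → K q q' → (p = q ↔ p' = q'))
    (h2 : ∀ {p p' q q'}, K p p' → K q q' → (p.1 = q.1 ↔ p'.1 = q'.1))
    (h3 : ∀ {p p'}, K p p' → K (p.1, 0) (p'.1, 0)) :
    IsPartIso fun x y : N => (∃ m, x = e m ∧ y = e m) ∨ ∃ p q, K p q ∧ x = t p ∧ y = t q := by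
  have hM : ∀ {m}, IsObj (e m) ↔ IsObj m := fun {m} => he.obj_iff m
  constructor
  · rintro _ _ _ _ (⟨m, rfl, rfl⟩ | ⟨p, q, hp, rfl, rfl⟩) (⟨n, rfl, rfl⟩ | ⟨p', q', hp', rfl, rfl⟩)
    · rfl
    · exact iff_of_false (t_ne _ _).symm (t_ne _ _).symm
    · exact iff_of_false (t_ne _ _) (t_ne _ _)
    · rw [t_inj.eq_iff, t_inj.eq_iff, h1 hp hp']
  · rintro _ _ (⟨m, rfl, rfl⟩ | ⟨p, q, hp, rfl, rfl⟩)
    · rfl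
    · exact iff_of_true (t_obj _) (t_obj _)
  · rintro _ _ _ _ (⟨m, rfl, rfl⟩ | ⟨p, q, hp, rfl, rfl⟩) (⟨n, rfl, rfl⟩ | ⟨p', q', hp', rfl, rfl⟩)
    · rfl
    · exact iff_of_false (fun h => t_e _ _ (hN.symm _ _ h)) (fun h => t_e _ _ (hN.symm _ _ h))
    · exact iff_of_false (t_e _ _) (t_e _ _)
    · rw [t_rel, t_rel, h2 hp hp']
  · rintro _ _ _ _ (⟨m, rfl, rfl⟩ | ⟨p, q, hp, rfl, rfl⟩) (⟨n, rfl, rfl⟩ | ⟨p', q', hp', rfl, rfl⟩)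
    · exact .inl ⟨_, he.eval _ _, he.eval _ _⟩
    · by_cases hm : IsObj m
      · rw [evalAt_of_not_fn hN (hM.2 hm), evalAt_of_not_fn hN (hM.2 hm)]
        exact .inr ⟨_, _, hp', rfl, rfl⟩
      · rw [t_eval _ _ hm, t_eval _ _ hm]
        exact .inr ⟨_, _, h3 hp', rfl, rfl⟩
    · rw [evalAt_of_not_fn hN (t_obj _), evalAt_of_not_fn hN (t_obj _)]
      exact .inl ⟨_, rfl, rfl⟩
    · rw [evalAt_of_not_fn hN (t_obj _), evalAt_of_not_fn hN (t_obj _)]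
      exact .inr ⟨_, _, hp', rfl, rfl⟩

end Grid

/-! ### A formula that forks but does not divide -/

section ForkDivide

/-- The formula `eval(x₀, z) = z` for a function `x₀`. -/
def selectsFormula : selLang.Formula (Fin 2 ⊕ Fin 1) :=
  (atomFormula (.inl (.inl 0))).not ⊓
    atomFormula (.inr (.inr (.inr (.inl 0, .inr 0), .inl (.inr 0))))

/-- The formula `E(x₁, z)`. -/
def sameClassFormula : selLang.Formula (Fin 2 ⊕ Fin 1) :=
  atomFormula (.inr (.inl (.inl 1, .inr 0)))

section
variable {M : Type*} [selLang.Structure M] (x : Fin 2 → M) (z : Fin 1 → M)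

theorem realize_selectsFormula : selectsFormula.Realize (Sum.elim x z) ↔
    ¬ IsObj (x 0) ∧ evalAt (x 0) (z 0) = z 0 := by
  rw [selectsFormula, Formula.realize_inf, Formula.realize_not, realize_atomFormula,
    realize_atomFormula]
  rfl

theorem realize_sameClassFormula : sameClassFormula.Realize (Sum.elim x z) ↔
    EqRel (x 1) (z 0) := by
  rw [sameClassFormula, realize_atomFormula]
  rfl

end

/-- An indiscernible sequence of objects either lies in one class, and then its first term solves
all the conditions `E(x₁, z)`, or is pairwise inequivalent, and then a new function can select all
its terms. -/
theorem not_divides_selects {M : Type u} [selLang.Structure M] [M ⊨ selectorTheory] {A : Set M}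
    {b : Fin 1 → M} (hb : IsObj (b 0)) :
    ¬ ForkDiv.Divides A (selectsFormula ⊔ sameClassFormula) b := by
  classical
  rintro ⟨N, _, e, s, hs, hi, I, hI⟩
  have := model_of_elementary e
  have hN := isSelectorModel_of_model N
  have hobj : ∀ i, IsObj (s i 0) := fun i => by
    rw [hi.isObj_iff 0 i 0, hs]
    exact ((isEmb_elementary e).obj_iff _).2 hb
  apply hI
  by_cases hE : EqRel (s 0 0) (s 1 0)
  · refine ⟨fun _ => s 0 0, fun i _ => ?_⟩
    rw [Formula.realize_sup, realize_sameClassFormula]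
    right
    rcases Nat.eq_zero_or_pos i with rfl | h
    · exact hN.refl _ (hobj 0)
    · exact (hi.eqRel_iff 0 h Nat.zero_lt_one).2 hE
  have hne : ∀ i j, EqRel (s i 0) (s j 0) → i = j := by
    intro i j h
    rcases lt_trichotomy i j with hij | hij | hij
    · exact absurd ((hi.eqRel_iff 0 hij Nat.zero_lt_one).1 h) hE
    · exact hij
    · exact absurd ((hi.eqRel_iff 0 hij Nat.zero_lt_one).1 (hN.symm _ _ h)) hE
  obtain ⟨rep, hr, hr'⟩ := exists_rep hN
  -- A single function without objects, to be amalgamated with `N` so that it selects according to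
  -- `sel`.
  let _ : selLang.Structure Unit := mkStructure (fun _ => False) (fun _ _ => False) fun _ y => y
  have hP : IsSelectorModel Unit := by apply mkStructure_isSelectorModel <;> simp
  let sel : N → N := fun y => if h : ∃ i, EqRel y (s i 0) then s h.choose 0 else rep y
  have sel_pos : ∀ y i, EqRel y (s i 0) → sel y = s i 0 := by
    intro y i h
    have hex : ∃ i, EqRel y (s i 0) := ⟨i, h⟩
    have h1 : sel y = s hex.choose 0 := dif_pos hex
    rw [h1, hne _ _ (hN.trans _ _ _ (hN.symm _ _ hex.choose_spec) h)]
  have sel_rel : ∀ y, IsObj y → EqRel (sel y) y := by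
    intro y hy
    by_cases h : ∃ i, EqRel y (s i 0)
    · obtain ⟨i, h⟩ := h
      rw [sel_pos y i h]
      exact hN.symm _ _ h
    · have h1 : sel y = rep y := dif_neg h
      rw [h1]
      exact hr y hy
  have sel_congr : ∀ y y', EqRel y y' → sel y = sel y' := by
    intro y y' hy
    by_cases h : ∃ i, EqRel y' (s i 0)
    · obtain ⟨i, h⟩ := h
      rw [sel_pos y' i h, sel_pos y i (hN.trans _ _ _ hy h)]
    · have h' : ¬ ∃ i, EqRel y (s i 0) := by
        rintro ⟨i, h'⟩
        exact h ⟨i, hN.trans _ _ _ (hN.symm _ _ hy) h'⟩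
      have h1 : sel y = rep y := dif_neg h'
      have h2 : sel y' = rep y' := dif_neg h
      rw [h1, h2, hr' _ _ hy]
  obtain ⟨W, _, ι, τ, hW, hι, hτ, -, -, hα, -⟩ :=
    exists_amalgam hN hP (isPartIso_false (M := Unit) (N := N)) (fun _ => sel)
      (fun _ p => p) (fun _ _ _ h => sel_rel _ h) (fun _ _ _ _ h => sel_congr _ _ h)
      (fun _ _ _ h => h.elim) (fun _ _ _ _ h => h.elim)
  obtain ⟨N', _, _, -, g, hg⟩ := exists_model hW
  obtain ⟨x, hx⟩ := exists_realize_of_elementary (hg.comp hι).toElementary (ι := I)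
    (selectsFormula ⊔ sameClassFormula) (fun i => s i) ⟨fun _ => g (τ ()), fun i => by
      rw [Formula.realize_sup, realize_selectsFormula]
      refine .inl ⟨fun h => ((hg.comp hτ).obj_iff ()).1 h, ?_⟩
      refine (hg.eval _ _).trans (congrArg g ?_)
      refine (hα () _ not_false ?_ (hobj _) ?_).trans
        (congrArg ι (sel_pos _ _ (hN.refl _ (hobj _))))
      · rintro ⟨_, h⟩; exact h
      · rintro _ ⟨_, h⟩; exact h.elim⟩
  exact ⟨x, fun i hi => hx ⟨i, hi⟩⟩

/-- The first disjunct divides along a sequence within one class of the grid, since a function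
selects one object per class. The second divides along a sequence of inequivalent objects. -/
theorem exists_forks_not_divides (M : Type u) [selLang.Structure M] [M ⊨ selectorTheory] :
    ∃ (N : Type u) (_ : selLang.Structure N) (e : M ↪ₑ[selLang] N) (b : Fin 1 → N),
      ForkDiv.Forks (Set.range e) (selectsFormula ⊔ sameClassFormula) b ∧
        ¬ ForkDiv.Divides (Set.range e) (selectsFormula ⊔ sameClassFormula) b := by
  obtain ⟨N, _, _, e, t, t_inj, t_obj, t_rel, t_e, t_ne, t_eval⟩ := exists_grid M
  have hN := isSelectorModel_of_model N
  refine ⟨N, inferInstance, e, fun _ => t (0, 1), ?_, not_divides_selects (t_obj _)⟩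
  have key : ∀ (s : ℕ → ℕ × ℕ), (∀ (r : ℕ) (i j : Fin r → ℕ), StrictMono i → StrictMono j →
      ∃ K : ℕ × ℕ → ℕ × ℕ → Prop, (∀ {p p' q q'}, K p p' → K q q' → (p = q ↔ p' = q')) ∧
      (∀ {p p' q q'}, K p p' → K q q' → (p.1 = q.1 ↔ p'.1 = q'.1)) ∧
      (∀ {p p'}, K p p' → K (p.1, 0) (p'.1, 0)) ∧ ∀ a, K (s (i a)) (s (j a))) →
      ForkDiv.IsIndiscernible (L := selLang)
        (ElementaryEmbedding.refl selLang N '' (ElementaryEmbedding.refl selLang N '' Set.range e))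
        (fun i (_ : Fin 1) => t (s i)) := by
    intro s h
    refine isIndiscernible_of_sameQF fun r i j hi hj => ?_
    obtain ⟨K, h1, h2, h3, h4⟩ := h r i j hi hj
    refine ⟨_, isPartIso_grid hN (isEmb_elementary e) t_inj t_obj t_rel t_e t_ne t_eval h1 h2 h3, ?_⟩
    rintro (⟨_, _, ⟨_, ⟨m, rfl⟩, rfl⟩, rfl⟩ | p)
    · exact .inl ⟨m, rfl, rfl⟩
    · exact .inr ⟨_, _, h4 p.1, rfl, rfl⟩
  refine ⟨N, inferInstance, .refl selLang N, 2, fun _ => 1,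
    ![selectsFormula, sameClassFormula], fun _ _ => t (0, 1), ?_, ?_⟩
  · intro i
    fin_cases i
    -- The index is shifted because `t (0, 0)` is the value of the old functions in this class and
    -- must be fixed.
    · refine ⟨N, inferInstance, .refl selLang N, fun i _ => t (0, i + 1), rfl,
        key (fun i => (0, i + 1)) ?_, {0, 1}, ?_⟩
      · intro r i j hi hj
        refine ⟨fun p q => (∃ a, p = (0, i a + 1) ∧ q = (0, j a + 1)) ∨ (p = (0, 0) ∧ q = (0, 0)),
          ?_, ?_, ?_, fun a => .inl ⟨a, rfl, rfl⟩⟩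
        · rintro _ _ _ _ (⟨a, rfl, rfl⟩ | ⟨rfl, rfl⟩) (⟨b, rfl, rfl⟩ | ⟨rfl, rfl⟩)
          · simp [hi.injective.eq_iff, hj.injective.eq_iff]
          · simp
          · simp
          · simp
        · rintro _ _ _ _ (⟨a, rfl, rfl⟩ | ⟨rfl, rfl⟩) (⟨b, rfl, rfl⟩ | ⟨rfl, rfl⟩) <;> simp
        · rintro _ _ (⟨a, rfl, rfl⟩ | ⟨rfl, rfl⟩) <;> exact .inr ⟨rfl, rfl⟩
      · rintro ⟨x, hx⟩
        have h0 := (realize_selectsFormula _ _).1 (hx 0 (by simp))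
        have h1 := (realize_selectsFormula _ _).1 (hx 1 (by simp))
        have h2 := evalAt_congr hN h0.1 ((t_rel (0, 1) (0, 2)).2 rfl)
        have := t_inj (h0.2.symm.trans (h2.trans h1.2))
        simp at this
    · refine ⟨N, inferInstance, .refl selLang N, fun i _ => t (i, 1), rfl,
        key (fun i => (i, 1)) ?_, {0, 1}, ?_⟩
      · intro r i j hi hj
        refine ⟨fun p q => ∃ a, p.1 = i a ∧ q.1 = j a ∧ p.2 = q.2, ?_, ?_, ?_,
          fun a => ⟨a, rfl, rfl, rfl⟩⟩
        · rintro ⟨p1, p2⟩ ⟨p1', p2'⟩ ⟨q1, q2⟩ ⟨q1', q2'⟩ ⟨a, h1, h2, h3⟩ ⟨b, h1', h2', h3'⟩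
          simp only at h1 h2 h3 h1' h2' h3'
          subst_vars
          simp [hi.injective.eq_iff, hj.injective.eq_iff]
        · rintro p p' q q' ⟨a, h1, h2, -⟩ ⟨b, h1', h2', -⟩
          rw [h1, h1', h2, h2', hi.injective.eq_iff, hj.injective.eq_iff]
        · rintro p p' ⟨a, h1, h2, -⟩
          exact ⟨a, h1, h2, rfl⟩
      · rintro ⟨x, hx⟩
        have h0 := (realize_sameClassFormula _ _).1 (hx 0 (by simp))
        have h1 := (realize_sameClassFormula _ _).1 (hx 1 (by simp))
        have := (t_rel (0, 1) (1, 1)).1 (hN.trans _ _ _ (hN.symm _ _ h0) h1)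
        simp at this
  · intro x hx
    rcases Formula.realize_sup.1 hx with h | h
    · exact ⟨0, h⟩
    · exact ⟨1, h⟩

end ForkDivide

/-! ### Free extensions -/

section Free

variable {N : Type*} [selLang.Structure N] {P : Type*} [selLang.Structure P]
  {Q : Type*} [selLang.Structure Q] {A : Type*}

/-- `Q` is generated freely by `N` and `P` over their common family of elements, except that
functions of `P` select new objects `ν y` in the classes of `N` and functions of `N` select
given representatives in the classes of `P`. -/
structure IsFree (j : A → P) (i : A → N) (rep : P → P) (ι : N → Q) (τ : P → Q) (ν : N → Q) :
    Prop where
  emb_left : IsEmb ι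
  emb_right : IsEmb τ
  eq_iff : ∀ p n, τ p = ι n ↔ genRel j i p n
  rel_iff : ∀ p n, EqRel (τ p) (ι n) ↔ ∃ p' n', genRel j i p' n' ∧ EqRel p p' ∧ EqRel n' n
  new_rel : ∀ y, IsObj y → EqRel (ν y) (ι y)
  new_congr : ∀ y y', EqRel y y' → ν y = ν y'
  new_ne : ∀ y z, ν y ≠ ι z
  eval_right : ∀ f y, ¬ IsObj f → f ∉ closed j → IsObj y → (∀ y' ∈ closed i, ¬ EqRel y y') →
    evalAt (τ f) (ι y) = ν y
  eval_left : ∀ g x, ¬ IsObj g → g ∉ closed i → IsObj x → (∀ x' ∈ closed j, ¬ EqRel x x') →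
    evalAt (ι g) (τ x) = τ (rep x)

/-- Doubling `N` inside its own classes creates objects that are not in `N`. The twin of the
representative of a class serves as the common choice of the functions coming from `P`. -/
theorem exists_isFree {N P : Type u} [selLang.Structure N] [selLang.Structure P]
    (hN : IsSelectorModel N) (hP : IsSelectorModel P) {j : A → P} {i : A → N} (h : SameQF j i)
    {rep : P → P} (hr : ∀ x, IsObj x → EqRel (rep x) x)
    (hr' : ∀ x y, EqRel x y → rep x = rep y) :
    ∃ (Q : Type u) (_ : selLang.Structure Q) (_ : Q ⊨ selectorTheory) (_ : Nonempty Q)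
      (ι : N → Q) (τ : P → Q) (ν : N → Q), IsFree j i rep ι τ ν := by
  classical
  obtain ⟨rN, hn, hn'⟩ := exists_rep hN
  let π : N ⊕ N → N := Sum.elim id id
  -- Selectors keep their values in the first summand, so `Sum.inl` remains an embedding.
  let _ : selLang.Structure (N ⊕ N) := mkStructure (fun w => IsObj (π w))
    (fun w w' => EqRel (π w) (π w'))
    (fun w w' => if ¬ IsObj (π w) ∧ IsObj (π w') then .inl (evalAt (π w) (π w')) else w')
  have ev_pos : ∀ w w' : N ⊕ N, ¬ IsObj (π w) → IsObj (π w') →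
      evalAt w w' = .inl (evalAt (π w) (π w')) := fun w w' h h' => if_pos ⟨h, h'⟩
  have ev_neg : ∀ w w' : N ⊕ N, (IsObj (π w) ∨ ¬ IsObj (π w')) → evalAt w w' = w' :=
    fun w w' h => if_neg (by tauto)
  have hNN : IsSelectorModel (N ⊕ N) := by
    refine mkStructure_isSelectorModel (fun x y => hN.rel_obj _ _) (fun x => hN.refl _)
      (fun x y => hN.symm _ _) (fun x y z => hN.trans _ _ _) (fun f b hf hb => ?_)
      (fun f b b' hf hb => ?_) ev_neg
    · rw [if_pos ⟨hf, hb⟩]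
      exact evalAt_eqRel hN hb
    · have := hN.rel_obj _ _ hb
      rw [if_pos ⟨hf, this.1⟩, if_pos ⟨hf, this.2⟩, evalAt_congr hN hf hb]
  have hinl : IsEmb (Sum.inl : N → N ⊕ N) := by
    refine ⟨Sum.inl_injective, fun _ => Iff.rfl, fun _ _ => Iff.rfl, fun x y => ?_⟩
    by_cases hxy : ¬ IsObj x ∧ IsObj y
    · exact ev_pos (.inl x) (.inl y) hxy.1 hxy.2
    · rw [ev_neg (.inl x) (.inl y) (by change IsObj x ∨ ¬ IsObj y; tauto), hN.eval_off]
      rwa [hN.isFn_iff]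
  have hG := h.isPartIso hP hN
  obtain ⟨W, _, ι, τ, hW, hι, hτ, eq1, rel1, hα, hβ⟩ :=
    exists_amalgam hNN hP (hG.comp hinl.isPartIso) (fun _ w => .inr (rN (π w))) (fun _ x => rep x)
      (fun _ y _ h => hn (π y) h) (fun _ y y' _ h => congrArg Sum.inr (hn' _ _ h))
      (fun _ x _ h => hr x h) (fun _ x x' _ h => hr' _ _ h)
  obtain ⟨Q, _, hQ, hne, g, hg⟩ := exists_model hW
  refine ⟨Q, inferInstance, hQ, hne, g ∘ ι ∘ Sum.inl, g ∘ τ, fun y => g (ι (.inr (rN y))), ?_⟩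
  have dom : ∀ {x y}, (∃ z, genRel j i x z ∧ y = (Sum.inl z : N ⊕ N)) →
      x ∈ closed j ∧ ∃ z ∈ closed i, y = .inl z := by
    rintro x y ⟨z, ⟨t, rfl, rfl⟩, rfl⟩
    exact ⟨⟨t, rfl⟩, _, ⟨t, rfl⟩, rfl⟩
  refine ⟨hg.comp (hι.comp hinl), hg.comp hτ, fun p n => ?_, fun p n => ?_, fun y hy => ?_,
    fun y y' h => ?_, fun y z h => ?_, fun f y h1 h2 h3 h4 => ?_, fun f y h1 h2 h3 h4 => ?_⟩
  · refine hg.inj.eq_iff.trans ((eq1 p (.inl n)).trans ⟨?_, fun h => ⟨n, h, rfl⟩⟩)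
    rintro ⟨z, hz, h⟩
    rwa [Sum.inl_injective h]
  · refine (hg.rel_iff _ _).trans ((rel1 p (.inl n)).trans ⟨?_, ?_⟩)
    · rintro ⟨p', _, ⟨z, hz, rfl⟩, h1, h2⟩
      exact ⟨p', z, hz, h1, h2⟩
    · rintro ⟨p', n', h1, h2, h3⟩
      exact ⟨p', .inl n', ⟨n', h1, rfl⟩, h2, h3⟩
  · exact (hg.rel_iff _ _).2 ((hι.rel_iff _ _).2 (hn y hy))
  · exact congrArg (fun z => g (ι (.inr z))) (hn' _ _ h)
  · exact absurd (hι.inj (hg.inj h)) (by simp)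
  · refine (hg.eval _ _).trans (congrArg g (hα f (.inl y) h1 ?_ h3 ?_))
    · rintro ⟨_, h⟩
      exact h2 (dom h).1
    · rintro _ ⟨_, h⟩ he
      obtain ⟨-, z, hz, rfl⟩ := dom h
      exact h4 z hz he
  · refine (hg.eval _ _).trans (congrArg g (hβ (.inl f) y h1 ?_ h3 ?_))
    · rintro ⟨_, h⟩
      obtain ⟨-, z, hz, hfz⟩ := dom h
      exact h2 (Sum.inl_injective hfz ▸ hz)
    · rintro x' ⟨_, h⟩ he
      exact h4 x' (dom h).1 he

variable {N' : Type*} [selLang.Structure N'] {Q' : Type*} [selLang.Structure Q']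

/-- The relation between free extensions induced by a relation between the bases. -/
def freeRel (i : A → N) (ι : N → Q) (τ : P → Q) (ν : N → Q) (ι' : N' → Q') (τ' : P → Q')
    (ν' : N' → Q') (K : N → N' → Prop) (z : Q) (z' : Q') : Prop :=
  (∃ x x', K x x' ∧ z = ι x ∧ z' = ι' x') ∨ (∃ p, z = τ p ∧ z' = τ' p) ∨
    ∃ x x', K x x' ∧ IsObj x ∧ (∀ y ∈ closed i, ¬ EqRel x y) ∧ z = ν x ∧ z' = ν' x'

/-- The clauses of `IsFree` determine all relations and values from data preserved by `K` as soon as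
`K` respects the common family. Hence `K` extends by `τ p ↦ τ' p` and `ν x ↦ ν' x'`. -/
theorem isPartIso_freeRel (hN : IsSelectorModel N) (hN' : IsSelectorModel N')
    (hQ : IsSelectorModel Q) (hQ' : IsSelectorModel Q') {j : A → P} {i : A → N} {i' : A → N'}
    {rep : P → P} {ι : N → Q} {τ : P → Q} {ν : N → Q} {ι' : N' → Q'} {τ' : P → Q'} {ν' : N' → Q'}
    (hF : IsFree j i rep ι τ ν) (hF' : IsFree j i' rep ι' τ' ν') {K : N → N' → Prop}
    (hK : IsPartIso K) (hi : ∀ a, K (i a) (i' a)) :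
    IsPartIso (freeRel i ι τ ν ι' τ' ν' K) := by
  have Kt : ∀ t, K (tval i t) (tval i' t) := hK.tval hi
  have τι : ∀ t, τ (tval j t) = ι (tval i t) := fun t => (hF.eq_iff _ _).2 ⟨t, rfl, rfl⟩
  have τι' : ∀ t, τ' (tval j t) = ι' (tval i' t) := fun t => (hF'.eq_iff _ _).2 ⟨t, rfl, rfl⟩
  have gen_iff : ∀ {p x x'}, K x x' → (τ p = ι x ↔ τ' p = ι' x') := by
    intro p x x' h
    rw [hF.eq_iff, hF'.eq_iff]
    refine exists_congr fun t => and_congr_right fun _ => ?_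
    exact hK.eq_iff h (Kt t)
  have link_iff : ∀ {p x x'}, K x x' → (EqRel (τ p) (ι x) ↔ EqRel (τ' p) (ι' x')) := by
    intro p x x' h
    rw [hF.rel_iff, hF'.rel_iff]
    constructor
    · rintro ⟨_, _, ⟨t, rfl, rfl⟩, h1, h2⟩
      exact ⟨_, _, ⟨t, rfl, rfl⟩, h1, (hK.rel_iff (Kt t) h).1 h2⟩
    · rintro ⟨_, _, ⟨t, rfl, rfl⟩, h1, h2⟩
      exact ⟨_, _, ⟨t, rfl, rfl⟩, h1, (hK.rel_iff (Kt t) h).2 h2⟩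
  have near_iff : ∀ {x x'}, K x x' →
      ((∀ y ∈ closed i, ¬ EqRel x y) ↔ ∀ y ∈ closed i', ¬ EqRel x' y) := by
    intro x x' h
    constructor
    · rintro h1 _ ⟨t, rfl⟩ h2
      exact h1 _ ⟨t, rfl⟩ ((hK.rel_iff h (Kt t)).2 h2)
    · rintro h1 _ ⟨t, rfl⟩ h2
      exact h1 _ ⟨t, rfl⟩ ((hK.rel_iff h (Kt t)).1 h2)
  have closed_iff : ∀ {x x'}, K x x' → (x ∈ closed i ↔ x' ∈ closed i') := by
    intro x x' h
    refine exists_congr fun t => ?_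
    rw [eq_comm, hK.eq_iff h (Kt t), eq_comm]
  have νι : ∀ {x}, IsObj x → EqRel (ν x) (ι x) := fun h => hF.new_rel _ h
  have νι' : ∀ {x}, IsObj x → EqRel (ν' x) (ι' x) := fun h => hF'.new_rel _ h
  have ν_eq : ∀ {x y}, IsObj x → IsObj y → (ν x = ν y ↔ EqRel x y) := by
    intro x y hx hy
    refine ⟨fun h => ?_, hF.new_congr x y⟩
    rw [← hF.emb_left.rel_iff]
    refine hQ.trans _ _ _ (hQ.symm _ _ (νι hx)) ?_
    rw [h]
    exact νι hy
  have ν_eq' : ∀ {x y}, IsObj x → IsObj y → (ν' x = ν' y ↔ EqRel x y) := by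
    intro x y hx hy
    refine ⟨fun h => ?_, hF'.new_congr x y⟩
    rw [← hF'.emb_left.rel_iff]
    refine hQ'.trans _ _ _ (hQ'.symm _ _ (νι' hx)) ?_
    rw [h]
    exact νι' hy
  -- A class that misses the common family contains nothing from `P`; hence the restriction on `ν x`
  -- in `freeRel`.
  have ν_ne : ∀ {p x}, IsObj x → (∀ y ∈ closed i, ¬ EqRel x y) → τ p ≠ ν x := by
    intro p x hx h he
    have := νι hx
    rw [← he, hF.rel_iff] at this
    obtain ⟨_, _, ⟨t, rfl, rfl⟩, -, h2⟩ := this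
    exact h _ ⟨t, rfl⟩ (hN.symm _ _ h2)
  have ν_ne' : ∀ {p x}, IsObj x → (∀ y ∈ closed i', ¬ EqRel x y) → τ' p ≠ ν' x := by
    intro p x hx h he
    have := νι' hx
    rw [← he, hF'.rel_iff] at this
    obtain ⟨_, _, ⟨t, rfl, rfl⟩, -, h2⟩ := this
    exact h _ ⟨t, rfl⟩ (hN'.symm _ _ h2)
  set R := freeRel i ι τ ν ι' τ' ν' K with hR
  have obj : ∀ {z z'}, R z z' → (IsObj z ↔ IsObj z') := by
    rintro _ _ (⟨x, x', h, rfl, rfl⟩ | ⟨p, rfl, rfl⟩ | ⟨x, x', h, hx, -, rfl, rfl⟩)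
    · rw [hF.emb_left.obj_iff, hF'.emb_left.obj_iff, hK.obj_iff h]
    · rw [hF.emb_right.obj_iff, hF'.emb_right.obj_iff]
    · exact iff_of_true (hQ.rel_obj _ _ (νι hx)).1 (hQ'.rel_obj _ _ (νι' ((hK.obj_iff h).1 hx))).1
  -- up to `E`, an element belongs to one of the bases
  have base : ∀ {z z'}, R z z' → ∃ w w', ((∃ x x', K x x' ∧ w = ι x ∧ w' = ι' x') ∨
      ∃ p, w = τ p ∧ w' = τ' p) ∧ (w = z ∨ EqRel w z) ∧ (w' = z' ∨ EqRel w' z') := by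
    rintro _ _ (⟨x, x', h, rfl, rfl⟩ | ⟨p, rfl, rfl⟩ | ⟨x, x', h, hx, -, rfl, rfl⟩)
    · exact ⟨_, _, .inl ⟨x, x', h, rfl, rfl⟩, .inl rfl, .inl rfl⟩
    · exact ⟨_, _, .inr ⟨p, rfl, rfl⟩, .inl rfl, .inl rfl⟩
    · exact ⟨_, _, .inl ⟨x, x', h, rfl, rfl⟩, .inr (hQ.symm _ _ (νι hx)),
        .inr (hQ'.symm _ _ (νι' ((hK.obj_iff h).1 hx)))⟩
  have congr_base : ∀ {w z u v : Q}, (w = z ∨ EqRel w z) → (u = v ∨ EqRel u v) →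
      (EqRel w u ↔ EqRel z v) := by
    rintro w z u v (rfl | h) (rfl | h')
    · rfl
    · exact eqRel_congr_right hQ h'
    · exact eqRel_congr_left hQ h
    · rw [eqRel_congr_left hQ h, eqRel_congr_right hQ h']
  have congr_base' : ∀ {w z u v : Q'}, (w = z ∨ EqRel w z) → (u = v ∨ EqRel u v) →
      (EqRel w u ↔ EqRel z v) := by
    rintro w z u v (rfl | h) (rfl | h')
    · rfl
    · exact eqRel_congr_right hQ' h'
    · exact eqRel_congr_left hQ' h
    · rw [eqRel_congr_left hQ' h, eqRel_congr_right hQ' h']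
  constructor
  · rintro _ _ _ _ (⟨x, x', h, rfl, rfl⟩ | ⟨p, rfl, rfl⟩ | ⟨x, x', h, hx, hn, rfl, rfl⟩)
      (⟨y, y', k, rfl, rfl⟩ | ⟨q, rfl, rfl⟩ | ⟨y, y', k, ky, kn, rfl, rfl⟩)
    · rw [hF.emb_left.inj.eq_iff, hF'.emb_left.inj.eq_iff, hK.eq_iff h k]
    · rw [eq_comm, gen_iff h, eq_comm]
    · exact iff_of_false (hF.new_ne _ _).symm (hF'.new_ne _ _).symm
    · exact gen_iff k
    · rw [hF.emb_right.inj.eq_iff, hF'.emb_right.inj.eq_iff]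
    · exact iff_of_false (ν_ne ky kn) (ν_ne' ((hK.obj_iff k).1 ky) ((near_iff k).1 kn))
    · exact iff_of_false (hF.new_ne _ _) (hF'.new_ne _ _)
    · exact iff_of_false (ν_ne hx hn).symm
        (ν_ne' ((hK.obj_iff h).1 hx) ((near_iff h).1 hn)).symm
    · rw [ν_eq hx ky, ν_eq' ((hK.obj_iff h).1 hx) ((hK.obj_iff k).1 ky), hK.rel_iff h k]
  · exact obj
  · intro z z' u u' hz hu
    obtain ⟨w, w', hw, h1, h2⟩ := base hz
    obtain ⟨v, v', hv, h3, h4⟩ := base hu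
    rw [← congr_base h1 h3, ← congr_base' h2 h4]
    rcases hw with ⟨x, x', h, rfl, rfl⟩ | ⟨p, rfl, rfl⟩ <;>
      rcases hv with ⟨y, y', k, rfl, rfl⟩ | ⟨q, rfl, rfl⟩
    · rw [hF.emb_left.rel_iff, hF'.emb_left.rel_iff, hK.rel_iff h k]
    · rw [eqRel_comm hQ, link_iff h, eqRel_comm hQ']
    · exact link_iff k
    · rw [hF.emb_right.rel_iff, hF'.emb_right.rel_iff]
  · intro z z' u u' hz hu
    by_cases oz : IsObj z
    · rwa [evalAt_of_not_fn hQ oz, evalAt_of_not_fn hQ' ((obj hz).1 oz)]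
    have oz' : ¬ IsObj z' := (obj hz).not.1 oz
    by_cases ou : ¬ IsObj u
    · rwa [evalAt_of_not_obj hQ ou, evalAt_of_not_obj hQ' ((obj hu).not.1 ou)]
    rw [not_not] at ou
    obtain ⟨v, v', hv, h3, h4⟩ := base hu
    have e1 : evalAt z u = evalAt z v := by
      rcases h3 with rfl | h3
      · rfl
      · exact (evalAt_congr hQ oz h3).symm
    have e2 : evalAt z' u' = evalAt z' v' := by
      rcases h4 with rfl | h4
      · rfl
      · exact (evalAt_congr hQ' oz' h4).symm
    have ov : IsObj v := by
      rcases h3 with rfl | h3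
      · exact ou
      · exact (hQ.rel_obj _ _ h3).1
    rw [e1, e2]
    clear hu h3 h4 e1 e2
    rcases hz with ⟨g, g', h, rfl, rfl⟩ | ⟨f, rfl, rfl⟩ | ⟨x, x', -, hx, -, rfl, -⟩
    · rcases hv with ⟨y, y', k, rfl, rfl⟩ | ⟨q, rfl, rfl⟩
      · rw [hF.emb_left.eval, hF'.emb_left.eval]
        exact .inl ⟨_, _, hK.eval h k, rfl, rfl⟩
      · rw [hF.emb_left.obj_iff] at oz
        rw [hF'.emb_left.obj_iff] at oz'
        rw [hF.emb_right.obj_iff] at ov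
        -- A function from the common part is evaluated in `P`, an argument in a class of the common
        -- part is replaced by one from `N`, and otherwise the rule with `rep` applies.
        by_cases hg : g ∈ closed i
        · obtain ⟨t, rfl⟩ := hg
          obtain rfl := (hK.eq_iff (Kt t) h).1 rfl
          rw [← τι, ← τι', hF.emb_right.eval, hF'.emb_right.eval]
          exact .inr (.inl ⟨_, rfl, rfl⟩)
        by_cases hq : ∀ x' ∈ closed j, ¬ EqRel q x'
        · rw [hF.eval_left g q oz hg ov hq, hF'.eval_left g' q oz' ((closed_iff h).not.1 hg) ov hq]
          exact .inr (.inl ⟨_, rfl, rfl⟩)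
        · push Not at hq
          obtain ⟨_, ⟨t, rfl⟩, hq⟩ := hq
          rw [evalAt_congr hQ (by rwa [hF.emb_left.obj_iff]) ((hF.emb_right.rel_iff _ _).2 hq),
            evalAt_congr hQ' (by rwa [hF'.emb_left.obj_iff]) ((hF'.emb_right.rel_iff _ _).2 hq),
            τι, τι', hF.emb_left.eval, hF'.emb_left.eval]
          exact .inl ⟨_, _, hK.eval h (Kt t), rfl, rfl⟩
    · rcases hv with ⟨y, y', k, rfl, rfl⟩ | ⟨q, rfl, rfl⟩
      · rw [hF.emb_right.obj_iff] at oz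
        rw [hF.emb_left.obj_iff] at ov
        by_cases hf : f ∈ closed j
        · obtain ⟨t, rfl⟩ := hf
          rw [τι, τι', hF.emb_left.eval, hF'.emb_left.eval]
          exact .inl ⟨_, _, hK.eval (Kt t) k, rfl, rfl⟩
        by_cases hy : ∀ x' ∈ closed i, ¬ EqRel y x'
        · rw [hF.eval_right f y oz hf ov hy,
            hF'.eval_right f y' oz hf ((hK.obj_iff k).1 ov) ((near_iff k).1 hy)]
          exact .inr (.inr ⟨y, y', k, ov, hy, rfl, rfl⟩)
        · push Not at hy
          obtain ⟨_, ⟨t, rfl⟩, hy⟩ := hy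
          rw [evalAt_congr hQ (by rwa [hF.emb_right.obj_iff]) ((hF.emb_left.rel_iff _ _).2 hy),
            evalAt_congr hQ' oz' ((hF'.emb_left.rel_iff _ _).2 ((hK.rel_iff k (Kt t)).1 hy)),
            ← τι, ← τι', hF.emb_right.eval, hF'.emb_right.eval]
          exact .inr (.inl ⟨_, rfl, rfl⟩)
      · rw [hF.emb_right.eval, hF'.emb_right.eval]
        exact .inr (.inl ⟨_, rfl, rfl⟩)
    · exact absurd (hQ.rel_obj _ _ (νι hx)).1 oz

end Free

/-! ### Types over sets and quantifier-free types -/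

section TypesOverSets

variable {M : Type u} [selLang.Structure M]

theorem sameQF_of_sameType (hM : IsSelectorModel M) {A : Set M} {k : ℕ} {b b' : Fin k → M}
    (h : ForkDiv.SameType selLang A b b') :
    SameQF (Sum.elim (fun a : A => (a : M)) b) (Sum.elim (fun a : A => (a : M)) b') := by
  refine (sameQF_iff hM hM).2 fun a => ?_
  have key : ∀ v : Fin k → M,
      Formula.Realize (BoundedFormula.constantsVarsEquiv.symm (atomFormula a)) v ↔
        atomHolds (Sum.elim (fun a : A => (a : M)) v) a := by
    intro v
    rw [Formula.Realize, ← BoundedFormula.realize_constantsVarsEquiv, Equiv.apply_symm_apply,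
      ← realize_atomFormula]
    simp only [coe_con]
    rfl
  rw [← key, ← key]
  exact h _

theorem _root_.ForkDiv.IsIndiscernible.sameType {A : Set M} {k : ℕ} {s : ℕ → Fin k → M}
    (h : ForkDiv.IsIndiscernible (L := selLang) A s) (i j : ℕ) :
    ForkDiv.SameType selLang A (s i) (s j) := by
  intro ψ
  have := h 1 (ψ.relabel fun a => ((0 : Fin 1), a)) (fun _ => i) (fun _ => j)
    (Subsingleton.strictMono _) (Subsingleton.strictMono _)
  rwa [Formula.realize_relabel, Formula.realize_relabel] at this

end TypesOverSets

/-! ### Free extensions neither divide nor fork -/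

section FreeTypes

theorem IsFree.realize_iff {N P Q N' Q' A κ : Type*} [selLang.Structure N] [selLang.Structure P]
    [selLang.Structure Q] [selLang.Structure N'] [selLang.Structure Q'] (hN : IsSelectorModel N)
    (hN' : IsSelectorModel N') [Q ⊨ selectorTheory] [Q' ⊨ selectorTheory] {j : A → P} {i : A → N}
    {i' : A → N'} {rep : P → P} {ι : N → Q} {τ : P → Q} {ν : N → Q} {ι' : N' → Q'} {τ' : P → Q'}
    {ν' : N' → Q'} (hF : IsFree j i rep ι τ ν) (hF' : IsFree j i' rep ι' τ' ν')
    {K : N → N' → Prop} (hK : IsPartIso K) (hi : ∀ a, K (i a) (i' a)) {n : ℕ} (d : Fin n → P)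
    {b : κ → N} {b' : κ → N'} (hb : ∀ a, K (b a) (b' a)) (φ : selLang.Formula (Fin n ⊕ κ)) :
    φ.Realize (Sum.elim (τ ∘ d) (ι ∘ b)) ↔ φ.Realize (Sum.elim (τ' ∘ d) (ι' ∘ b')) := by
  refine SameQF.realize_iff ⟨_, isPartIso_freeRel hN hN' (isSelectorModel_of_model Q)
    (isSelectorModel_of_model Q') hF hF' hK hi, ?_⟩ φ
  rintro (a | a)
  · exact .inr (.inl ⟨_, rfl, rfl⟩)
  · exact .inl ⟨_, _, hb a, rfl, rfl⟩

variable {N P Q : Type u} [selLang.Structure N] [selLang.Structure P]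
  [selLang.Structure Q] [N ⊨ selectorTheory] [P ⊨ selectorTheory] [Q ⊨ selectorTheory]
  {A : Type*} {j : A → P} {i : A → N} {rep : P → P} {ι : N → Q} {τ : P → Q} {ν : N → Q} {n k : ℕ}

/-- The terms of an indiscernible sequence have the same type over the common family. By canonicity,
in a free extension of the model containing the sequence the one tuple `τ' ∘ d` satisfies every
instance. -/
theorem IsFree.not_divides (hF : IsFree j i rep ι τ ν) (h : SameQF j i)
    (hr : ∀ x, IsObj x → EqRel (rep x) x) (hr' : ∀ x y, EqRel x y → rep x = rep y) {B : Set N}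
    (hB : ∀ a, i a ∈ B) (d : Fin n → P) {ψ : selLang.Formula (Fin n ⊕ Fin k)} {c : Fin k → N}
    (hψ : ψ.Realize (Sum.elim (τ ∘ d) (ι ∘ c))) : ¬ ForkDiv.Divides B ψ c := by
  rintro ⟨N', _, e, s, hs, hind, I, hI⟩
  have := model_of_elementary e
  have hN := isSelectorModel_of_model N
  have hN' := isSelectorModel_of_model N'
  have he := isEmb_elementary e
  obtain ⟨Q', _, _, -, ι', τ', ν', hF'⟩ := exists_isFree hN' (isSelectorModel_of_model P)
    (h.trans (he.sameQF i)) hr hr'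
  have h0 : ψ.Realize (Sum.elim (τ' ∘ d) (ι' ∘ s 0)) := by
    refine (hF.realize_iff hN hN' hF' he.isPartIso (fun a => rfl) d (fun a => ?_) ψ).1 hψ
    rw [hs]
    rfl
  have hm : ∀ m, ψ.Realize (Sum.elim (τ' ∘ d) (ι' ∘ s m)) := by
    intro m
    obtain ⟨K, hK, hKv⟩ := sameQF_of_sameType hN' (hind.sameType 0 m)
    exact (hF'.realize_iff hN' hN' hF' hK (fun a => hKv (.inl ⟨_, _, hB a, rfl⟩)) d
      (fun a => hKv (.inr a)) ψ).1 h0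
  obtain ⟨x, hx⟩ := exists_realize_of_elementary hF'.emb_left.toElementary (ι := I) ψ
    (fun m => s m) ⟨τ' ∘ d, fun m => hm m⟩
  exact hI ⟨x, fun m hmI => hx ⟨m, hmI⟩⟩

/-- A free extension exists over the elementary extension in which forking is witnessed. There `τ' ∘
d` satisfies `φ` but none of the dividing formulas, and elementarity yields a tuple below that
violates the implication. -/
theorem IsFree.not_forks (hF : IsFree j i rep ι τ ν) (h : SameQF j i)
    (hr : ∀ x, IsObj x → EqRel (rep x) x) (hr' : ∀ x y, EqRel x y → rep x = rep y) {B : Set N}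
    (hB : ∀ a, i a ∈ B) (d : Fin n → P) {φ : selLang.Formula (Fin n ⊕ Fin k)} {b : Fin k → N}
    (hφ : φ.Realize (Sum.elim (τ ∘ d) (ι ∘ b))) : ¬ ForkDiv.Forks B φ b := by
  rintro ⟨N', _, e, r, l, ψ, c, hdiv, himp⟩
  have := model_of_elementary e
  have hN := isSelectorModel_of_model N
  have hN' := isSelectorModel_of_model N'
  have he := isEmb_elementary e
  have h' := h.trans (he.sameQF i)
  obtain ⟨Q', _, _, -, ι', τ', ν', hF'⟩ := exists_isFree hN' (isSelectorModel_of_model P) h' hr hr'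
  have hφ' : φ.Realize (Sum.elim (τ' ∘ d) (ι' ∘ e ∘ b)) :=
    (hF.realize_iff hN hN' hF' he.isPartIso (fun a => rfl) d (fun a => rfl) φ).1 hφ
  have hψ : ∀ m, ¬ (ψ m).Realize (Sum.elim (τ' ∘ d) (ι' ∘ c m)) := fun m hm =>
    hF'.not_divides h' hr hr' (fun a => Set.mem_image_of_mem e (hB a)) d hm (hdiv m)
  let χ : selLang.Formula (Fin n ⊕ (Fin k ⊕ (m : Fin r) × Fin (l m))) :=
    φ.relabel (Sum.map id Sum.inl) ⊓
      Formula.iInf fun m => ((ψ m).relabel (Sum.map id fun a => .inr ⟨m, a⟩)).not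
  have hχ : ∀ {Z : Type u} [selLang.Structure Z] (x : Fin n → Z) (y : Fin k → Z)
      (z : ∀ m, Fin (l m) → Z), χ.Realize (Sum.elim x (Sum.elim y fun p => z p.1 p.2)) ↔
        φ.Realize (Sum.elim x y) ∧ ∀ m, ¬ (ψ m).Realize (Sum.elim x (z m)) := by
    intro Z _ x y z
    rw [Formula.realize_inf, Formula.realize_relabel, Formula.realize_iInf]
    simp only [Formula.realize_not, Formula.realize_relabel, Sum.elim_comp_map, Function.comp_id,
      Sum.elim_comp_inl]
    rfl
  obtain ⟨x, hx⟩ := exists_realize_of_elementary hF'.emb_left.toElementary (ι := Unit) χ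
    (fun _ => Sum.elim (e ∘ b) fun p => c p.1 p.2) ⟨τ' ∘ d, fun _ => by
      rw [Sum.comp_elim]
      exact (hχ (τ' ∘ d) (ι' ∘ e ∘ b) fun m => ι' ∘ c m).2 ⟨hφ', hψ⟩⟩
  have hx' := (hχ x (e ∘ b) c).1 (hx ())
  obtain ⟨m, hm⟩ := himp x hx'.1
  exact hx'.2 m hm

end FreeTypes

/-! ### Global invariant non-forking extensions -/

section Global

theorem model_of_completeTheory {M : Type*} [selLang.Structure M] [M ⊨ selectorTheory] {A : Set M}
    {P : Type*} [selLang.Structure P] [(selLang[[A]]).Structure P]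
    [(selLang.lhomWithConstants A).IsExpansionOn P] [P ⊨ (selLang[[A]]).completeTheory M] :
    P ⊨ selectorTheory := by
  refine ⟨fun φ hφ => ?_⟩
  rw [← LHom.realize_onSentence P (selLang.lhomWithConstants A)]
  refine Theory.realize_sentence_of_mem ((selLang[[A]]).completeTheory M) ?_
  rw [mem_completeTheory, LHom.realize_onSentence]
  exact Theory.realize_sentence_of_mem selectorTheory hφ

theorem sameQF_of_completeTheory {M : Type*} [selLang.Structure M] [M ⊨ selectorTheory] {A : Set M}
    {P : Type*} [selLang.Structure P] [P ⊨ selectorTheory] [(selLang[[A]]).Structure P]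
    [(selLang.lhomWithConstants A).IsExpansionOn P] [P ⊨ (selLang[[A]]).completeTheory M] :
    SameQF (fun a : A => ((selLang.con a : (selLang[[A]]).Constants) : P))
      (fun a : A => (a : M)) := by
  refine (sameQF_iff (isSelectorModel_of_model P) (isSelectorModel_of_model M)).2 fun a => ?_
  have h := realize_iff_of_model_completeTheory (L := selLang[[A]]) M P
    (Formula.equivSentence (atomFormula a))
  have h1 := Formula.realize_equivSentence P (atomFormula a)
  have h2 := Formula.realize_equivSentence M (atomFormula a)
  rw [realize_atomFormula] at h1 h2
  simp only [coe_con] at h2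
  exact h1.symm.trans (h.trans h2)

theorem realize_instantiate {M Q : Type*} [selLang.Structure M] [selLang.Structure Q]
    [(selLang[[M]]).Structure Q] [(selLang.lhomWithConstants M).IsExpansionOn Q] {n k : ℕ}
    (φ : selLang.Formula (Fin n ⊕ Fin k)) (b : Fin k → M) (v : Fin n → Q) :
    (ForkDiv.instantiate φ b).Realize v ↔ φ.Realize
      (Sum.elim v fun a => ((selLang.con (b a) : (selLang[[M]]).Constants) : Q)) := by
  rw [ForkDiv.instantiate, Formula.Realize, BoundedFormula.realize_subst, ← Formula.Realize,
    LHom.realize_onFormula]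
  have : (fun a => Term.realize v (Sum.elim (fun i => Term.var i)
      (fun a => (selLang.con (b a)).term) a : (selLang[[M]]).Term (Fin n))) =
      Sum.elim v fun a => ((selLang.con (b a) : (selLang[[M]]).Constants) : Q) := by
    funext a
    rcases a with a | a
    · rfl
    · exact Term.realize_constants
  rw [this]

/-- A model `P` realising `p` is amalgamated freely with `M` over `A`, and `q` is the type over `M`
of the realisation. Invariance is canonicity applied to partial isomorphisms of `M` that fix `A`. -/
theorem exists_global_extension (M : Type u) [selLang.Structure M] [Nonempty M]
    [M ⊨ selectorTheory] (A : Set M) (n : ℕ) (p : ForkDiv.TypeOver selLang M A n) :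
    ∃ q : ForkDiv.GlobalType selLang M n,
      ForkDiv.Extends q p ∧ q.Invariant A ∧ ¬ q.ForksOver A := by
  obtain ⟨P, d, rfl⟩ := Theory.exists_modelType_is_realized_in _ p
  let _ : selLang.Structure P := (selLang.lhomWithConstants A).reduct P
  have : (selLang.lhomWithConstants A).IsExpansionOn P := LHom.isExpansionOn_reduct _ _
  have hP : P ⊨ selectorTheory := model_of_completeTheory (M := M) (A := A)
  have hM := isSelectorModel_of_model M
  have h := sameQF_of_completeTheory (M := M) (A := A) (P := P)
  obtain ⟨rep, hr, hr'⟩ := exists_rep (isSelectorModel_of_model P)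
  obtain ⟨Q, _, _, _, ι, τ, ν, hF⟩ := exists_isFree hM (isSelectorModel_of_model P) h hr hr'
  let _ : (constantsOn M).Structure Q := constantsOn.structure ι
  have hQ : Q ⊨ selLang.elementaryDiagram M := by
    refine ⟨fun φ hφ => ?_⟩
    refine (realize_iff_of_constants (M := M) (N := Q) ⟨_, hF.emb_left.isPartIso, ?_⟩ φ).1 hφ
    rintro (a | a)
    · rfl
    · exact a.elim
  have hq : ∀ {k : ℕ} (φ : selLang.Formula (Fin n ⊕ Fin k)) (b : Fin k → M),
      ForkDiv.GlobalType.Contains (Theory.typeOf (selLang.elementaryDiagram M) (τ ∘ d)) φ b ↔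
        φ.Realize (Sum.elim (τ ∘ d) (ι ∘ b)) := fun φ b =>
    Theory.CompleteType.formula_mem_typeOf.trans (realize_instantiate φ b (τ ∘ d))
  refine ⟨Theory.typeOf (selLang.elementaryDiagram M) (τ ∘ d), fun φ hφ => ?_, ?_, ?_⟩
  · rw [Theory.CompleteType.formula_mem_typeOf] at hφ ⊢
    let _ : (constantsOn A).Structure Q := constantsOn.structure fun a => ι a
    have : (LHom.constantsOnMap ((↑) : A → M)).IsExpansionOn Q := constantsOnMap_isExpansionOn rfl
    have : (selLang.lhomWithConstantsMap ((↑) : A → M)).IsExpansionOn Q :=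
      LHom.sumMap_isExpansionOn _ _ _
    rw [LHom.realize_onFormula]
    refine (realize_iff_of_constants (M := P) (N := Q) ⟨_, hF.emb_right.isPartIso, ?_⟩ φ).1 hφ
    rintro (a | a)
    -- The two embeddings agree on `A`, so the type of the realisation over `A` is still `p`.
    · exact ((hF.eq_iff _ _).2 (genRel_base _ _ a)).symm
    · rfl
  · intro k φ b b' hb
    rw [hq, hq]
    obtain ⟨K, hK, hKv⟩ := sameQF_of_sameType hM hb
    exact hF.realize_iff hM hM hF hK (fun a => hKv (.inl a)) d (fun a => hKv (.inr a)) φ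
  · rintro ⟨k, φ, b, hφ, hfork⟩
    exact hF.not_forks h hr hr' (fun a => a.2) d ((hq φ b).1 hφ) hfork

end Global

end Selector

theorem corollary9p18 :
    -- `T*₁` is a complete theory, it is `NSOP₁` and `NSOP₃`
    selectorTheory.IsComplete ∧
    ForkDiv.NSOP₁.{u} selectorTheory ∧
    ForkDiv.NSOP₃.{u} selectorTheory ∧
    -- some formula forks but does not divide, over every model
    (∃ (n k : ℕ) (φ : selLang.Formula (Fin n ⊕ Fin k)),
      ∀ (M : Type u) [selLang.Structure M] [Nonempty M] [M ⊨ selectorTheory],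
        ∃ (N : Type u) (_ : selLang.Structure N) (e : M ↪ₑ[selLang] N) (b : Fin k → N),
          ForkDiv.Forks (Set.range e) φ b ∧ ¬ ForkDiv.Divides (Set.range e) φ b) ∧
    -- every complete type has a global extension that is invariant and does not fork over its domain
    (∀ (M : Type u) [selLang.Structure M] [Nonempty M] [M ⊨ selectorTheory] (A : Set M) (n : ℕ)
      (p : ForkDiv.TypeOver selLang M A n),
        ∃ q : ForkDiv.GlobalType selLang M n,
          ForkDiv.Extends q p ∧ q.Invariant A ∧ ¬ q.ForksOver A) :=
  ⟨Selector.selectorTheory_isComplete, Selector.nsop₁, Selector.nsop₃,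
    ⟨2, 1, _, fun M _ _ _ => Selector.exists_forks_not_divides M⟩,
    fun M _ _ _ A n p => Selector.exists_global_extension M A n p⟩
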